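/- Let $M\in\{1,2\}$, $L\ge 0$, $A\in\mathbb R^{2\times2}$ and $B=(b_1,\dots,b_M)\in\mathbb R^{2\times M}$ with $\operatorname{rank}[b_i,Ab_i]=2$ for $i=1,\dots,M$. Then there is a time $\mathcal T>0$, depending only on $L$, $A$ and $B$, such that the following holds for all $F:\mathbb R^2\to\mathbb R^2$ and $G=(G_1,\dots,G_M):\mathbb R^2\to\mathbb R^{2\times M}$ of class $\mathcal C^{1,1}$ whose first-order partial derivatives are Lipschitz with constant $L$ and which satisfy $F(0)=0$, $DF(0)=A$, $G(0)=B$, $DG(0)=0$, and for all $0<\tau<\mathcal T$. Consider the control system $\dot y=F(y)+G(y)u$ with measurable controls $u(t)\in[-1,1]^M$. Let $T(x)\in[0,+\infty]$ be the minimum time to steer $x$ to the origin, let $\mathcal R_t$ be the set of points which can be steered to the origin within the time $t$, and let $h(x,p)=\min\{\langle p,F(x)+G(x)w\rangle : w\in[-1,1]^M\}$. For $K\subset\mathbb R^2$ and $x\in K$ let $N_K(x)$ be the proximal normal cone, i.e. the set of $v$ such that, for some $\sigma\ge0$, $\langle v,y-x\rangle\le\sigma\|y-x\|^2$ for all $y\in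 K$. Put $$S=\{x\in\mathcal R_\tau:\ \text{there is } \zeta\in N_{\mathcal R_{T(x)}}(x),\ \|\zeta\|=1,\ \text{with } h(x,\zeta)=0\}.$$ Then: 1. $S$ is exactly the set of those $x\in\mathcal R_\tau$ at which $T$ is non-Lipschitz, i.e. for which there are sequences $x_i\ne y_i$ of points where $T$ is finite, both converging to $x$, with $\limsup_i |T(y_i)-T(x_i)|/\|y_i-x_i\|=+\infty$. 2. $S$ is countably $\mathcal H^1$-rectifiable: it is $\mathcal H^1$-measurable and, up to an $\mathcal H^1$-null set, it is covered by countably many Lipschitz images of $\mathbb R$. 3. Either $S$ is empty or it consists of exactly two optimal trajectories of the reversed dynamics: there are two distinct trajectories $x_1,x_2$ on $[0,\tau]$ of $\dot x=-F(x)-G(x)u$, $x(0)=0$, $u\in[-1,1]^M$, with $T(x_j(\tau))=\tau$ for $j=1,2$, such that $S=x_1([0,\tau])\cup x_2([0,\tau])$. 4. For every $\bar x\in S$ there is $\delta>0$ such that $\mathcal H^1(S\cap B(\bar x,\delta))>0$. -/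

import Mathlib

open MeasureTheory Set Filter Topology
open scoped NNReal ENNReal

noncomputable section

namespace MinTime

/-- The state space `ℝ²` with its Euclidean norm. -/
abbrev Plane : Type := EuclideanSpace ℝ (Fin 2)

/-- `F` is of class `C^{1,1}` on the plane, and all first order partial derivatives of its
components are Lipschitz with constant `L`. -/
def IsC11 (L : ℝ≥0) (F : Plane → Plane) : Prop :=
  ContDiff ℝ 1 F ∧
    ∀ j k : Fin 2, LipschitzWith L (fun x => fderiv ℝ F x (EuclideanSpace.single k 1) j)

/-- The `2 × 2` matrix with columns `v` and `w`. -/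
def columns (v w : Plane) : Matrix (Fin 2) (Fin 2) ℝ :=
  Matrix.of fun j k => (![v, w] k) j

/-- The control-affine dynamics `F x + G x w`, where `G i` is the `i`-th column of `G`. -/
def dynamics {M : ℕ} (F : Plane → Plane) (G : Fin M → Plane → Plane)
    (x : Plane) (w : Fin M → ℝ) : Plane :=
  F x + ∑ i, w i • G i x

/-- Admissible controls: measurable functions of time with values in `[-1,1]^M` a.e. -/
def IsControl {M : ℕ} (u : ℝ → Fin M → ℝ) : Prop :=
  Measurable u ∧ ∀ᵐ s : ℝ, u s ∈ Icc (-1 : Fin M → ℝ) 1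

/-- `y` is a Carathéodory solution on `[0,t]` of `y' = f(y,u)`, `y(0) = x`, in integral form.
(For continuous `f`, continuous `y` and an admissible `u` the integrand is bounded and measurable,
so that this says that `y` is absolutely continuous and solves the equation a.e.) -/
def IsTrajectory {M : ℕ} (f : Plane → (Fin M → ℝ) → Plane) (u : ℝ → Fin M → ℝ)
    (x : Plane) (t : ℝ) (y : ℝ → Plane) : Prop :=
  ContinuousOn y (Icc 0 t) ∧ ∀ r ∈ Icc 0 t, y r = x + ∫ s in (0 : ℝ)..r, f (y s) (u s)

/-- Some admissible control steers `x` to the origin at time `t`. -/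
def Steers {M : ℕ} (F : Plane → Plane) (G : Fin M → Plane → Plane) (x : Plane) (t : ℝ) : Prop :=
  0 ≤ t ∧ ∃ u : ℝ → Fin M → ℝ, IsControl u ∧
    ∃ y : ℝ → Plane, IsTrajectory (dynamics F G) u x t y ∧ y t = 0

/-- The minimum time to reach the origin (`⊤` if the origin cannot be reached from `x`). -/
def minTime {M : ℕ} (F : Plane → Plane) (G : Fin M → Plane → Plane) (x : Plane) : ℝ≥0∞ :=
  ⨅ (t : ℝ) (_ : Steers F G x t), ENNReal.ofReal t

/-- The set of points which can be steered to the origin within the time `t`. -/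
def reachable {M : ℕ} (F : Plane → Plane) (G : Fin M → Plane → Plane) (t : ℝ) : Set Plane :=
  {x | ∃ s ≤ t, Steers F G x s}

/-- The minimized Hamiltonian, the minimum of `⟨p, F x + G x w⟩` over `w ∈ [-1,1]^M`
(attained, since the cube is compact and nonempty). -/
def minHamiltonian {M : ℕ} (F : Plane → Plane) (G : Fin M → Plane → Plane) (x p : Plane) : ℝ :=
  sInf ((fun w : Fin M → ℝ => inner ℝ p (dynamics F G x w)) '' Icc (-1) 1)

/-- The proximal normal cone to `K` at a point `x` of `K`. -/
def proximalNormals (K : Set Plane) (x : Plane) : Set Plane :=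
  {v | x ∈ K ∧ ∃ σ : ℝ, 0 ≤ σ ∧ ∀ y ∈ K, inner ℝ v (y - x) ≤ σ * ‖y - x‖ ^ 2}

/-- The points `x` of `R_τ` at which some unit proximal normal to the sublevel `R_{T(x)}`
annihilates the minimized Hamiltonian. -/
def singularSet {M : ℕ} (F : Plane → Plane) (G : Fin M → Plane → Plane) (τ : ℝ) : Set Plane :=
  {x | x ∈ reachable F G τ ∧
    ∃ ζ : Plane, ‖ζ‖ = 1 ∧ ζ ∈ proximalNormals (reachable F G (minTime F G x).toReal) x ∧
      minHamiltonian F G x ζ = 0}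

/-- `f` is non-Lipschitz at `x`: there are points `a i ≠ b i` of the domain `{f < ⊤}`, converging
to `x`, along which the difference quotients of `f` have upper limit `+∞`. -/
def NonLipschitzAt (f : Plane → ℝ≥0∞) (x : Plane) : Prop :=
  ∃ a b : ℕ → Plane, (∀ i, a i ≠ b i) ∧ (∀ i, f (a i) ≠ ⊤) ∧ (∀ i, f (b i) ≠ ⊤) ∧
    Tendsto a atTop (𝓝 x) ∧ Tendsto b atTop (𝓝 x) ∧
    limsup (fun i => ((|(f (b i)).toReal - (f (a i)).toReal| / ‖b i - a i‖ : ℝ) : EReal)) atTop = ⊤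

/-- `x` is, on `[0,τ]`, an optimal trajectory of the reversed dynamics `x' = -F(x) - G(x) u`,
`x(0) = 0`: it reaches its endpoint `x(τ)` in the minimum time. -/
def IsOptimalReversed {M : ℕ} (F : Plane → Plane) (G : Fin M → Plane → Plane) (τ : ℝ)
    (x : ℝ → Plane) : Prop :=
  (∃ u : ℝ → Fin M → ℝ, IsControl u ∧ IsTrajectory (fun z w => -dynamics F G z w) u 0 τ x) ∧
    minTime F G (x τ) = ENNReal.ofReal τ

/-- Countable `H^k`-rectifiability: `E` is `H^k`-measurable and is covered, up to an `H^k`-null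
set, by countably many Lipschitz images of `ℝ^k`. -/
def CountablyRectifiable (k : ℕ) (E : Set Plane) : Prop :=
  (Measure.hausdorffMeasure (k : ℝ) : Measure Plane).toOuterMeasure.IsCaratheodory E ∧
    ∃ f : ℕ → EuclideanSpace ℝ (Fin k) → Plane,
      (∀ n, ∃ K : ℝ≥0, LipschitzWith K (f n)) ∧
        Measure.hausdorffMeasure (k : ℝ) (E \ ⋃ n, range (f n)) = 0

end MinTime

end

/-! Run time backwards. Since `F 0 = 0` one may wait at the origin, so `R_t` is the set of end
points at time `t` of trajectories of the reversed dynamics issuing from 0. All smallness conditions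
are expressed by a constant `C` depending on `L`, `A`, `B` only (`exists_isNice`) and, in the
parallel case below, by a constant `c` of `A` and `B`.

Singular implies non-Lipschitz, once the minimum time is finite nearby
(`not_lipAt_of_mem_singularSet`): if `h(x,ζ) = 0`, no reversed velocity at `x` has a positive
component along `ζ`, so `x + εζ`, which lies outside the sublevel, cannot be reached with a delay of
order `ε`. It remains to find enough singular points and to prove Lipschitz bounds elsewhere.

If two columns of `B` are independent, small points `p` are steered to 0 along a segment in time
`O(‖p‖)`. Then the minimum time is Lipschitz near every point of `R_τ` and the singular set is
empty.

Otherwise `B i = β i • e`, and the rank condition says that `e` and `A e` are independent. The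
constant controls `signs β` and `-signs β` give two reversed extremals `X`, `Y`. Compare `X`, with
velocity `V`, to a reversed trajectory `x` with control `v` through `wedge V (x - X)`. An
integrating factor kills the linear part of its derivative. What is left is a quadratic remainder
and the switching term. The latter has a definite sign and size at least a multiple of `s` times the
gap of the controls, because `V` turns towards `A e` at a linear rate whereas `DG(0) = 0` makes `G
i` deviate from `β i • e` only quadratically. The result is `extremal_inequality`: reachable points
lie on one side of the tangent to `X`, up to a quadratic error, with a gain equal to a multiple of
the moment `∫ s |v - signs β|`. Hence the rotated velocity is a proximal normal that annihilates the
Hamiltonian, `X` is optimal, and `X` and `Y` separate at once.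

Off the two curves, a control steering to the origin has positive moment with respect to both
constant controls. Tilting it towards one or the other, while keeping the new end point `b` fixed,
moves the starting point of the reversed trajectory to either side of the curve formed by `X` and
`Y` (`side_estimate`). By continuity some tilt starts on that curve (`exists_crossing`), at a
parameter `O(‖b - x‖)`. This is the extra time needed, so the minimum time is Lipschitz
(`steer_near`). -/

noncomputable section

namespace MinTime

/-! ### Algebra of the plane: wedge product and trace -/

/-- The determinant of two plane vectors. -/
def wedge (x y : Plane) : ℝ := x 0 * y 1 - x 1 * y 0

theorem wedge_add_right (x y z : Plane) : wedge x (y + z) = wedge x y + wedge x z := by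
  simp [wedge]; ring

theorem wedge_sub_right (x y z : Plane) : wedge x (y - z) = wedge x y - wedge x z := by
  simp [wedge]; ring

theorem wedge_neg_right (x y : Plane) : wedge x (-y) = -wedge x y := by
  simp [wedge]; ring

theorem wedge_smul_right (c : ℝ) (x y : Plane) : wedge x (c • y) = c * wedge x y := by
  simp [wedge]; ring

theorem wedge_add_left (x y z : Plane) : wedge (x + y) z = wedge x z + wedge y z := by
  simp [wedge]; ring

theorem wedge_sub_left (x y z : Plane) : wedge (x - y) z = wedge x z - wedge y z := by
  simp [wedge]; ring

theorem wedge_neg_left (x y : Plane) : wedge (-x) y = -wedge x y := by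
  simp [wedge]; ring

theorem wedge_smul_left (c : ℝ) (x y : Plane) : wedge (c • x) y = c * wedge x y := by
  simp [wedge]; ring

theorem wedge_self (x : Plane) : wedge x x = 0 := by
  simp [wedge]; ring

theorem wedge_swap (x y : Plane) : wedge x y = -wedge y x := by
  simp [wedge]; ring

theorem wedge_sum_right {ι : Type*} (s : Finset ι) (x : Plane) (f : ι → Plane) :
    wedge x (∑ i ∈ s, f i) = ∑ i ∈ s, wedge x (f i) := by
  classical
  induction s using Finset.induction_on with
  | empty => simp [wedge]
  | insert a s ha ih => rw [Finset.sum_insert ha, Finset.sum_insert ha, wedge_add_right, ih]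

theorem norm_sq_plane (x : Plane) : ‖x‖ ^ 2 = x 0 ^ 2 + x 1 ^ 2 := by
  rw [EuclideanSpace.norm_sq_eq]; simp

theorem inner_plane (x y : Plane) : inner ℝ x y = x 0 * y 0 + x 1 * y 1 := by
  simp [PiLp.inner_apply]; ring

/-- Lagrange's identity; a vector is determined by its inner product and its wedge with a unit
vector. -/
theorem inner_sq_add_wedge_sq (x y : Plane) :
    (inner ℝ x y : ℝ) ^ 2 + wedge x y ^ 2 = ‖x‖ ^ 2 * ‖y‖ ^ 2 := by
  rw [inner_plane, norm_sq_plane, norm_sq_plane, wedge]; ring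

theorem abs_wedge_le (x y : Plane) : |wedge x y| ≤ ‖x‖ * ‖y‖ := by
  apply abs_le_of_sq_le_sq _ (by positivity)
  have := inner_sq_add_wedge_sq x y
  nlinarith [sq_nonneg (inner ℝ x y : ℝ)]

/-- The trace of an endomorphism of the plane. -/
def planeTrace (D : Plane →L[ℝ] Plane) : ℝ :=
  D (EuclideanSpace.single 0 1) 0 + D (EuclideanSpace.single 1 1) 1

theorem map_plane_apply (D : Plane →L[ℝ] Plane) (v : Plane) (j : Fin 2) :
    D v j = v 0 * D (EuclideanSpace.single 0 1) j + v 1 * D (EuclideanSpace.single 1 1) j := by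
  have hv : v = v 0 • EuclideanSpace.single 0 1 + v 1 • EuclideanSpace.single 1 1 := by
    ext i; fin_cases i <;> simp
  conv_lhs => rw [hv]
  simp

/-- Infinitesimal form of Liouville's formula: a linear flow changes areas at the rate of its trace.
It provides the integrating factor in `extremal_inequality`. -/
theorem wedge_map_add (D : Plane →L[ℝ] Plane) (v z : Plane) :
    wedge (D v) z + wedge v (D z) = planeTrace D * wedge v z := by
  simp only [wedge, planeTrace]
  rw [map_plane_apply D v 0, map_plane_apply D v 1, map_plane_apply D z 0, map_plane_apply D z 1]
  ring

theorem continuous_planeTrace : Continuous planeTrace := by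
  unfold planeTrace
  fun_prop

theorem norm_le_abs_add_abs (x : Plane) : ‖x‖ ≤ |x 0| + |x 1| := by
  apply le_of_sq_le_sq _ (by positivity)
  rw [norm_sq_plane]
  nlinarith [sq_abs (x 0), sq_abs (x 1), abs_nonneg (x 0), abs_nonneg (x 1)]

theorem abs_apply_le_norm (x : Plane) (j : Fin 2) : |x j| ≤ ‖x‖ := by
  simpa using PiLp.norm_apply_le x j

/-! ### Estimates for `C^{1,1}` fields with uniform constants -/

/-- The derivative of a `C^{1,1}` field is Lipschitz in the operator norm. -/
theorem IsC11.norm_fderiv_sub_le {L : ℝ≥0} {F : Plane → Plane} (h : IsC11 L F) (x y : Plane) :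
    ‖fderiv ℝ F x - fderiv ℝ F y‖ ≤ 4 * L * ‖x - y‖ := by
  refine ContinuousLinearMap.opNorm_le_bound _ (by positivity) fun v => ?_
  have key : ∀ j, |(fderiv ℝ F x - fderiv ℝ F y) v j| ≤ 2 * L * ‖x - y‖ * ‖v‖ := by
    intro j
    rw [map_plane_apply]
    have hk : ∀ k, |(fderiv ℝ F x - fderiv ℝ F y) (EuclideanSpace.single k 1) j| ≤
        L * ‖x - y‖ := by
      intro k
      have := (h.2 j k).dist_le_mul x y
      simpa [Real.dist_eq, dist_eq_norm] using this
    calc _ ≤ |v 0| * |(fderiv ℝ F x - fderiv ℝ F y) (EuclideanSpace.single 0 1) j| +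
          |v 1| * |(fderiv ℝ F x - fderiv ℝ F y) (EuclideanSpace.single 1 1) j| := by
          rw [← abs_mul, ← abs_mul]; exact abs_add_le _ _
      _ ≤ ‖v‖ * (L * ‖x - y‖) + ‖v‖ * (L * ‖x - y‖) := by
          gcongr
          · exact abs_apply_le_norm v 0
          · exact hk 0
          · exact abs_apply_le_norm v 1
          · exact hk 1
      _ = _ := by ring
  calc _ ≤ _ := norm_le_abs_add_abs _
    _ ≤ 2 * L * ‖x - y‖ * ‖v‖ + 2 * L * ‖x - y‖ * ‖v‖ := add_le_add (key 0) (key 1)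
    _ = _ := by ring

/-- The factor `r` is what matters: when the derivative at 0 vanishes, as for the control fields,
the Lipschitz constant on the ball of radius `r` is itself of order `r`. -/
theorem IsC11.norm_sub_sub_le {L : ℝ≥0} {F : Plane → Plane} (h : IsC11 L F) {r : ℝ} {x y : Plane}
    (hx : ‖x‖ ≤ r) (hy : ‖y‖ ≤ r) :
    ‖F x - F y - fderiv ℝ F 0 (x - y)‖ ≤ 4 * L * r * ‖x - y‖ := by
  have hd : Differentiable ℝ F := h.1.differentiable (by simp)
  refine (convex_closedBall (0 : Plane) r).norm_image_sub_le_of_norm_fderiv_le'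
    (fun z _ => hd z) (fun z hz => ?_) (by simpa using hy) (by simpa using hx)
  calc _ ≤ 4 * L * ‖z - 0‖ := h.norm_fderiv_sub_le z 0
    _ ≤ _ := by gcongr; simpa using hz

theorem IsC11.norm_taylor_le {L : ℝ≥0} {F : Plane → Plane} (h : IsC11 L F) (x y : Plane) :
    ‖F y - F x - fderiv ℝ F x (y - x)‖ ≤ 4 * L * ‖y - x‖ ^ 2 := by
  have hd : Differentiable ℝ F := h.1.differentiable (by simp)
  have := (convex_closedBall x ‖y - x‖).norm_image_sub_le_of_norm_fderiv_le' (φ := fderiv ℝ F x)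
    (C := 4 * L * ‖y - x‖)
    (fun z _ => hd z) (fun z hz => ?_) (Metric.mem_closedBall_self (norm_nonneg _))
    (y := y) (by simp [dist_eq_norm])
  · rwa [mul_assoc, ← pow_two] at this
  · calc _ ≤ 4 * L * ‖z - x‖ := h.norm_fderiv_sub_le z x
      _ ≤ _ := by gcongr; simpa [dist_eq_norm] using hz

/-- A system `y' = F y + G y u` near the origin, with all constants bounded by `C`. -/
structure IsNice {M : ℕ} (F : Plane → Plane) (G : Fin M → Plane → Plane)
    (A : Plane →L[ℝ] Plane) (B : Fin M → Plane) (C : ℝ) : Prop where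
  one_le : 1 ≤ C
  card_le : (M : ℝ) ≤ C
  norm_A : ‖A‖ ≤ C
  F_zero : F 0 = 0
  G_zero : ∀ i, G i 0 = B i
  F_contDiff : ContDiff ℝ 1 F
  G_contDiff : ∀ i, ContDiff ℝ 1 (G i)
  F_sub : ∀ r ≤ 1, ∀ x y : Plane, ‖x‖ ≤ r → ‖y‖ ≤ r → ‖F x - F y - A (x - y)‖ ≤ C * r * ‖x - y‖
  G_sub : ∀ i, ∀ r ≤ 1, ∀ x y : Plane, ‖x‖ ≤ r → ‖y‖ ≤ r → ‖G i x - G i y‖ ≤ C * r * ‖x - y‖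
  norm_G : ∀ i, ∀ x : Plane, ‖x‖ ≤ 1 → ‖G i x‖ ≤ C
  norm_le : ∀ x : Plane, ‖x‖ ≤ 1 → ∀ w ∈ Icc (-1 : Fin M → ℝ) 1, ‖dynamics F G x w‖ ≤ C
  lip : ∀ x y : Plane, ‖x‖ ≤ 1 → ‖y‖ ≤ 1 → ∀ w ∈ Icc (-1 : Fin M → ℝ) 1,
    ‖dynamics F G x w - dynamics F G y w‖ ≤ C * ‖x - y‖
  taylor : ∀ w ∈ Icc (-1 : Fin M → ℝ) 1, ∀ x y : Plane,
    ‖dynamics F G y w - dynamics F G x w - fderiv ℝ (fun z => dynamics F G z w) x (y - x)‖ ≤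
      C * ‖y - x‖ ^ 2

theorem abs_le_one_of_mem_cube {M : ℕ} {w : Fin M → ℝ} (hw : w ∈ Icc (-1 : Fin M → ℝ) 1)
    (i : Fin M) : |w i| ≤ 1 :=
  abs_le.2 ⟨by simpa using hw.1 i, by simpa using hw.2 i⟩

theorem mem_cube_of_abs_le_one {M : ℕ} {w : Fin M → ℝ} (hw : ∀ i, |w i| ≤ 1) :
    w ∈ Icc (-1 : Fin M → ℝ) 1 :=
  ⟨fun i => by simpa using (abs_le.1 (hw i)).1, fun i => by simpa using (abs_le.1 (hw i)).2⟩

theorem norm_sum_smul_le {M : ℕ} {w : Fin M → ℝ} (hw : w ∈ Icc (-1 : Fin M → ℝ) 1)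
    {g : Fin M → Plane} {a : ℝ} (hg : ∀ i, ‖g i‖ ≤ a) : ‖∑ i, w i • g i‖ ≤ M * a := by
  calc _ ≤ ∑ i : Fin M, a := norm_sum_le_of_le _ fun i _ => by
        rw [norm_smul]
        calc _ ≤ 1 * ‖g i‖ := by
              gcongr; simpa using abs_le_one_of_mem_cube hw i
          _ ≤ a := by rw [one_mul]; exact hg i
    _ = _ := by simp

/-- Uniform constants for all systems with the same first order data. -/
theorem exists_isNice {M : ℕ} (L : ℝ≥0) (A : Plane →L[ℝ] Plane) (B : Fin M → Plane) :
    ∃ C : ℝ, ∀ (F : Plane → Plane) (G : Fin M → Plane → Plane),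
      IsC11 L F → (∀ i, IsC11 L (G i)) → F 0 = 0 → fderiv ℝ F 0 = A →
      (∀ i, G i 0 = B i) → (∀ i, fderiv ℝ (G i) 0 = 0) → IsNice F G A B C := by
  set b : ℝ := ∑ i, ‖B i‖ with hb
  have hb0 : 0 ≤ b := Finset.sum_nonneg fun i _ => norm_nonneg _
  have hBb : ∀ i, ‖B i‖ ≤ b := fun i =>
    Finset.single_le_sum (f := fun i => ‖B i‖) (fun i _ => norm_nonneg _) (Finset.mem_univ i)
  have hA := norm_nonneg A
  have hL : (0 : ℝ) ≤ L := L.2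
  have hM : (0 : ℝ) ≤ M := Nat.cast_nonneg _
  -- A sum of nonnegative terms that dominates each bound below; `M * (b + 4 * L)` bounds the
  -- controlled part on the unit ball.
  refine ⟨1 + M + ‖A‖ + 4 * L + b + M * (b + 4 * L), fun F G hF hG F0 dF G0 dG => ?_⟩
  have hMb : 0 ≤ M * b := by positivity
  have hML : 0 ≤ M * (4 * L : ℝ) := by positivity
  have hMbL : (M : ℝ) * (b + 4 * L) = M * b + M * (4 * L) := by ring
  set C := 1 + M + ‖A‖ + 4 * L + b + M * (b + 4 * L) with hC
  have hGsub : ∀ i, ∀ r : ℝ, ∀ x y : Plane, ‖x‖ ≤ r → ‖y‖ ≤ r →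
      ‖G i x - G i y‖ ≤ 4 * L * r * ‖x - y‖ := by
    intro i r x y hx hy
    simpa [dG] using (hG i).norm_sub_sub_le hx hy
  have hGn : ∀ i, ∀ x : Plane, ‖x‖ ≤ 1 → ‖G i x‖ ≤ b + 4 * L := by
    intro i x hx
    have h1 := hGsub i 1 x 0 hx (by simp)
    have h2 := norm_sub_norm_le (G i x) (G i 0)
    have h3 : 4 * (L : ℝ) * 1 * ‖x - 0‖ ≤ 4 * L := by
      rw [sub_zero, mul_one]
      exact mul_le_of_le_one_right (by positivity) hx
    have := hBb i
    rw [G0] at *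
    linarith
  have hFsub : ∀ x y : Plane, ‖x‖ ≤ 1 → ‖y‖ ≤ 1 → ‖F x - F y‖ ≤ (‖A‖ + 4 * L) * ‖x - y‖ := by
    intro x y hx hy
    have h1 := hF.norm_sub_sub_le hx hy
    rw [dF] at h1
    have h2 := norm_sub_norm_le (F x - F y) (A (x - y))
    have h3 := A.le_opNorm (x - y)
    nlinarith
  refine ⟨by linarith, by linarith, by linarith, F0, G0, hF.1, fun i => (hG i).1, ?_, ?_, ?_, ?_,
    ?_, ?_⟩
  · intro r _ x y hx hy
    have hr : 0 ≤ r := (norm_nonneg _).trans hx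
    have := hF.norm_sub_sub_le hx hy
    rw [dF] at this
    refine this.trans ?_
    gcongr
    linarith
  · intro i r _ x y hx hy
    have hr : 0 ≤ r := (norm_nonneg _).trans hx
    refine (hGsub i r x y hx hy).trans ?_
    gcongr
    linarith
  · intro i x hx
    have := hGn i x hx
    linarith
  · intro x hx w hw
    have h1 : ‖F x‖ ≤ ‖A‖ + 4 * L := by
      have := hFsub x 0 hx (by simp)
      rw [F0, sub_zero, sub_zero] at this
      exact this.trans (mul_le_of_le_one_right (by positivity) hx)
    have h2 := norm_sum_smul_le hw (fun i => hGn i x hx)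
    have := norm_add_le (F x) (∑ i, w i • G i x)
    unfold dynamics
    linarith
  · intro x y hx hy w hw
    have h1 := hFsub x y hx hy
    have h2 := norm_sum_smul_le hw (g := fun i => G i x - G i y) (a := 4 * L * ‖x - y‖)
      (fun i => by simpa using hGsub i 1 x y hx hy)
    have h3 : dynamics F G x w - dynamics F G y w =
        (F x - F y) + ∑ i, w i • (G i x - G i y) := by
      simp only [dynamics, smul_sub, Finset.sum_sub_distrib]; abel
    rw [h3]
    calc _ ≤ _ := norm_add_le _ _
      _ ≤ (‖A‖ + 4 * L) * ‖x - y‖ + M * (4 * L * ‖x - y‖) := add_le_add h1 h2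
      _ = (‖A‖ + 4 * L + M * (4 * L)) * ‖x - y‖ := by ring
      _ ≤ _ := by gcongr; linarith
  · intro w hw x y
    have hdF : DifferentiableAt ℝ F x := (hF.1.differentiable (by simp)) x
    have hdG : ∀ i, DifferentiableAt ℝ (G i) x := fun i => ((hG i).1.differentiable (by simp)) x
    have hD : fderiv ℝ (fun z => dynamics F G z w) x =
        fderiv ℝ F x + ∑ i, w i • fderiv ℝ (G i) x := by
      refine HasFDerivAt.fderiv ?_
      unfold dynamics
      exact hdF.hasFDerivAt.fun_add (HasFDerivAt.fun_sum fun i _ =>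
        (hdG i).hasFDerivAt.fun_const_smul (w i))
    have h1 := hF.norm_taylor_le x y
    have h2 := norm_sum_smul_le hw (g := fun i => G i y - G i x - fderiv ℝ (G i) x (y - x))
      (a := 4 * L * ‖y - x‖ ^ 2) (fun i => (hG i).norm_taylor_le x y)
    have h3 : dynamics F G y w - dynamics F G x w - fderiv ℝ (fun z => dynamics F G z w) x (y - x)
        = (F y - F x - fderiv ℝ F x (y - x)) +
          ∑ i, w i • (G i y - G i x - fderiv ℝ (G i) x (y - x)) := by
      rw [hD]
      simp only [dynamics, smul_sub, Finset.sum_sub_distrib, add_apply,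
        sum_apply, smul_apply]
      abel
    rw [h3]
    calc _ ≤ _ := norm_add_le _ _
      _ ≤ 4 * L * ‖y - x‖ ^ 2 + M * (4 * L * ‖y - x‖ ^ 2) := add_le_add h1 h2
      _ = (4 * L + M * (4 * L)) * ‖y - x‖ ^ 2 := by ring
      _ ≤ _ := by gcongr; linarith

/-! ### Trajectories of a controlled field near the origin -/

section

/-- A controlled field, bounded and Lipschitz with constant `C` on the unit ball. -/
structure IsField {M : ℕ} (f : Plane → (Fin M → ℝ) → Plane) (C : ℝ) : Prop where
  one_le : 1 ≤ C
  cont : Continuous fun p : Plane × (Fin M → ℝ) => f p.1 p.2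
  norm_le : ∀ x : Plane, ‖x‖ ≤ 1 → ∀ w ∈ Icc (-1 : Fin M → ℝ) 1, ‖f x w‖ ≤ C
  lip : ∀ x y : Plane, ‖x‖ ≤ 1 → ‖y‖ ≤ 1 → ∀ w ∈ Icc (-1 : Fin M → ℝ) 1,
    ‖f x w - f y w‖ ≤ C * ‖x - y‖
  lip_control : ∀ x : Plane, ‖x‖ ≤ 1 → ∀ w w' : Fin M → ℝ,
    ‖f x w - f x w'‖ ≤ C * ∑ i, |w i - w' i|

variable {M : ℕ}

theorem IsNice.isField {F : Plane → Plane} {G : Fin M → Plane → Plane}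
    {A : Plane →L[ℝ] Plane} {B : Fin M → Plane} {C : ℝ} (h : IsNice F G A B C) :
    IsField (dynamics F G) C := by
  refine ⟨h.one_le, ?_, h.norm_le, h.lip, fun x hx w w' => ?_⟩
  · have := h.F_contDiff.continuous
    have := fun i => (h.G_contDiff i).continuous
    unfold dynamics
    fun_prop
  · have : dynamics F G x w - dynamics F G x w' = ∑ i, (w i - w' i) • G i x := by
      simp [dynamics, sub_smul]
    rw [this, Finset.mul_sum]
    refine norm_sum_le_of_le _ fun i _ => ?_
    rw [norm_smul, mul_comm, Real.norm_eq_abs]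
    gcongr
    exact h.norm_G i x hx

theorem IsField.neg {f : Plane → (Fin M → ℝ) → Plane} {C : ℝ} (h : IsField f C) :
    IsField (fun z w => -f z w) C := by
  refine ⟨h.one_le, h.cont.neg, fun x hx w hw => by simpa using h.norm_le x hx w hw,
    fun x y hx hy w hw => ?_, fun x hx w w' => ?_⟩
  · rw [neg_sub_neg, norm_sub_rev]; exact h.lip x y hx hy w hw
  · rw [neg_sub_neg, norm_sub_rev]; exact h.lip_control x hx w w'

theorem IsControl.comp_sub_left {u : ℝ → Fin M → ℝ} (hu : IsControl u) (t : ℝ) :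
    IsControl fun s => u (t - s) :=
  ⟨hu.1.comp (measurable_const.sub measurable_id),
    (Measure.measurePreserving_sub_left volume t).quasiMeasurePreserving.ae hu.2⟩

theorem IsControl.comp_sub_right {u : ℝ → Fin M → ℝ} (hu : IsControl u) (t : ℝ) :
    IsControl fun s => u (s - t) :=
  ⟨hu.1.comp (measurable_id.sub measurable_const),
    (measurePreserving_sub_right volume t).quasiMeasurePreserving.ae hu.2⟩

theorem isControl_const {w : Fin M → ℝ} (hw : w ∈ Icc (-1 : Fin M → ℝ) 1) :
    IsControl fun _ : ℝ => w :=
  ⟨measurable_const, Eventually.of_forall fun _ => hw⟩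

theorem IsControl.ite {u v : ℝ → Fin M → ℝ} (hu : IsControl u) (hv : IsControl v) (s : ℝ) :
    IsControl fun r => if r < s then u r else v r := by
  refine ⟨Measurable.ite measurableSet_Iio hu.1 hv.1, ?_⟩
  filter_upwards [hu.2, hv.2] with r h1 h2
  split_ifs <;> assumption

theorem IsField.intervalIntegrable {f : Plane → (Fin M → ℝ) → Plane} {C : ℝ} (hf : IsField f C)
    {u : ℝ → Fin M → ℝ} (hu : IsControl u) {y : ℝ → Plane} {t : ℝ}
    (hy : ContinuousOn y (Icc 0 t)) {r r' : ℝ} (hr : r ∈ Icc 0 t) (hr' : r' ∈ Icc 0 t) :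
    IntervalIntegrable (fun s => f (y s) (u s)) volume r r' := by
  have hsub : uIcc r r' ⊆ Icc 0 t := (convex_Icc 0 t).ordConnected.uIcc_subset hr hr'
  -- Compactness bounds the integrand even if `y` leaves the unit ball, where `norm_le` says
  -- nothing.
  have hK : IsCompact ((y '' Icc 0 t) ×ˢ Icc (-1 : Fin M → ℝ) 1) :=
    (isCompact_Icc.image_of_continuousOn hy).prod isCompact_Icc
  obtain ⟨K, hK⟩ := (hK.image hf.cont).isBounded.exists_norm_le
  have hmeas : AEStronglyMeasurable (fun s => f (y s) (u s)) (volume.restrict (Icc 0 t)) := by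
    have h1 : AEMeasurable y (volume.restrict (Icc 0 t)) := hy.aemeasurable measurableSet_Icc
    have h2 : AEMeasurable u (volume.restrict (Icc 0 t)) := hu.1.aemeasurable
    exact (hf.cont.measurable.comp_aemeasurable (h1.prodMk h2)).aestronglyMeasurable
  have hint : IntegrableOn (fun s => f (y s) (u s)) (Icc 0 t) := by
    refine Integrable.of_bound hmeas K ?_
    rw [ae_restrict_iff' measurableSet_Icc]
    filter_upwards [hu.2] with s hs hst
    exact hK _ ⟨(y s, u s), ⟨⟨s, hst, rfl⟩, hs⟩, rfl⟩
  rw [intervalIntegrable_iff']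
  exact hint.mono_set hsub

section Trajectories

variable {f : Plane → (Fin M → ℝ) → Plane} {C : ℝ} {u : ℝ → Fin M → ℝ} {p : Plane} {t : ℝ}
  {y : ℝ → Plane}

theorem IsTrajectory.sub_eq (hf : IsField f C) (hu : IsControl u) (hy : IsTrajectory f u p t y)
    {r r' : ℝ} (hr : r ∈ Icc 0 t) (hr' : r' ∈ Icc 0 t) :
    y r' - y r = ∫ s in r..r', f (y s) (u s) := by
  have h0 : (0 : ℝ) ∈ Icc 0 t := ⟨le_rfl, hr.1.trans hr.2⟩
  rw [hy.2 r hr, hy.2 r' hr', add_sub_add_left_eq_sub,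
    intervalIntegral.integral_interval_sub_left (hf.intervalIntegrable hu hy.1 h0 hr')
    (hf.intervalIntegrable hu hy.1 h0 hr)]

theorem IsTrajectory.apply_zero (hy : IsTrajectory f u p t y) (ht : 0 ≤ t) : y 0 = p := by
  rw [hy.2 0 ⟨le_rfl, ht⟩]; simp

theorem IsTrajectory.mono (hy : IsTrajectory f u p t y) {t' : ℝ} (ht : t' ≤ t) :
    IsTrajectory f u p t' y :=
  ⟨hy.1.mono (Icc_subset_Icc_right ht), fun r hr => hy.2 r ⟨hr.1, hr.2.trans ht⟩⟩

theorem IsTrajectory.norm_sub_le_of_forall (hf : IsField f C) (hu : IsControl u)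
    (hy : IsTrajectory f u p t y) {r r' : ℝ} (hr : r ∈ Icc 0 t) (hr' : r' ∈ Icc 0 t)
    (hb : ∀ s ∈ uIoo r r', ‖y s‖ ≤ 1) : ‖y r' - y r‖ ≤ C * |r' - r| := by
  rw [hy.sub_eq hf hu hr hr']
  refine intervalIntegral.norm_integral_le_of_norm_le_const_ae ?_
  -- The integral runs over a half-open interval, while the bound is assumed on the open one only.
  have h1 : ∀ᵐ s : ℝ, s ≠ max r r' := by simp [ae_iff, measure_singleton]
  filter_upwards [hu.2, h1] with s hs hne hsr
  refine hf.norm_le _ (hb s ⟨hsr.1, lt_of_le_of_ne hsr.2 hne⟩) _ hs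

/-- Up to the first time at which the norm reaches 1, the speed is at most `C`, so the path is too
short to have reached the unit sphere. -/
theorem IsTrajectory.norm_lt_one (hf : IsField f C) (hu : IsControl u)
    (hy : IsTrajectory f u p t y) (hp : ‖p‖ + C * t < 1) {r : ℝ} (hr : r ∈ Icc 0 t) :
    ‖y r‖ < 1 := by
  by_contra! hcon
  have ht : 0 ≤ t := hr.1.trans hr.2
  have hcont : ContinuousOn (fun s => ‖y s‖) (Icc 0 t) := hy.1.norm
  have hcl : IsClosed (Icc 0 t ∩ (fun s => ‖y s‖) ⁻¹' Ici 1) :=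
    hcont.preimage_isClosed_of_isClosed isClosed_Icc isClosed_Ici
  have hcomp : IsCompact (Icc 0 t ∩ (fun s => ‖y s‖) ⁻¹' Ici 1) :=
    isCompact_Icc.of_isClosed_subset hcl inter_subset_left
  obtain ⟨r0, ⟨hr0, hr1⟩, hmin⟩ := hcomp.exists_isLeast ⟨r, hr, hcon⟩
  have h0 : (0 : ℝ) ∈ Icc 0 t := ⟨le_rfl, ht⟩
  have hb : ∀ s ∈ uIoo 0 r0, ‖y s‖ ≤ 1 := by
    intro s hs
    rw [uIoo_of_le hr0.1] at hs
    by_contra! h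
    exact absurd (hmin ⟨⟨hs.1.le, hs.2.le.trans hr0.2⟩, h.le⟩) (not_le.2 hs.2)
  have h2 := hy.norm_sub_le_of_forall hf hu h0 hr0 hb
  rw [hy.apply_zero ht, sub_zero, abs_of_nonneg hr0.1] at h2
  have h3 := norm_sub_norm_le (y r0) p
  have h4 : C * r0 ≤ C * t := by
    have := hf.one_le
    gcongr
    exact hr0.2
  have h5 : (1 : ℝ) ≤ ‖y r0‖ := hr1
  linarith

theorem IsTrajectory.norm_sub_le (hf : IsField f C) (hu : IsControl u)
    (hy : IsTrajectory f u p t y) (hp : ‖p‖ + C * t < 1) {r r' : ℝ} (hr : r ∈ Icc 0 t)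
    (hr' : r' ∈ Icc 0 t) : ‖y r' - y r‖ ≤ C * |r' - r| := by
  refine hy.norm_sub_le_of_forall hf hu hr hr' fun s hs => (hy.norm_lt_one hf hu hp ?_).le
  exact (convex_Icc 0 t).ordConnected.uIcc_subset hr hr' (uIoo_subset_uIcc_self hs)

theorem IsTrajectory.norm_le (hf : IsField f C) (hu : IsControl u)
    (hy : IsTrajectory f u p t y) (hp : ‖p‖ + C * t < 1) {r : ℝ} (hr : r ∈ Icc 0 t) :
    ‖y r‖ ≤ ‖p‖ + C * r := by
  have h0 : (0 : ℝ) ∈ Icc 0 t := ⟨le_rfl, hr.1.trans hr.2⟩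
  have h1 := hy.norm_sub_le hf hu hp h0 hr
  rw [hy.apply_zero h0.2, sub_zero, abs_of_nonneg hr.1] at h1
  have := norm_sub_norm_le (y r) p
  linarith

theorem IsTrajectory.reverse (hf : IsField f C) (hu : IsControl u)
    (hy : IsTrajectory f u p t y) (ht : 0 ≤ t) :
    IsTrajectory (fun z w => -f z w) (fun s => u (t - s)) (y t) t (fun s => y (t - s)) := by
  have hmem : ∀ r ∈ Icc 0 t, t - r ∈ Icc 0 t := fun r hr => ⟨by linarith [hr.2], by linarith [hr.1]⟩
  refine ⟨hy.1.comp (by fun_prop) hmem, fun r hr => ?_⟩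
  have h1 := hy.sub_eq hf hu (hmem r hr) ⟨ht, le_rfl⟩
  rw [intervalIntegral.integral_neg,
    intervalIntegral.integral_comp_sub_left (fun s => f (y s) (u s)) t, sub_zero, ← h1]
  abel

theorem IsTrajectory.concat (hf : IsField f C) (hu : IsControl u)
    {s : ℝ} (hs : 0 ≤ s) (ht : 0 ≤ t) (hy : IsTrajectory f u p s y)
    {v : ℝ → Fin M → ℝ} (hv : IsControl v) {y' : ℝ → Plane}
    (hy' : IsTrajectory f v (y s) t y') :
    IsTrajectory f (fun r => if r < s then u r else v (r - s)) p (s + t)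
      (fun r => if r ≤ s then y r else y' (r - s)) := by
  set Y : ℝ → Plane := fun r => if r ≤ s then y r else y' (r - s) with hY
  set U : ℝ → Fin M → ℝ := fun r => if r < s then u r else v (r - s) with hU
  have hYs : ∀ r, s ≤ r → Y r = y' (r - s) := by
    intro r hr
    rcases hr.eq_or_lt with rfl | hr
    · simp [hY, hy'.apply_zero ht]
    · simp [hY, not_le.2 hr]
  have hU' : IsControl U := hu.ite (hv.comp_sub_right s) s
  have hcont : ContinuousOn Y (Icc 0 (s + t)) := by
    have h1 : ContinuousOn Y (Icc 0 s) := hy.1.congr fun r hr => by simp [hY, hr.2]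
    have h2 : ContinuousOn Y (Icc s (s + t)) := by
      refine ContinuousOn.congr (f := fun r => y' (r - s))
        (hy'.1.comp (by fun_prop) fun r hr => ?_) fun r hr => hYs r hr.1
      exact ⟨by linarith [hr.1], by linarith [hr.2]⟩
    rw [← Icc_union_Icc_eq_Icc hs (by linarith : s ≤ s + t)]
    exact h1.union_of_isClosed h2 isClosed_Icc isClosed_Icc
  have hne : ∀ᵐ r : ℝ, r ≠ s := by simp [ae_iff, measure_singleton]
  have hfirst : ∀ r ∈ Icc 0 s, Y r = p + ∫ q in (0 : ℝ)..r, f (Y q) (U q) := by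
    intro r hr
    have : Y r = y r := by simp [hY, hr.2]
    rw [this, hy.2 r hr]
    congr 1
    refine intervalIntegral.integral_congr_ae ?_
    filter_upwards [hne] with q hq hqr
    rw [uIoc_of_le hr.1] at hqr
    have h1 : q < s := lt_of_le_of_ne (hqr.2.trans hr.2) hq
    simp [hY, hU, h1, h1.le]
  refine ⟨hcont, fun r hr => ?_⟩
  rcases le_total r s with hrs | hrs
  · exact hfirst r ⟨hr.1, hrs⟩
  · have h0 : (0 : ℝ) ∈ Icc 0 (s + t) := ⟨le_rfl, by linarith⟩
    have hsm : s ∈ Icc 0 (s + t) := ⟨hs, by linarith⟩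
    rw [← intervalIntegral.integral_add_adjacent_intervals
      (hf.intervalIntegrable hU' hcont h0 hsm) (hf.intervalIntegrable hU' hcont hsm hr), ← add_assoc,
      ← hfirst s ⟨hs, le_rfl⟩, hYs r hrs, hy'.2 (r - s) ⟨by linarith, by linarith [hr.2]⟩]
    congr 1
    · simp [hY]
    · rw [show (0 : ℝ) = s - s by ring,
        ← intervalIntegral.integral_comp_sub_right (fun q => f (y' q) (v q)) s]
      refine intervalIntegral.integral_congr fun q hq => ?_
      rw [uIcc_of_le hrs] at hq
      simp only [hYs q hq.1, hU, not_lt.2 hq.1, if_false]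

/-- The `ℓ¹` distance of two controls. -/
def gap (u v : ℝ → Fin M → ℝ) (s : ℝ) : ℝ := ∑ i, |u s i - v s i|

theorem gap_nonneg (u v : ℝ → Fin M → ℝ) (s : ℝ) : 0 ≤ gap u v s :=
  Finset.sum_nonneg fun _ _ => abs_nonneg _

theorem gap_le {u v : ℝ → Fin M → ℝ} (hu : IsControl u) (hv : IsControl v) :
    ∀ᵐ s : ℝ, gap u v s ≤ 2 * M := by
  filter_upwards [hu.2, hv.2] with s h1 h2
  calc gap u v s ≤ ∑ i : Fin M, (2 : ℝ) := Finset.sum_le_sum fun i _ => by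
        have := abs_sub (u s i) (v s i)
        have := abs_le_one_of_mem_cube h1 i
        have := abs_le_one_of_mem_cube h2 i
        linarith
    _ = 2 * M := by simp [mul_comm]

theorem gap_locallyIntegrable {u v : ℝ → Fin M → ℝ} (hu : IsControl u) (hv : IsControl v) :
    LocallyIntegrable (gap u v) := by
  have hm : Measurable (gap u v) := by
    have := hu.1
    have := hv.1
    unfold gap
    fun_prop
  refine (locallyIntegrable_const (2 * M : ℝ)).mono hm.aestronglyMeasurable ?_
  filter_upwards [gap_le hu hv] with s hs
  rw [Real.norm_eq_abs, abs_of_nonneg (gap_nonneg u v s)]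
  exact hs.trans (le_abs_self _)

theorem gap_intervalIntegrable {u v : ℝ → Fin M → ℝ} (hu : IsControl u) (hv : IsControl v)
    (a b : ℝ) : IntervalIntegrable (gap u v) volume a b := by
  rw [intervalIntegrable_iff']
  exact (gap_locallyIntegrable hu hv).integrableOn_isCompact isCompact_uIcc

/-- Short-time Gronwall estimate for two trajectories in the unit ball. -/
theorem norm_sub_trajectory_le (hf : IsField f C) (ht : C * t ≤ 1 / 2) (hu : IsControl u)
    (hy : IsTrajectory f u p t y) (hy1 : ∀ r ∈ Icc 0 t, ‖y r‖ ≤ 1)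
    {v : ℝ → Fin M → ℝ} (hv : IsControl v) {q : Plane} {y' : ℝ → Plane}
    (hy' : IsTrajectory f v q t y') (hy1' : ∀ r ∈ Icc 0 t, ‖y' r‖ ≤ 1)
    {r r0 : ℝ} (hr : r ∈ Icc 0 t) (hr0 : r0 ∈ Icc 0 t) :
    ‖y r - y' r‖ ≤ 2 * (‖y r0 - y' r0‖ + C * |∫ s in r0..r, gap u v s|) := by
  have hC := hf.one_le
  have hsub : uIcc r0 r ⊆ Icc 0 t := (convex_Icc 0 t).ordConnected.uIcc_subset hr0 hr
  have hcont : ContinuousOn (fun s => ‖y s - y' s‖) (uIcc r0 r) :=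
    ((hy.1.sub hy'.1).norm).mono hsub
  -- Evaluate the integral equation at the time of largest distance; since `C * t ≤ 1 / 2`, half of
  -- that distance is absorbed, which replaces the exponential.
  obtain ⟨m, hm, hmax⟩ := isCompact_uIcc.exists_isMaxOn nonempty_uIcc hcont
  have hmt := hsub hm
  have hgap : |∫ s in r0..m, gap u v s| ≤ |∫ s in r0..r, gap u v s| := by
    refine intervalIntegral.abs_integral_mono_interval
      (uIoc_subset_uIoc_of_uIcc_subset_uIcc (uIcc_subset_uIcc_left hm))
      (Eventually.of_forall fun s => gap_nonneg u v s) (gap_intervalIntegrable hu hv _ _)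
  have hint : y m - y' m = (y r0 - y' r0) + ∫ s in r0..m, (f (y s) (u s) - f (y' s) (v s)) := by
    rw [intervalIntegral.integral_sub (hf.intervalIntegrable hu hy.1 hr0 hmt)
      (hf.intervalIntegrable hv hy'.1 hr0 hmt), ← hy.sub_eq hf hu hr0 hmt,
      ← hy'.sub_eq hf hv hr0 hmt]
    abel
  have hbound : ‖∫ s in r0..m, (f (y s) (u s) - f (y' s) (v s))‖ ≤
      |∫ s in r0..m, (C * ‖y m - y' m‖ + C * gap u v s)| := by
    refine intervalIntegral.norm_integral_le_abs_of_norm_le ?_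
      (intervalIntegrable_const.add ((gap_intervalIntegrable hu hv _ _).const_mul C))
    rw [ae_restrict_iff' measurableSet_uIoc]
    filter_upwards [hu.2, hv.2] with s h1 h2 hs
    have hs1 : s ∈ uIcc r0 r := uIcc_subset_uIcc_left hm (uIoc_subset_uIcc hs)
    have hst := hsub hs1
    have e1 := hf.lip (y s) (y' s) (hy1 s hst) (hy1' s hst) _ h1
    have e2 := hf.lip_control (y' s) (hy1' s hst) (u s) (v s)
    have e3 : C * ‖y s - y' s‖ ≤ C * ‖y m - y' m‖ := by
      gcongr; exact hmax hs1
    calc _ = ‖(f (y s) (u s) - f (y' s) (u s)) + (f (y' s) (u s) - f (y' s) (v s))‖ := by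
          congr 1; abel
      _ ≤ _ := norm_add_le _ _
      _ ≤ _ := by unfold gap; linarith
  rw [intervalIntegral.integral_add intervalIntegrable_const
    ((gap_intervalIntegrable hu hv _ _).const_mul C), intervalIntegral.integral_const,
    intervalIntegral.integral_const_mul, smul_eq_mul] at hbound
  have hmr : |m - r0| ≤ t := by
    rw [abs_le]; constructor <;> linarith [hmt.1, hmt.2, hr0.1, hr0.2]
  have h5 : |(m - r0) * (C * ‖y m - y' m‖)| ≤ 1 / 2 * ‖y m - y' m‖ := by
    rw [abs_mul, abs_of_nonneg (by positivity : 0 ≤ C * ‖y m - y' m‖)]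
    calc _ ≤ t * (C * ‖y m - y' m‖) := by gcongr
      _ = C * t * ‖y m - y' m‖ := by ring
      _ ≤ _ := by gcongr
  have h6 : |C * ∫ s in r0..m, gap u v s| ≤ C * |∫ s in r0..r, gap u v s| := by
    rw [abs_mul, abs_of_nonneg (by linarith)]
    gcongr
  have h7 : ‖y m - y' m‖ ≤ ‖y r0 - y' r0‖ + (1 / 2 * ‖y m - y' m‖ +
      C * |∫ s in r0..r, gap u v s|) := by
    have h9 := norm_add_le (y r0 - y' r0) (∫ s in r0..m, (f (y s) (u s) - f (y' s) (v s)))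
    rw [← hint] at h9
    linarith [hbound.trans ((abs_add_le _ _).trans (add_le_add h5 h6))]
  have h8 : ‖y r - y' r‖ ≤ ‖y m - y' m‖ := hmax right_mem_uIcc
  linarith

/-- Picard iteration on continuous maps into the closed unit ball, a contraction by 1/2. Freezing
the solution outside `[0,t]` makes it continuous on the whole line. -/
theorem exists_trajectory (hf : IsField f C) (hu : IsControl u) (ht : 0 ≤ t)
    (hCt : C * t ≤ 1 / 2) (hp : ‖p‖ + C * t ≤ 1) :
    ∃ y : ℝ → Plane, Continuous y ∧ IsTrajectory f u p t y := by
  have hC := hf.one_le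
  let X := C(Icc (0 : ℝ) t, Metric.closedBall (0 : Plane) 1)
  let ext : X → ℝ → Plane := fun x s => (x (projIcc 0 t ht s) : Plane)
  have hext : ∀ x : X, Continuous (ext x) := fun x =>
    continuous_subtype_val.comp (x.continuous.comp continuous_projIcc)
  have hext1 : ∀ (x : X) s, ‖ext x s‖ ≤ 1 := fun x s =>
    mem_closedBall_zero_iff.1 (x (projIcc 0 t ht s)).2
  have h0 : (0 : ℝ) ∈ Icc 0 t := ⟨le_rfl, ht⟩
  have hint : ∀ (x : X) {r r' : ℝ}, r ∈ Icc 0 t → r' ∈ Icc 0 t →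
      IntervalIntegrable (fun s => f (ext x s) (u s)) volume r r' := fun x r r' hr hr' =>
    hf.intervalIntegrable hu (hext x).continuousOn hr hr'
  have hle : ∀ (x : X) (r r' : ℝ), ‖∫ s in r..r', f (ext x s) (u s)‖ ≤ C * |r' - r| := by
    intro x r r'
    refine intervalIntegral.norm_integral_le_of_norm_le_const_ae ?_
    filter_upwards [hu.2] with s hs _
    exact hf.norm_le _ (hext1 x s) _ hs
  let I : X → Icc (0 : ℝ) t → Plane := fun x r => p + ∫ s in (0 : ℝ)..r, f (ext x s) (u s)
  have hI1 : ∀ x r, I x r ∈ Metric.closedBall (0 : Plane) 1 := by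
    intro x r
    rw [mem_closedBall_zero_iff]
    have h1 := hle x 0 r
    rw [sub_zero, abs_of_nonneg r.2.1] at h1
    have h2 : C * (r : ℝ) ≤ C * t := by gcongr; exact r.2.2
    have := norm_add_le p (∫ s in (0 : ℝ)..r, f (ext x s) (u s))
    linarith
  have hI2 : ∀ x, Continuous (I x) := by
    intro x
    refine (LipschitzWith.of_dist_le_mul (K := C.toNNReal) fun r r' => ?_).continuous
    rw [dist_eq_norm, Real.coe_toNNReal C (by linarith), Subtype.dist_eq, Real.dist_eq]
    simp only [I]
    rw [add_sub_add_left_eq_sub,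
      intervalIntegral.integral_interval_sub_left (hint x h0 r.2) (hint x h0 r'.2)]
    exact hle x r' r
  let Φ : X → X := fun x => ⟨fun r => ⟨I x r, hI1 x r⟩, (hI2 x).subtype_mk _⟩
  have hΦ : ContractingWith (1 / 2) Φ := by
    refine ⟨by rw [← NNReal.coe_lt_coe]; norm_num, LipschitzWith.of_dist_le_mul fun x x' => ?_⟩
    rw [ContinuousMap.dist_le (by positivity)]
    intro r
    rw [Subtype.dist_eq, dist_eq_norm]
    change ‖I x r - I x' r‖ ≤ _
    simp only [I]
    rw [add_sub_add_left_eq_sub, ← intervalIntegral.integral_sub (hint x h0 r.2) (hint x' h0 r.2)]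
    have : ‖∫ s in (0 : ℝ)..r, (f (ext x s) (u s) - f (ext x' s) (u s))‖ ≤
        C * dist x x' * |(r : ℝ) - 0| := by
      refine intervalIntegral.norm_integral_le_of_norm_le_const_ae ?_
      filter_upwards [hu.2] with s hs _
      refine (hf.lip _ _ (hext1 x s) (hext1 x' s) _ hs).trans ?_
      gcongr
      have := ContinuousMap.dist_apply_le_dist (f := x) (g := x') (projIcc 0 t ht s)
      rwa [Subtype.dist_eq, dist_eq_norm] at this
    refine this.trans ?_
    rw [sub_zero, abs_of_nonneg r.2.1]
    calc C * dist x x' * r ≤ C * dist x x' * t := by gcongr; exact r.2.2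
      _ = C * t * dist x x' := by ring
      _ ≤ 1 / 2 * dist x x' := by gcongr
      _ = _ := by simp
  have hp1 : p ∈ Metric.closedBall (0 : Plane) 1 := by
    rw [mem_closedBall_zero_iff]
    have : 0 ≤ C * t := by positivity
    linarith
  have : Nonempty X := ⟨ContinuousMap.const _ ⟨p, hp1⟩⟩
  have : CompleteSpace (Metric.closedBall (0 : Plane) 1) :=
    Metric.isClosed_closedBall.completeSpace_coe
  have hfix := hΦ.fixedPoint_isFixedPt
  set x := ContractingWith.fixedPoint Φ hΦ
  refine ⟨ext x, hext x, (hext x).continuousOn, fun r hr => ?_⟩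
  have h1 : ((Φ x) ⟨r, hr⟩ : Plane) = p + ∫ s in (0 : ℝ)..r, f (ext x s) (u s) := rfl
  rw [← h1, hfix.eq]
  simp [ext, projIcc_of_mem ht hr]

theorem IsTrajectory.ae_hasDerivAt (hf : IsField f C) (hu : IsControl u)
    (hy : IsTrajectory f u p t y) (ht : 0 ≤ t) :
    ∀ᵐ s : ℝ, s ∈ Ioo 0 t → HasDerivAt y (f (y s) (u s)) s := by
  have h0 : (0 : ℝ) ∈ Icc 0 t := ⟨le_rfl, ht⟩
  have hi := hf.intervalIntegrable hu hy.1 h0 ⟨ht, le_rfl⟩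
  filter_upwards [hi.ae_hasDerivAt_integral] with s hs hst
  have h1 := (hs (by rw [uIcc_of_le ht]; exact Ioo_subset_Icc_self hst) 0
    (by rw [uIcc_of_le ht]; exact h0)).const_add p
  refine h1.congr_of_eventuallyEq ?_
  filter_upwards [Ioo_mem_nhds hst.1 hst.2] with r hr
  exact hy.2 r (Ioo_subset_Icc_self hr)

theorem IsTrajectory.absolutelyContinuous (hf : IsField f C) (hu : IsControl u)
    (hy : IsTrajectory f u p t y) (ht : 0 ≤ t) (hp : ‖p‖ + C * t < 1) (j : Fin 2) :
    AbsolutelyContinuousOnInterval (fun s => y s j) 0 t := by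
  have hC := hf.one_le
  refine LipschitzOnWith.absolutelyContinuousOnInterval (K := C.toNNReal)
    (LipschitzOnWith.of_dist_le_mul fun r hr r' hr' => ?_)
  rw [uIcc_of_le ht] at hr hr'
  rw [Real.coe_toNNReal C (by linarith), Real.dist_eq, Real.dist_eq]
  exact (abs_apply_le_norm (y r - y r') j).trans (hy.norm_sub_le hf hu hp hr' hr)

end Trajectories

/-- Controls are merely measurable, so derivatives exist almost everywhere only; absolute continuity
is what lets them be integrated. -/
theorem sub_le_integral_of_ae_hasDerivAt_le {ψ g : ℝ → ℝ} {t : ℝ} (ht : 0 ≤ t)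
    (hψ : AbsolutelyContinuousOnInterval ψ 0 t) (hg : IntervalIntegrable g volume 0 t)
    (h : ∀ᵐ s : ℝ, s ∈ Ioo 0 t → ∃ d, HasDerivAt ψ d s ∧ d ≤ g s) :
    ψ t - ψ 0 ≤ ∫ s in (0 : ℝ)..t, g s := by
  rw [← hψ.integral_deriv_eq_sub]
  refine intervalIntegral.integral_mono_ae_restrict ht hψ.intervalIntegrable_deriv hg ?_
  have h0 : ∀ᵐ s : ℝ, s ≠ 0 := by simp [ae_iff, measure_singleton]
  have h1 : ∀ᵐ s : ℝ, s ≠ t := by simp [ae_iff, measure_singleton]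
  rw [EventuallyLE, ae_restrict_iff' measurableSet_Icc]
  filter_upwards [h, h0, h1] with s hs hs0 hs1 hst
  obtain ⟨d, hd, hdg⟩ := hs ⟨lt_of_le_of_ne hst.1 (Ne.symm hs0), lt_of_le_of_ne hst.2 hs1⟩
  rw [hd.deriv]
  exact hdg

/-- The tail integral of a control gap integrates to its first moment. -/
theorem integral_tail_gap {u v : ℝ → Fin M → ℝ} (hu : IsControl u) (hv : IsControl v) (t : ℝ) :
    ∫ s in (0 : ℝ)..t, (∫ r in s..t, gap u v r) = ∫ s in (0 : ℝ)..t, s * gap u v s := by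
  have hi := gap_intervalIntegrable hu hv
  set P : ℝ → ℝ := fun s => ∫ r in (0 : ℝ)..s, gap u v r with hP
  have hac : AbsolutelyContinuousOnInterval P 0 t :=
    (hi 0 t).absolutelyContinuousOnInterval_intervalIntegral left_mem_uIcc
  have hid : AbsolutelyContinuousOnInterval (fun s : ℝ => s) 0 t :=
    contDiffOn_id.absolutelyContinuousOnInterval
  -- Integration by parts of `s` against the primitive of the gap.
  have h1 := hid.integral_mul_deriv_eq_deriv_mul hac
  have h2 : ∫ s in (0 : ℝ)..t, s * deriv P s = ∫ s in (0 : ℝ)..t, s * gap u v s := by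
    refine intervalIntegral.integral_congr_ae ?_
    filter_upwards [(hi 0 t).ae_hasDerivAt_integral] with s hs hst
    rw [(hs (uIoc_subset_uIcc hst) 0 left_mem_uIcc).deriv]
  have h3 : ∀ s, ∫ r in s..t, gap u v r = P t - P s := fun s =>
    (intervalIntegral.integral_interval_sub_left (hi 0 t) (hi 0 s)).symm
  have hPc : Continuous P := intervalIntegral.continuous_primitive hi 0
  simp only [h3]
  rw [intervalIntegral.integral_sub intervalIntegrable_const (hPc.intervalIntegrable _ _), ← h2, h1]
  simp

end

/-! ### Time reversal, the minimum time and its Lipschitz points -/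

section

variable {M : ℕ} {F : Plane → Plane} {G : Fin M → Plane → Plane} {A : Plane →L[ℝ] Plane}
  {B : Fin M → Plane} {C : ℝ}

/-- The dynamics with time reversed. -/
def revDynamics (F : Plane → Plane) (G : Fin M → Plane → Plane) (z : Plane) (w : Fin M → ℝ) :
    Plane := -dynamics F G z w

theorem IsNice.isField_rev (h : IsNice F G A B C) : IsField (revDynamics F G) C := h.isField.neg

theorem Steers.exists_rev (h : IsNice F G A B C) {x : Plane} {t : ℝ} (hx : Steers F G x t) :
    ∃ u : ℝ → Fin M → ℝ, IsControl u ∧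
      ∃ y : ℝ → Plane, IsTrajectory (revDynamics F G) u 0 t y ∧ y t = x := by
  obtain ⟨ht, u, hu, y, hy, hyt⟩ := hx
  have h1 := hy.reverse h.isField hu ht
  rw [hyt] at h1
  exact ⟨_, hu.comp_sub_left t, _, h1, by simp [hy.apply_zero ht]⟩

/-- A trajectory of the reversed dynamics from a point which can be steered to the origin ends in
a point which can be steered to the origin. -/
theorem steers_of_rev (h : IsNice F G A B C) {u : ℝ → Fin M → ℝ} (hu : IsControl u) {p : Plane}
    {t : ℝ} (ht : 0 ≤ t) {y : ℝ → Plane} (hy : IsTrajectory (revDynamics F G) u p t y) {s : ℝ}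
    (hp : Steers F G p s) : Steers F G (y t) (t + s) := by
  obtain ⟨hs, v, hv, z, hz, hzs⟩ := hp
  have h1 : IsTrajectory (dynamics F G) (fun s => u (t - s)) (y t) t (fun s => y (t - s)) := by
    have := hy.reverse h.isField_rev hu ht
    simpa [revDynamics] using this
  have hz' : IsTrajectory (dynamics F G) v (y (t - t)) s z := by
    rwa [sub_self, hy.apply_zero ht]
  have h2 := h1.concat h.isField (hu.comp_sub_left t) ht hs hv hz'
  refine ⟨by linarith, _, (hu.comp_sub_left t).ite (hv.comp_sub_right t) t, _, h2, ?_⟩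
  split_ifs with hc
  · have hs0 : s = 0 := by linarith
    subst hs0
    simp only [add_zero, sub_self]
    rw [hy.apply_zero ht, ← hzs, hz.apply_zero le_rfl]
  · simpa using hzs

theorem steers_zero : Steers F G 0 0 := by
  refine ⟨le_rfl, fun _ => 0, isControl_const ⟨by intro i; simp, by intro i; simp⟩, fun _ => 0,
    ⟨continuousOn_const, fun r hr => ?_⟩, rfl⟩
  have : r = 0 := le_antisymm hr.2 hr.1
  subst this
  simp

theorem steers_of_rev_zero (h : IsNice F G A B C) {u : ℝ → Fin M → ℝ} (hu : IsControl u)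
    {t : ℝ} (ht : 0 ≤ t) {y : ℝ → Plane} (hy : IsTrajectory (revDynamics F G) u 0 t y) :
    Steers F G (y t) t := by
  simpa using steers_of_rev h hu ht hy steers_zero

/-- One may wait at the origin before following a trajectory of the reversed dynamics. -/
theorem Steers.exists_rev_wait (h : IsNice F G A B C) {x : Plane} {s t : ℝ} (hx : Steers F G x s)
    (hst : s ≤ t) :
    ∃ u : ℝ → Fin M → ℝ, IsControl u ∧ (∀ r < t - s, u r = 0) ∧
      ∃ y : ℝ → Plane, IsTrajectory (revDynamics F G) u 0 t y ∧ y t = x := by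
  obtain ⟨v, hv, z, hz, hzs⟩ := hx.exists_rev h
  have h0 : IsControl (fun _ : ℝ => (0 : Fin M → ℝ)) :=
    isControl_const ⟨by intro i; simp, by intro i; simp⟩
  have hw : IsTrajectory (revDynamics F G) (fun _ => (0 : Fin M → ℝ)) 0 (t - s) (fun _ => 0) :=
    ⟨continuousOn_const, fun r _ => by simp [revDynamics, dynamics, h.F_zero]⟩
  have h2 := hw.concat h.isField_rev h0 (by linarith) hx.1 hv hz
  rw [sub_add_cancel] at h2
  refine ⟨_, h0.ite (hv.comp_sub_right (t - s)) (t - s), fun r hr => by simp [hr], _, h2, ?_⟩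
  split_ifs with hc
  · have hs0 : s = 0 := by linarith [hx.1]
    subst hs0
    rw [← hzs, hz.apply_zero le_rfl]
  · simpa using hzs

theorem Steers.mono (h : IsNice F G A B C) {x : Plane} {s t : ℝ} (hx : Steers F G x s)
    (hst : s ≤ t) : Steers F G x t := by
  obtain ⟨u, hu, -, y, hy, rfl⟩ := hx.exists_rev_wait h hst
  exact steers_of_rev_zero h hu (hx.1.trans hst) hy

theorem mem_reachable_iff (h : IsNice F G A B C) {x : Plane} {t : ℝ} :
    x ∈ reachable F G t ↔ Steers F G x t :=
  ⟨fun ⟨_, hs, hx⟩ => hx.mono h hs, fun hx => ⟨t, le_rfl, hx⟩⟩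

theorem Steers.minTime_le {x : Plane} {t : ℝ} (hx : Steers F G x t) :
    minTime F G x ≤ ENNReal.ofReal t := iInf₂_le t hx

theorem Steers.minTime_ne_top {x : Plane} {t : ℝ} (hx : Steers F G x t) :
    minTime F G x ≠ ⊤ := (hx.minTime_le.trans_lt ENNReal.ofReal_lt_top).ne

theorem Steers.toReal_minTime_le {x : Plane} {t : ℝ} (hx : Steers F G x t) :
    (minTime F G x).toReal ≤ t :=
  ENNReal.toReal_le_of_le_ofReal hx.1 hx.minTime_le

theorem exists_steers_lt {x : Plane} (hx : minTime F G x ≠ ⊤) {t : ℝ}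
    (ht : (minTime F G x).toReal < t) : ∃ s < t, Steers F G x s := by
  have h1 : minTime F G x < ENNReal.ofReal t := by
    rwa [ENNReal.lt_ofReal_iff_toReal_lt hx]
  unfold minTime at h1
  simp only [iInf_lt_iff] at h1
  obtain ⟨s, hs, hlt⟩ := h1
  exact ⟨s, (ENNReal.ofReal_lt_ofReal_iff_of_nonneg hs.1).1 hlt, hs⟩

/-- `f` is Lipschitz on the part of its domain `{f < ⊤}` near `x`. -/
def LipAt (f : Plane → ℝ≥0∞) (x : Plane) : Prop :=
  ∃ ε > 0, ∃ K : ℝ, 0 ≤ K ∧ ∀ a b : Plane, ‖a - x‖ < ε → ‖b - x‖ < ε → f a ≠ ⊤ → f b ≠ ⊤ →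
    |(f b).toReal - (f a).toReal| ≤ K * ‖b - a‖

/-- For the converse, the bound fails with constant `n` on the ball of radius `1/(n+1)` for each
`n`; the failing pairs are distinct because the failure is strict, and their quotients exceed `n`.
-/
theorem nonLipschitzAt_iff (f : Plane → ℝ≥0∞) (x : Plane) :
    NonLipschitzAt f x ↔ ¬ LipAt f x := by
  constructor
  · rintro ⟨a, b, hne, ha, hb, hax, hbx, hlim⟩ ⟨ε, hε, K, hK, hlip⟩
    have h1 : limsup (fun i => ((|(f (b i)).toReal - (f (a i)).toReal| / ‖b i - a i‖ : ℝ) : EReal))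
        atTop ≤ (K : EReal) := by
      refine limsup_le_of_le (h := ?_)
      have e1 := Metric.tendsto_atTop.1 hax ε hε
      have e2 := Metric.tendsto_atTop.1 hbx ε hε
      obtain ⟨N1, h1⟩ := e1
      obtain ⟨N2, h2⟩ := e2
      filter_upwards [eventually_ge_atTop N1, eventually_ge_atTop N2] with i hi1 hi2
      have := hlip (a i) (b i) (by simpa [dist_eq_norm] using h1 i hi1)
        (by simpa [dist_eq_norm] using h2 i hi2) (ha i) (hb i)
      have hpos : 0 < ‖b i - a i‖ := norm_pos_iff.2 (sub_ne_zero.2 (hne i).symm)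
      exact_mod_cast (div_le_iff₀ hpos).2 this
    rw [hlim] at h1
    exact absurd h1 (not_le.2 (EReal.coe_lt_top K))
  · intro h
    unfold LipAt at h
    push Not at h
    have hn : ∀ n : ℕ, (0 : ℝ) < 1 / ((n : ℝ) + 1) := fun n => by positivity
    choose a b ha hb hfa hfb hlt using fun n : ℕ => h (1 / ((n : ℝ) + 1)) (hn n) n n.cast_nonneg
    have hne : ∀ n, a n ≠ b n := by
      intro n he
      have := hlt n
      simp [he] at this
    refine ⟨a, b, hne, hfa, hfb, ?_, ?_, ?_⟩
    · rw [tendsto_iff_norm_sub_tendsto_zero]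
      exact squeeze_zero (fun _ => norm_nonneg _) (fun n => (ha n).le)
        tendsto_one_div_add_atTop_nhds_zero_nat
    · rw [tendsto_iff_norm_sub_tendsto_zero]
      exact squeeze_zero (fun _ => norm_nonneg _) (fun n => (hb n).le)
        tendsto_one_div_add_atTop_nhds_zero_nat
    · refine Tendsto.limsup_eq ?_
      rw [EReal.tendsto_nhds_top_iff_real]
      intro y
      obtain ⟨N, hN⟩ := exists_nat_gt y
      filter_upwards [eventually_ge_atTop N] with n hn
      have hpos : 0 < ‖b n - a n‖ := norm_pos_iff.2 (sub_ne_zero.2 (hne n).symm)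
      have h1 : (n : ℝ) < |(f (b n)).toReal - (f (a n)).toReal| / ‖b n - a n‖ :=
        (lt_div_iff₀ hpos).2 (hlt n)
      have h2 : (N : ℝ) ≤ n := by exact_mod_cast hn
      exact_mod_cast (hN.trans_le h2).trans h1

theorem minHamiltonian_le (h : IsNice F G A B C) (x p : Plane) {w : Fin M → ℝ}
    (hw : w ∈ Icc (-1 : Fin M → ℝ) 1) :
    minHamiltonian F G x p ≤ inner ℝ p (dynamics F G x w) := by
  refine csInf_le (IsCompact.bddBelow (isCompact_Icc.image ?_)) ⟨w, hw, rfl⟩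
  have := h.isField.cont.comp (Continuous.prodMk_right x)
  exact continuous_const.inner this

theorem Steers.norm_le (h : IsNice F G A B C) {x : Plane} {t : ℝ} (hx : Steers F G x t)
    (ht : C * t < 1) : ‖x‖ ≤ C * t := by
  obtain ⟨u, hu, y, hy, rfl⟩ := hx.exists_rev h
  simpa using hy.norm_le h.isField_rev hu (by simpa using ht) (r := t) ⟨hx.1, le_rfl⟩

/-- If the minimum time is finite near a singular point, then it is not Lipschitz there. -/
theorem not_lipAt_of_mem_singularSet (h : IsNice F G A B C) {τ : ℝ} (hτ : C * τ ≤ 1 / 2)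
    {x : Plane} (hx : x ∈ singularSet F G τ) {ρ : ℝ} (hρ : 0 < ρ)
    (hfin : ∀ b, ‖b - x‖ < ρ → minTime F G b ≠ ⊤) : ¬ LipAt (minTime F G) x := by
  rintro ⟨ε₀, hε₀, K, hK, hlip⟩
  obtain ⟨hxτ, ζ, hζ, ⟨hxt, σ, hσ, hprox⟩, hH⟩ := hx
  have hC := h.one_le
  rw [mem_reachable_iff h] at hxτ
  set t := (minTime F G x).toReal with ht
  have ht0 : 0 ≤ t := ENNReal.toReal_nonneg
  have htτ : t ≤ τ := hxτ.toReal_minTime_le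
  have hCt : C * t ≤ C * τ := by gcongr
  set k := K + 1 with hk
  have hk1 : 1 ≤ k := by linarith
  set Q := k * C * (1 + C * k) + σ * (1 + C * k) ^ 2 with hQ
  have hQ0 : 0 < Q := by positivity
  obtain ⟨ε, hε, e1, e2, e3, e4⟩ : ∃ ε > 0, ε < ε₀ ∧ ε < ρ ∧ ε < 1 / (4 * (C * k)) ∧ ε < 1 / Q := by
    have h1 : 0 < min (min ε₀ ρ) (min (1 / (4 * (C * k))) (1 / Q)) := by positivity
    obtain ⟨ε, hε, hlt⟩ := exists_between h1
    simp only [lt_min_iff] at hlt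
    exact ⟨ε, hε, hlt.1.1, hlt.1.2, hlt.2.1, hlt.2.2⟩
  rw [lt_div_iff₀ (by positivity)] at e3 e4
  set z := x + ε • ζ with hz
  have hzx : ‖z - x‖ = ε := by simp [hz, norm_smul, hζ, abs_of_pos hε]
  have hzfin := hfin z (by rw [hzx]; exact e2)
  have hTz : (minTime F G z).toReal ≤ t + K * ε := by
    have := hlip x z (by simpa using hε₀) (by rw [hzx]; exact e1) hxτ.minTime_ne_top hzfin
    rw [hzx] at this
    linarith [(abs_le.1 this).2]
  obtain ⟨tz, htz, hs⟩ := exists_steers_lt hzfin (t := t + k * ε) (by rw [hk]; linarith)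
  have hinner : (inner ℝ ζ (z - x) : ℝ) = ε := by
    simp [hz, inner_smul_right, hζ]
  -- If `z` lies in the sublevel, it violates the proximal inequality itself. Otherwise `y t`, the
  -- point reached a time `s ≤ k * ε` before `z`, does.
  rcases le_or_gt tz t with hle | hgt
  · have := hprox z ⟨tz, hle, hs⟩
    rw [hinner, hzx] at this
    have h2 : σ ≤ Q := by
      have : σ * 1 ≤ σ * (1 + C * k) ^ 2 := by
        gcongr
        have : 0 ≤ C * k := by positivity
        nlinarith
      have : 0 ≤ k * C * (1 + C * k) := by positivity
      linarith
    nlinarith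
  · obtain ⟨u, hu, y, hy, hyz⟩ := hs.exists_rev h
    set s := tz - t with hs'
    have hsk : s ≤ k * ε := by linarith
    have hs0 : 0 < s := by linarith
    have htzm : tz ∈ Icc 0 tz := ⟨hs.1, le_rfl⟩
    have htm : t ∈ Icc 0 tz := ⟨ht0, hgt.le⟩
    have hCtz : ‖(0 : Plane)‖ + C * tz < 1 := by
      rw [norm_zero, zero_add]
      have : C * tz ≤ C * (t + k * ε) := by gcongr
      nlinarith
    have hyx : ∀ r ∈ Icc t tz, ‖y r - x‖ ≤ ε + C * s := by
      intro r hr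
      have h1 := hy.norm_sub_le h.isField_rev hu hCtz (r := r) (r' := tz)
        ⟨ht0.trans hr.1, hr.2⟩ htzm
      rw [hyz, abs_of_nonneg (by linarith [hr.2])] at h1
      have h2 : C * (tz - r) ≤ C * s := by gcongr; linarith [hr.1]
      have h3 : y r - x = (z - x) - (z - y r) := by abel
      rw [h3]
      calc _ ≤ _ := norm_sub_le _ _
        _ ≤ _ := by rw [hzx]; linarith
    have hmem : y t ∈ reachable F G t :=
      ⟨t, le_rfl, steers_of_rev_zero h hu ht0 (hy.mono hgt.le)⟩
    have h1 := hprox _ hmem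
    have h2 := hyx t ⟨le_rfl, hgt.le⟩
    have hxn : ‖x‖ ≤ 1 := by
      have := hxτ.norm_le h (by linarith)
      linarith
    have hint := h.isField_rev.intervalIntegrable hu hy.1 htm htzm
    -- At `x` every reversed velocity has nonpositive component along `ζ`, since `h(x,ζ) = 0`;
    -- nearby only the Lipschitz error contributes.
    have h3 : (inner ℝ ζ (z - y t) : ℝ) ≤ s * (C * (ε + C * s)) := by
      rw [← hyz, hy.sub_eq h.isField_rev hu htm htzm, ← innerSL_apply_apply ℝ,
        ← ContinuousLinearMap.intervalIntegral_comp_comm _ hint]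
      have hb : ∀ᵐ r : ℝ, r ∈ Ioc t tz →
          (innerSL ℝ ζ) (revDynamics F G (y r) (u r)) ≤ C * (ε + C * s) := by
        filter_upwards [hu.2] with r hr hrt
        have g1 := minHamiltonian_le h x ζ hr
        rw [hH] at g1
        have hyr : ‖y r‖ ≤ 1 :=
          (hy.norm_lt_one h.isField_rev hu hCtz ⟨ht0.trans hrt.1.le, hrt.2⟩).le
        have g2 := h.lip x (y r) hxn hyr _ hr
        have g3 := hyx r ⟨hrt.1.le, hrt.2⟩
        have g4 := real_inner_le_norm ζ (dynamics F G x (u r) - dynamics F G (y r) (u r))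
        rw [hζ, one_mul, inner_sub_right] at g4
        rw [norm_sub_rev] at g3
        have g5 : C * ‖x - y r‖ ≤ C * (ε + C * s) := by gcongr
        simp only [innerSL_apply_apply, revDynamics, inner_neg_right]
        linarith
      have hconst : ∫ r in t..tz, C * (ε + C * s) = s * (C * (ε + C * s)) := by
        rw [intervalIntegral.integral_const, smul_eq_mul]
      rw [← hconst]
      refine intervalIntegral.integral_mono_ae_restrict hgt.le ?_ intervalIntegrable_const ?_
      · exact ⟨(innerSL ℝ ζ).integrable_comp hint.1, (innerSL ℝ ζ).integrable_comp hint.2⟩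
      · rw [EventuallyLE, ae_restrict_iff' measurableSet_Icc]
        have h0 : ∀ᵐ r : ℝ, r ≠ t := by simp [ae_iff, measure_singleton]
        filter_upwards [hb, h0] with r hr hr0 hrt
        exact hr ⟨lt_of_le_of_ne hrt.1 (Ne.symm hr0), hrt.2⟩
    have h4 : (inner ℝ ζ (y t - x) : ℝ) = ε - inner ℝ ζ (z - y t) := by
      rw [← hinner, ← inner_sub_right]; congr 1; abel
    have h5 : ε + C * s ≤ (1 + C * k) * ε := by
      have : C * s ≤ C * (k * ε) := by gcongr
      linarith
    have h6 : s * (C * (ε + C * s)) ≤ k * ε * (C * ((1 + C * k) * ε)) := by gcongr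
    have h7 : σ * ‖y t - x‖ ^ 2 ≤ σ * ((1 + C * k) * ε) ^ 2 := by
      gcongr
      exact h2.trans h5
    have h8 : ε ≤ ε * (ε * Q) := by
      have : ε * (ε * Q) = k * ε * (C * ((1 + C * k) * ε)) + σ * ((1 + C * k) * ε) ^ 2 := by
        rw [hQ]; ring
      linarith
    nlinarith

/-- A uniform steering estimate at `x`: every point near `x` can be steered to the origin from the
time in which a neighbour can be steered, with a delay at most linear in the distance. -/
def SteerStable (F : Plane → Plane) (G : Fin M → Plane → Plane) (T : ℝ) (x : Plane) : Prop :=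
  ∃ ρ > 0, ∃ K : ℝ, 0 ≤ K ∧ ∀ a b : Plane, ‖a - x‖ < ρ → ‖b - x‖ < ρ → ∀ t ≤ T, Steers F G a t →
    ∃ s ≤ t + K * ‖b - a‖, Steers F G b s

/-- Steering stability covers times up to `T` only. The radius `(T - τ) / (2 * (K + 1))` keeps the
minimum times of neighbours below `T`, which leaves room for nearly optimal times. -/
theorem SteerStable.lipAt {T τ : ℝ} (hτ : τ < T) {x : Plane} (hx : Steers F G x τ)
    (hs : SteerStable F G T x) : LipAt (minTime F G) x := by
  obtain ⟨ρ, hρ, K, hK, hst⟩ := hs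
  have hd : 0 < (T - τ) / (2 * (K + 1)) := by
    have : 0 < T - τ := by linarith
    positivity
  refine ⟨min ρ ((T - τ) / (2 * (K + 1))), lt_min hρ hd, K, hK, ?_⟩
  have key : ∀ a b : Plane, ‖a - x‖ < min ρ ((T - τ) / (2 * (K + 1))) →
      ‖b - x‖ < min ρ ((T - τ) / (2 * (K + 1))) → minTime F G a ≠ ⊤ →
      (minTime F G b).toReal ≤ (minTime F G a).toReal + K * ‖b - a‖ := by
    intro a b ha hb hfa
    rw [lt_min_iff] at ha hb
    have h1 : (minTime F G a).toReal < T := by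
      obtain ⟨s, hs, hsa⟩ := hst x a (by simpa using hρ) ha.1 τ hτ.le hx
      have h2 := hsa.toReal_minTime_le
      have h3 := ha.2
      rw [lt_div_iff₀ (by positivity)] at h3
      nlinarith [norm_nonneg (a - x)]
    refine le_of_forall_pos_lt_add fun ε hε => ?_
    obtain ⟨t, ht, hta⟩ := exists_steers_lt hfa (t := min T ((minTime F G a).toReal + ε))
      (lt_min h1 (by linarith))
    rw [lt_min_iff] at ht
    obtain ⟨s, hs, hsb⟩ := hst a b ha.1 hb.1 t ht.1.le hta
    have := hsb.toReal_minTime_le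
    linarith
  intro a b ha hb hfa hfb
  have h1 := key a b ha hb hfa
  have h2 := key b a hb ha hfb
  rw [norm_sub_rev a b] at h2
  rw [abs_le]
  constructor <;> linarith

theorem SteerStable.exists_finite {T τ : ℝ} (hτ : τ ≤ T) {x : Plane} (hx : Steers F G x τ)
    (hs : SteerStable F G T x) : ∃ ρ > 0, ∀ b, ‖b - x‖ < ρ → minTime F G b ≠ ⊤ := by
  obtain ⟨ρ, hρ, K, hK, hst⟩ := hs
  refine ⟨ρ, hρ, fun b hb => ?_⟩
  obtain ⟨s, -, hsb⟩ := hst x b (by simpa using hρ) hb τ hτ hx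
  exact hsb.minTime_ne_top

end

/-! ### Parallel control fields: the constant-control extremals -/

section

variable {M : ℕ} {F : Plane → Plane} {G : Fin M → Plane → Plane} {A : Plane →L[ℝ] Plane}
  {B : Fin M → Plane} {C : ℝ}

/-- All control vector fields are parallel at the origin, to the unit vector `e`, and `e`, `A e`
are independent; `c` is a lower bound for the sizes and `ν` the sign of the orientation. -/
structure IsParallel (A : Plane →L[ℝ] Plane) (B : Fin M → Plane) (e : Plane) (β : Fin M → ℝ)
    (ν c : ℝ) : Prop where
  card_pos : 0 < M
  norm_e : ‖e‖ = 1
  B_eq : ∀ i, B i = β i • e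
  c_pos : 0 < c
  c_le_one : c ≤ 1
  c_le : ∀ i, c ≤ |β i|
  abs_ν : |ν| = 1
  c_le_wedge : c ≤ ν * wedge e (A e)

/-- The products `β i • e` and `wedge e (A e)` are unchanged, so every result on the extremal with
control `signs β` holds for the opposite one too. -/
theorem IsParallel.neg {e : Plane} {β : Fin M → ℝ} {ν c : ℝ} (hp : IsParallel A B e β ν c) :
    IsParallel A B (-e) (-β) ν c :=
  ⟨hp.card_pos, by rw [norm_neg, hp.norm_e], fun i => by simp [hp.B_eq i], hp.c_pos, hp.c_le_one,
    fun i => by simpa using hp.c_le i, hp.abs_ν, by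
      simpa [wedge_neg_left, wedge_neg_right] using hp.c_le_wedge⟩

/-- The vector of signs of `β`. -/
def signs (β : Fin M → ℝ) (i : Fin M) : ℝ := β i / |β i|

theorem signs_neg (β : Fin M → ℝ) : signs (-β) = -signs β := by
  funext i; simp [signs, neg_div]

section Parallel

variable {e : Plane} {β : Fin M → ℝ} {ν c : ℝ}

theorem IsParallel.abs_beta_pos (hp : IsParallel A B e β ν c) (i : Fin M) : 0 < |β i| :=
  hp.c_pos.trans_le (hp.c_le i)

theorem IsParallel.abs_signs (hp : IsParallel A B e β ν c) (i : Fin M) : |signs β i| = 1 := by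
  rw [signs, abs_div, abs_abs, div_self (hp.abs_beta_pos i).ne']

theorem IsParallel.signs_mul (hp : IsParallel A B e β ν c) (i : Fin M) :
    signs β i * β i = |β i| := by
  rw [signs, div_mul_eq_mul_div, ← abs_mul_abs_self, mul_div_assoc, div_self (hp.abs_beta_pos i).ne',
    mul_one]

theorem IsParallel.signs_mem (hp : IsParallel A B e β ν c) :
    signs β ∈ Icc (-1 : Fin M → ℝ) 1 :=
  mem_cube_of_abs_le_one fun i => (hp.abs_signs i).le

theorem IsParallel.isControl (hp : IsParallel A B e β ν c) :
    IsControl fun _ : ℝ => signs β := isControl_const hp.signs_mem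

theorem IsParallel.abs_beta_le (hp : IsParallel A B e β ν c) (h : IsNice F G A B C) (i : Fin M) :
    |β i| ≤ C := by
  have h1 := h.norm_G i 0 (by simp)
  rwa [h.G_zero, hp.B_eq, norm_smul, hp.norm_e, mul_one, Real.norm_eq_abs] at h1

/-- The speed of the constant extremals at the origin. -/
def totalSize (β : Fin M → ℝ) : ℝ := ∑ i, |β i|

theorem IsParallel.c_le_totalSize (hp : IsParallel A B e β ν c) : c ≤ totalSize β :=
  (hp.c_le ⟨0, hp.card_pos⟩).trans
    (Finset.single_le_sum (f := fun i => |β i|) (fun _ _ => abs_nonneg _) (Finset.mem_univ _))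

theorem IsParallel.revDynamics_zero (hp : IsParallel A B e β ν c) (h : IsNice F G A B C) :
    revDynamics F G 0 (signs β) = -(totalSize β • e) := by
  simp only [revDynamics, dynamics, h.F_zero, h.G_zero, hp.B_eq, smul_smul, hp.signs_mul,
    ← Finset.sum_smul, totalSize, zero_add]

/-- The control fields are constant up to second order at the origin, so `A` alone makes up the
linear part. -/
theorem IsParallel.norm_revDynamics_add_le (hp : IsParallel A B e β ν c) (h : IsNice F G A B C)
    {x : Plane} (hx : ‖x‖ ≤ 1) :
    ‖revDynamics F G x (signs β) + totalSize β • e + A x‖ ≤ 2 * C ^ 2 * ‖x‖ ^ 2 := by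
  have hC := h.one_le
  have h1 := h.F_sub ‖x‖ hx x 0 le_rfl (by simp)
  rw [h.F_zero, sub_zero, sub_zero] at h1
  have h2 := norm_sum_smul_le hp.signs_mem (g := fun i => G i x - G i 0) (a := C * ‖x‖ * ‖x‖)
    (fun i => by simpa using h.G_sub i ‖x‖ hx x 0 le_rfl (by simp))
  have h3 : revDynamics F G x (signs β) + totalSize β • e + A x =
      -(F x - A x) - ∑ i, signs β i • (G i x - G i 0) := by
    have := hp.revDynamics_zero h
    rw [revDynamics, neg_inj, dynamics, h.F_zero, zero_add] at this
    simp only [revDynamics, dynamics, smul_sub, Finset.sum_sub_distrib, this]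
    abel
  rw [h3]
  calc _ ≤ _ := norm_sub_le _ _
    _ ≤ C * ‖x‖ * ‖x‖ + M * (C * ‖x‖ * ‖x‖) := by rw [norm_neg]; exact add_le_add h1 h2
    _ ≤ C * C * (‖x‖ * ‖x‖) + C * (C * ‖x‖ * ‖x‖) := by
        refine add_le_add ?_ ?_
        · rw [mul_assoc, mul_assoc]
          exact mul_le_mul_of_nonneg_left (le_mul_of_one_le_left (by positivity) hC) (by linarith)
        · gcongr; exact h.card_le
    _ = _ := by ring

/-- The extremal with the constant control `signs β`, to first order. -/
theorem IsParallel.norm_extremal_add_le (hp : IsParallel A B e β ν c) (h : IsNice F G A B C)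
    {t : ℝ} (hCt : C * t < 1) {X : ℝ → Plane}
    (hX : IsTrajectory (revDynamics F G) (fun _ => signs β) 0 t X) {s r : ℝ}
    (hs : s ∈ Icc 0 t) (hr : r ∈ Icc 0 s) :
    ‖X s - X r + (s - r) • totalSize β • e‖ ≤ C ^ 2 * s * (s - r) := by
  have hC := h.one_le
  have hrt : r ∈ Icc 0 t := ⟨hr.1, hr.2.trans hs.2⟩
  have hlt : ‖(0 : Plane)‖ + C * t < 1 := by simpa using hCt
  have hint := h.isField_rev.intervalIntegrable hp.isControl hX.1 hrt hs
  have h1 : X s - X r + (s - r) • totalSize β • e =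
      ∫ q in r..s, (revDynamics F G (X q) (signs β) - revDynamics F G 0 (signs β)) := by
    rw [intervalIntegral.integral_sub hint intervalIntegrable_const,
      intervalIntegral.integral_const, hX.sub_eq h.isField_rev hp.isControl hrt hs,
      hp.revDynamics_zero h]
    simp
  rw [h1, ← abs_of_nonneg (sub_nonneg.2 hr.2)]
  refine intervalIntegral.norm_integral_le_of_norm_le_const fun q hq => ?_
  rw [uIoc_of_le hr.2] at hq
  have hqt : q ∈ Icc 0 t := ⟨hr.1.trans hq.1.le, hq.2.trans hs.2⟩
  have h2 := hX.norm_lt_one h.isField_rev hp.isControl hlt hqt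
  have h3 := hX.norm_le h.isField_rev hp.isControl hlt hqt
  rw [norm_zero, zero_add] at h3
  have h4 := h.isField_rev.lip (X q) 0 h2.le (by simp) _ hp.signs_mem
  rw [sub_zero] at h4
  calc _ ≤ _ := h4
    _ ≤ C * (C * s) := by gcongr; exact h3.trans (by gcongr; exact hq.2)
    _ = _ := by ring

theorem IsParallel.norm_extremal_add_smul_le (hp : IsParallel A B e β ν c) (h : IsNice F G A B C)
    {t : ℝ} (hCt : C * t < 1) {X : ℝ → Plane}
    (hX : IsTrajectory (revDynamics F G) (fun _ => signs β) 0 t X) {s : ℝ} (hs : s ∈ Icc 0 t) :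
    ‖X s + s • totalSize β • e‖ ≤ C ^ 2 * s ^ 2 := by
  have h1 := hp.norm_extremal_add_le h hCt hX hs ⟨le_rfl, hs.1⟩
  rw [hX.apply_zero (hs.1.trans hs.2), sub_zero, sub_zero] at h1
  linarith [h1]

/-- The switching functions along the extremal have a definite sign. -/
theorem IsParallel.switching_le (hp : IsParallel A B e β ν c) (h : IsNice F G A B C)
    {t : ℝ} (hCt : C * t < 1) (hct : 8 * C ^ 5 * t ≤ c ^ 3) {X : ℝ → Plane}
    (hX : IsTrajectory (revDynamics F G) (fun _ => signs β) 0 t X) {s : ℝ} (hs : s ∈ Icc 0 t)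
    {y : Plane} (hy : ‖y‖ ≤ C * s) (i : Fin M) :
    signs β i * (ν * wedge (revDynamics F G (X s) (signs β)) (G i y)) ≤ -(c ^ 3 / 2) * s := by
  have hC := h.one_le
  have hlt : ‖(0 : Plane)‖ + C * t < 1 := by simpa using hCt
  set V := revDynamics F G (X s) (signs β) with hV
  set k := totalSize β with hk
  have hX1 := hX.norm_lt_one h.isField_rev hp.isControl hlt hs
  have hX2 := hX.norm_le h.isField_rev hp.isControl hlt hs
  rw [norm_zero, zero_add] at hX2
  have hVn : ‖V‖ ≤ C := h.isField_rev.norm_le _ hX1.le _ hp.signs_mem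
  have hst : C * s ≤ C * t := by gcongr; exact hs.2
  have hs0 := hs.1
  -- To first order `X s` is `-s k e`, hence `V` is `-k e + s k A e`, with an error of order `s ^
  -- 2`.
  set R := V + k • e - (s * k) • A e with hR
  have hRn : ‖R‖ ≤ 3 * C ^ 4 * s ^ 2 := by
    have h1 := hp.norm_revDynamics_add_le h hX1.le
    have h2 := hp.norm_extremal_add_smul_le h hCt hX hs
    have h3 : R = (V + k • e + A (X s)) - A (X s + s • k • e) := by
      rw [hR, map_add, map_smul, map_smul, smul_smul]; abel
    have h4 := A.le_opNorm (X s + s • k • e)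
    rw [h3]
    calc _ ≤ _ := norm_sub_le _ _
      _ ≤ 2 * C ^ 2 * (C * s) ^ 2 + C * (C ^ 2 * s ^ 2) := by
          gcongr
          · exact h1.trans (by gcongr)
          · exact h4.trans (by gcongr; exact h.norm_A)
      _ = 2 * C ^ 4 * s ^ 2 + C ^ 3 * s ^ 2 := by ring
      _ ≤ 2 * C ^ 4 * s ^ 2 + C ^ 4 * s ^ 2 := by
          gcongr ?_ + ?_ * _
          · exact le_rfl
          · exact pow_le_pow_right₀ hC (by norm_num)
      _ = _ := by ring
  set R' := G i y - β i • e with hR'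
  have hRn' : ‖R'‖ ≤ C ^ 3 * s ^ 2 := by
    have h1 := h.G_sub i (C * s) (by linarith) y 0 hy (by simp; positivity)
    rw [h.G_zero, hp.B_eq, sub_zero] at h1
    calc _ ≤ _ := h1
      _ ≤ C * (C * s) * (C * s) := by gcongr
      _ = _ := by ring
  -- The part of `V` along `e` drops out, so the leading term is linear in `s`. The errors sum to at
  -- most `4 * C ^ 5 * s ^ 2`, half of the leading `c ^ 3 * s`.
  have hexp : wedge V (G i y) =
      β i * (-(s * k) * wedge e (A e) + wedge R e) + wedge V R' := by
    have h1 : G i y = β i • e + R' := by rw [hR']; abel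
    have h2 : V = R - k • e + (s * k) • A e := by rw [hR]; abel
    have h3 : wedge V e = -(s * k) * wedge e (A e) + wedge R e := by
      rw [h2, wedge_add_left, wedge_sub_left, wedge_smul_left, wedge_smul_left, wedge_self,
        wedge_swap (A e) e]
      ring
    rw [h1, wedge_add_right, wedge_smul_right, h3]
  have e1 : |wedge R e| ≤ 3 * C ^ 4 * s ^ 2 := by
    have := abs_wedge_le R e
    rw [hp.norm_e, mul_one] at this
    exact this.trans hRn
  have e2 : |wedge V R'| ≤ C * (C ^ 3 * s ^ 2) :=
    (abs_wedge_le V R').trans (by gcongr)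
  have e3 : signs β i * (ν * wedge V (G i y)) =
      -(|β i| * (k * (ν * wedge e (A e)))) * s + |β i| * (ν * wedge R e) +
        signs β i * (ν * wedge V R') := by
    rw [hexp, ← hp.signs_mul]; ring
  have e4 : c ^ 3 ≤ |β i| * (k * (ν * wedge e (A e))) := by
    have := hp.c_le i
    have hck : c ≤ k := hp.c_le_totalSize
    have := hp.c_le_wedge
    have := hp.c_pos
    have : 0 ≤ k := by linarith
    calc c ^ 3 = c * (c * c) := by ring
      _ ≤ _ := by gcongr
  have e5 : |β i| * (ν * wedge R e) ≤ C * (3 * C ^ 4 * s ^ 2) := by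
    refine (le_abs_self _).trans ?_
    rw [abs_mul, abs_mul, abs_abs, hp.abs_ν, one_mul]
    gcongr
    exact hp.abs_beta_le h i
  have e6 : signs β i * (ν * wedge V R') ≤ C * (C ^ 3 * s ^ 2) := by
    refine (le_abs_self _).trans ?_
    rwa [abs_mul, abs_mul, hp.abs_signs, hp.abs_ν, one_mul, one_mul]
  have e7 : C * (C ^ 3 * s ^ 2) ≤ C ^ 5 * s ^ 2 := by
    calc C * (C ^ 3 * s ^ 2) = C ^ 4 * s ^ 2 := by ring
      _ ≤ _ := by gcongr ?_ * _; exact pow_le_pow_right₀ hC (by norm_num)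
  have e8 : 8 * C ^ 5 * s * s ≤ c ^ 3 * s := by
    gcongr
    refine le_trans ?_ hct
    gcongr
    exact hs.2
  rw [e3]
  nlinarith [mul_le_mul_of_nonneg_right e4 hs0]

/-- The reference control sits at a vertex of the cube, so the `ℓ¹` gap is a linear function of the
other control. -/
theorem IsParallel.sub_signs_eq (hp : IsParallel A B e β ν c) {w : Fin M → ℝ}
    (hw : w ∈ Icc (-1 : Fin M → ℝ) 1) (i : Fin M) :
    w i - signs β i = -(signs β i * |w i - signs β i|) := by
  have k3 := _root_.abs_le.1 (abs_le_one_of_mem_cube hw i)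
  rcases eq_or_eq_neg_of_abs_eq (hp.abs_signs i) with k4 | k4
  · rw [k4, abs_of_nonpos (by linarith)]; ring
  · rw [k4, abs_of_nonneg (by linarith)]; ring

theorem _root_.HasDerivAt.wedge {a b : ℝ → Plane} {a' b' : Plane} {s : ℝ}
    (ha : HasDerivAt a a' s) (hb : HasDerivAt b b' s) :
    HasDerivAt (fun r => MinTime.wedge (a r) (b r))
      (MinTime.wedge a' (b s) + MinTime.wedge (a s) b') s := by
  have hc : ∀ {f : ℝ → Plane} {f' : Plane} (j : Fin 2), HasDerivAt f f' s →
      HasDerivAt (fun r => f r j) (f' j) s := fun j hf =>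
    (EuclideanSpace.proj j : Plane →L[ℝ] ℝ).hasFDerivAt.comp_hasDerivAt s hf
  have h1 := ((hc 0 ha).fun_mul (hc 1 hb)).fun_sub ((hc 1 ha).fun_mul (hc 0 hb))
  unfold MinTime.wedge
  refine h1.congr_deriv ?_
  ring

theorem abs_planeTrace_le (D : Plane →L[ℝ] Plane) : |planeTrace D| ≤ 2 * ‖D‖ := by
  have h1 : ∀ j : Fin 2, |D (EuclideanSpace.single j 1) j| ≤ ‖D‖ := by
    intro j
    refine (abs_apply_le_norm _ j).trans ?_
    simpa using D.le_opNorm (EuclideanSpace.single j 1)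
  have h2 := abs_add_le (D (EuclideanSpace.single 0 1) 0) (D (EuclideanSpace.single 1 1) 1)
  rw [planeTrace]
  linarith [h1 0, h1 1]

theorem sq_le_of_le_two_mul_add {x a b : ℝ} (hx : 0 ≤ x) (h : x ≤ 2 * (a + b)) :
    x ^ 2 ≤ 8 * a ^ 2 + 8 * b ^ 2 := by
  nlinarith [sq_nonneg (a - b)]

theorem integral_gap_le {u v : ℝ → Fin M → ℝ} (hu : IsControl u) (hv : IsControl v) {r t : ℝ}
    (hrt : r ≤ t) : ∫ s in r..t, gap u v s ≤ 2 * M * (t - r) := by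
  have h1 : ∫ _ in r..t, (2 * M : ℝ) = 2 * M * (t - r) := by
    rw [intervalIntegral.integral_const, smul_eq_mul, mul_comm]
  rw [← h1]
  exact intervalIntegral.integral_mono_ae hrt (gap_intervalIntegrable hu hv _ _)
    intervalIntegrable_const (gap_le hu hv)

theorem moment_intervalIntegrable {u v : ℝ → Fin M → ℝ} (hu : IsControl u) (hv : IsControl v)
    (a b : ℝ) : IntervalIntegrable (fun s => s * gap u v s) volume a b :=
  (gap_intervalIntegrable hu hv a b).continuousOn_mul continuousOn_id

/-- Every reachable point lies, up to a quadratic error, on one side of the tangent to the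
extremal with the constant control `signs β`, strictly so if its control differs. -/
theorem IsParallel.extremal_inequality (hp : IsParallel A B e β ν c) (h : IsNice F G A B C)
    {t : ℝ} (ht : 0 ≤ t) (hCt : C * t ≤ 1 / 4) (hct : 256 * C ^ 5 * t ≤ c ^ 3) {X : ℝ → Plane}
    (hXc : Continuous X) (hX : IsTrajectory (revDynamics F G) (fun _ => signs β) 0 t X)
    {v : ℝ → Fin M → ℝ} (hv : IsControl v) {x : ℝ → Plane}
    (hx : IsTrajectory (revDynamics F G) v 0 t x) :
    ν * wedge (revDynamics F G (X t) (signs β)) (x t - X t) ≤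
      -(c ^ 3 / 16) * (∫ s in (0 : ℝ)..t, s * gap v (fun _ => signs β) s) +
        32 * C ^ 2 * ‖x t - X t‖ ^ 2 := by
  have hC := h.one_le
  have hf := h.isField_rev
  have hσ := hp.isControl
  have hlt : ‖(0 : Plane)‖ + C * t < 1 := by rw [norm_zero]; linarith
  have ht1 : t ≤ 1 := by nlinarith
  have hXb := fun s hs => (hX.norm_lt_one hf hσ hlt (r := s) hs)
  have hxb := fun s hs => (hx.norm_lt_one hf hv hlt (r := s) hs)
  set V : Plane → Plane := fun y => revDynamics F G y (signs β) with hV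
  have hVc : ContDiff ℝ 1 V := by
    have h1 := h.F_contDiff
    have h2 := h.G_contDiff
    simp only [hV, revDynamics, dynamics]
    fun_prop
  have hVd : Differentiable ℝ V := hVc.differentiable (by simp)
  have hVn : ∀ y : Plane, ‖y‖ ≤ 1 → ‖V y‖ ≤ C := fun y hy => hf.norm_le y hy _ hp.signs_mem
  have hDn : ∀ y : Plane, ‖y‖ < 1 → ‖fderiv ℝ V y‖ ≤ C := by
    intro y hy
    refine (hVd y).hasFDerivAt.le_of_lip' (by linarith) ?_
    have : ∀ᶠ z in 𝓝 y, ‖z‖ < 1 := (continuous_norm.continuousAt).eventually_lt_const hy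
    filter_upwards [this] with z hz
    exact hf.lip z y hz.le hy.le _ hp.signs_mem
  have hVt : ∀ y z : Plane, ‖V z - V y - fderiv ℝ V y (z - y)‖ ≤ C * ‖z - y‖ ^ 2 := by
    intro y z
    have h1 := h.taylor _ hp.signs_mem y z
    have h2 : fderiv ℝ V y = -fderiv ℝ (fun z => dynamics F G z (signs β)) y := by
      simp only [hV, revDynamics]
      exact fderiv_fun_neg
    rw [← norm_neg] at h1
    refine le_of_eq_of_le (congrArg norm ?_) h1
    rw [h2]
    simp only [hV, revDynamics, neg_apply]
    abel
  set tr : ℝ → ℝ := fun s => planeTrace (fderiv ℝ V (X s)) with htr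
  have htrc : Continuous tr :=
    continuous_planeTrace.comp ((hVc.continuous_fderiv (by simp)).comp hXc)
  -- Integrating factor that cancels the trace term of `wedge_map_add`.
  set E : ℝ → ℝ := fun s => Real.exp (-∫ r in (0 : ℝ)..s, tr r) with hE
  have hEd : ∀ s, HasDerivAt E (E s * (-tr s)) s := fun s =>
    ((htrc.integral_hasStrictDerivAt 0 s).hasDerivAt.fun_neg).exp
  have hEc : Continuous E := continuous_iff_continuousAt.2 fun s => (hEd s).continuousAt
  have hEac : AbsolutelyContinuousOnInterval E 0 t := by
    refine (ContDiff.contDiffOn ?_).absolutelyContinuousOnInterval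
    rw [contDiff_one_iff_deriv]
    refine ⟨fun s => (hEd s).differentiableAt, ?_⟩
    have : deriv E = fun s => E s * (-tr s) := funext fun s => (hEd s).deriv
    rw [this]
    fun_prop
  have hEb : ∀ s ∈ Icc 0 t, 1 / 2 ≤ E s ∧ E s ≤ 2 := by
    intro s hs
    have h1 : |∫ r in (0 : ℝ)..s, tr r| ≤ 1 / 2 := by
      have : ‖∫ r in (0 : ℝ)..s, tr r‖ ≤ (2 * C) * |s - 0| := by
        refine intervalIntegral.norm_integral_le_of_norm_le_const fun r hr => ?_
        rw [uIoc_of_le hs.1] at hr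
        refine (abs_planeTrace_le _).trans ?_
        gcongr
        exact hDn _ (hXb r ⟨hr.1.le, hr.2.trans hs.2⟩)
      rw [sub_zero, abs_of_nonneg hs.1, Real.norm_eq_abs] at this
      have : C * s ≤ C * t := by gcongr; exact hs.2
      linarith
    have h2 := abs_le.1 h1
    constructor
    · have := Real.add_one_le_exp (-∫ r in (0 : ℝ)..s, tr r)
      simp only [hE]; linarith
    · have h3 := Real.add_one_le_exp (∫ r in (0 : ℝ)..s, tr r)
      have h4 : E s * Real.exp (∫ r in (0 : ℝ)..s, tr r) = 1 := by
        rw [hE, ← Real.exp_add]; simp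
      have h5 : 0 < E s := Real.exp_pos _
      nlinarith
  set g := gap v (fun _ => signs β) with hg
  have hgi := gap_intervalIntegrable hv hσ
  set ψ : ℝ → ℝ := fun s => (ν * E s) * wedge (V (X s)) (x s - X s) with hψ
  have hVX : ∀ j : Fin 2, AbsolutelyContinuousOnInterval (fun s => V (X s) j) 0 t := by
    intro j
    refine LipschitzOnWith.absolutelyContinuousOnInterval (K := (C * C).toNNReal)
      (LipschitzOnWith.of_dist_le_mul fun r hr r' hr' => ?_)
    rw [uIcc_of_le ht] at hr hr'
    rw [Real.coe_toNNReal _ (by positivity), Real.dist_eq, Real.dist_eq]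
    calc _ ≤ ‖V (X r) - V (X r')‖ := abs_apply_le_norm (V (X r) - V (X r')) j
      _ ≤ C * ‖X r - X r'‖ := hf.lip _ _ (hXb r hr).le (hXb r' hr').le _ hp.signs_mem
      _ ≤ C * (C * |r - r'|) := by gcongr; exact hX.norm_sub_le hf hσ hlt hr' hr
      _ = _ := by ring
  have hz : ∀ j : Fin 2, AbsolutelyContinuousOnInterval (fun s => (x s - X s) j) 0 t := fun j =>
    (hx.absolutelyContinuous hf hv ht hlt j).fun_sub (hX.absolutelyContinuous hf hσ ht hlt j)
  have hψac : AbsolutelyContinuousOnInterval ψ 0 t :=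
    (hEac.const_mul ν).fun_mul (((hVX 0).fun_mul (hz 1)).fun_sub ((hVX 1).fun_mul (hz 0)))
  set tail : ℝ → ℝ := fun s => ∫ r in s..t, g r with htail
  have htailc : Continuous tail := by
    have : tail = fun s => -∫ r in t..s, g r := by
      funext s; rw [htail]; exact intervalIntegral.integral_symm _ _
    rw [this]
    exact (intervalIntegral.continuous_primitive hgi t).neg
  have htb : ∀ s ∈ Icc 0 t, 0 ≤ tail s ∧ tail s ≤ 2 * C * t := by
    intro s hs
    refine ⟨intervalIntegral.integral_nonneg hs.2 fun r _ => gap_nonneg _ _ r, ?_⟩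
    calc tail s ≤ 2 * M * (t - s) := integral_gap_le hv hσ hs.2
      _ ≤ 2 * C * t := by
        have := h.card_le
        have : t - s ≤ t := by linarith [hs.1]
        have : 0 ≤ t - s := by linarith [hs.2]
        gcongr
  -- Gronwall is run backwards from time `t`, because the estimate must involve the end points.
  -- Since `tail s ≤ 2 * C * t`, the square of the tail costs only a small factor times the tail.
  have hzb : ∀ s ∈ Icc 0 t, ‖x s - X s‖ ^ 2 ≤ 8 * ‖x t - X t‖ ^ 2 + 16 * C ^ 3 * t * tail s := by
    intro s hs
    have h1 := norm_sub_trajectory_le hf (by linarith) hv hx (fun r hr => (hxb r hr).le) hσ hX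
      (fun r hr => (hXb r hr).le) hs ⟨ht, le_rfl⟩
    rw [intervalIntegral.integral_symm, abs_neg] at h1
    obtain ⟨h2, h3⟩ := htb s hs
    change _ ≤ 2 * (_ + C * |tail s|) at h1
    rw [abs_of_nonneg h2] at h1
    have h4 := sq_le_of_le_two_mul_add (norm_nonneg _) h1
    have h5 : (C * tail s) ^ 2 ≤ 2 * C ^ 3 * t * tail s := by
      calc (C * tail s) ^ 2 = C ^ 2 * (tail s * tail s) := by ring
        _ ≤ C ^ 2 * (2 * C * t * tail s) := by gcongr
        _ = _ := by ring
    linarith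
  set bd : ℝ → ℝ := fun s => 16 * C ^ 2 * ‖x t - X t‖ ^ 2 + 32 * C ^ 5 * t * tail s -
    c ^ 3 / 4 * (s * g s) with hbd
  have hbdi : IntervalIntegrable bd volume 0 t :=
    (((continuous_const.add (continuous_const.mul htailc)).intervalIntegrable 0 t)).sub
      ((moment_intervalIntegrable hv hσ 0 t).const_mul _)
  have hct8 : 8 * C ^ 5 * t ≤ c ^ 3 := by
    have : 0 ≤ C ^ 5 * t := by positivity
    linarith
  have hder : ∀ᵐ s : ℝ, s ∈ Ioo 0 t → ∃ d, HasDerivAt ψ d s ∧ d ≤ bd s := by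
    filter_upwards [hx.ae_hasDerivAt hf hv ht, hX.ae_hasDerivAt hf hσ ht, hv.2] with s h1 h2 h3 hs
    have hs' := Ioo_subset_Icc_self hs
    specialize h1 hs
    specialize h2 hs
    have hVXd : HasDerivAt (fun r => V (X r)) (fderiv ℝ V (X s) (V (X s))) s :=
      (hVd (X s)).hasFDerivAt.comp_hasDerivAt s h2
    have hd := ((hEd s).const_mul ν).fun_mul (hVXd.wedge (h1.fun_sub h2))
    refine ⟨_, hd, ?_⟩
    set z := x s - X s with hz
    set D := fderiv ℝ V (X s)
    have hz' : revDynamics F G (x s) (v s) - revDynamics F G (X s) (signs β) =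
        D z + (V (x s) - V (X s) - D z) - ∑ i, (v s i - signs β i) • G i (x s) := by
      simp only [hV, revDynamics, dynamics, sub_smul, Finset.sum_sub_distrib]
      abel
    have htrace := wedge_map_add D (V (X s)) z
    have hcalc : ν * (E s * (-tr s)) * wedge (V (X s)) z +
        ν * E s * (wedge (D (V (X s))) z + wedge (V (X s))
          (revDynamics F G (x s) (v s) - revDynamics F G (X s) (signs β))) =
        E s * (ν * wedge (V (X s)) (V (x s) - V (X s) - D z) -
          ν * ∑ i, (v s i - signs β i) * wedge (V (X s)) (G i (x s))) := by
      have h5 : tr s * wedge (V (X s)) z = wedge (D (V (X s))) z + wedge (V (X s)) (D z) :=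
        htrace.symm
      rw [hz', wedge_sub_right (V (X s)) (D z + _), wedge_add_right, wedge_sum_right]
      simp only [wedge_smul_right]
      linear_combination (-ν * E s) * h5
    rw [hcalc]
    have hr1 : ν * wedge (V (X s)) (V (x s) - V (X s) - D z) ≤ C * (C * ‖z‖ ^ 2) := by
      refine (le_abs_self _).trans ?_
      rw [abs_mul, hp.abs_ν, one_mul]
      refine (abs_wedge_le _ _).trans ?_
      gcongr
      · exact hVn _ (hXb s hs').le
      · exact hVt _ _
    have hxs : ‖x s‖ ≤ C * s := by simpa using hx.norm_le hf hv hlt hs'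
    have hr2 : -(ν * ∑ i, (v s i - signs β i) * wedge (V (X s)) (G i (x s))) ≤
        -(c ^ 3 / 2) * s * g s := by
      rw [← mul_neg, ← Finset.sum_neg_distrib, Finset.mul_sum, hg, gap, Finset.mul_sum]
      refine Finset.sum_le_sum fun i _ => ?_
      have k1 := hp.switching_le h (t := t) (by linarith) hct8 hX hs' hxs i
      have k2 := hp.sub_signs_eq h3 i
      calc _ = |v s i - signs β i| * (signs β i * (ν * wedge (V (X s)) (G i (x s)))) := by
            conv_lhs => rw [k2]
            ring
        _ ≤ |v s i - signs β i| * (-(c ^ 3 / 2) * s) := by gcongr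
        _ = _ := by ring
    obtain ⟨E1, E2⟩ := hEb s hs'
    have hzs := hzb s hs'
    have hgs : 0 ≤ s * g s := mul_nonneg hs.1.le (gap_nonneg _ _ s)
    have hc3 : 0 < c ^ 3 := pow_pos hp.c_pos 3
    have k5 : E s * (C * (C * ‖z‖ ^ 2)) ≤
        2 * (C * (C * (8 * ‖x t - X t‖ ^ 2 + 16 * C ^ 3 * t * tail s))) := by gcongr
    have k6 : 1 / 2 * (c ^ 3 / 2 * (s * g s)) ≤ E s * (c ^ 3 / 2 * (s * g s)) := by gcongr
    calc _ ≤ E s * (C * (C * ‖z‖ ^ 2) + -(c ^ 3 / 2) * s * g s) := by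
          gcongr
          linarith
      _ = E s * (C * (C * ‖z‖ ^ 2)) - E s * (c ^ 3 / 2 * (s * g s)) := by ring
      _ ≤ 2 * (C * (C * (8 * ‖x t - X t‖ ^ 2 + 16 * C ^ 3 * t * tail s))) -
          1 / 2 * (c ^ 3 / 2 * (s * g s)) := sub_le_sub k5 k6
      _ = bd s := by rw [hbd]; ring
  have hfin := sub_le_integral_of_ae_hasDerivAt_le ht hψac hbdi hder
  set m := ∫ s in (0 : ℝ)..t, s * g s with hm
  have hm0 : 0 ≤ m := intervalIntegral.integral_nonneg ht fun s hs =>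
    mul_nonneg hs.1 (gap_nonneg _ _ s)
  have hbdint : ∫ s in (0 : ℝ)..t, bd s =
      t * (16 * C ^ 2 * ‖x t - X t‖ ^ 2) + 32 * C ^ 5 * t * m - c ^ 3 / 4 * m := by
    have hi1 : IntervalIntegrable
        (fun s => 16 * C ^ 2 * ‖x t - X t‖ ^ 2 + 32 * C ^ 5 * t * tail s) volume 0 t :=
      (continuous_const.add (continuous_const.mul htailc)).intervalIntegrable 0 t
    have hi2 : IntervalIntegrable (fun s => 32 * C ^ 5 * t * tail s) volume 0 t :=
      (continuous_const.mul htailc).intervalIntegrable 0 t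
    simp only [hbd]
    rw [intervalIntegral.integral_sub hi1
      ((moment_intervalIntegrable hv hσ 0 t).const_mul _),
      intervalIntegral.integral_add intervalIntegrable_const hi2, intervalIntegral.integral_const,
      intervalIntegral.integral_const_mul, intervalIntegral.integral_const_mul,
      integral_tail_gap hv hσ, sub_zero, smul_eq_mul]
  have hψ0 : ψ 0 = 0 := by
    simp [hψ, hx.apply_zero ht, hX.apply_zero ht, wedge]
  rw [hbdint, hψ0, sub_zero] at hfin
  obtain ⟨E1, E2⟩ := hEb t ⟨ht, le_rfl⟩
  have hc3 : 0 < c ^ 3 := pow_pos hp.c_pos 3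
  -- The constant 256 in the smallness of `t` is chosen for this: the tail terms, integrated into
  -- the moment, use up at most half of the gain `c ^ 3 / 4`.
  have l1 : 32 * C ^ 5 * t * m ≤ c ^ 3 / 8 * m := by gcongr; linarith
  have l2 : t * (16 * C ^ 2 * ‖x t - X t‖ ^ 2) ≤ 16 * C ^ 2 * ‖x t - X t‖ ^ 2 :=
    mul_le_of_le_one_left (by positivity) ht1
  have l3 : E t * (ν * wedge (V (X t)) (x t - X t)) ≤
      E t * (-(c ^ 3 / 16) * m + 32 * C ^ 2 * ‖x t - X t‖ ^ 2) := by
    have l4 : E t * (c ^ 3 / 16 * m) ≤ 2 * (c ^ 3 / 16 * m) := by gcongr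
    have l5 : 1 / 2 * (32 * C ^ 2 * ‖x t - X t‖ ^ 2) ≤ E t * (32 * C ^ 2 * ‖x t - X t‖ ^ 2) := by
      gcongr
    have l6 : ψ t = E t * (ν * wedge (V (X t)) (x t - X t)) := by rw [hψ]; ring
    rw [← l6]
    linarith
  exact le_of_mul_le_mul_left l3 (by linarith)

end Parallel

end

/-! ### Optimality of the extremals, and their points are singular -/

section

variable {M : ℕ} {F : Plane → Plane} {G : Fin M → Plane → Plane} {A : Plane →L[ℝ] Plane}
  {B : Fin M → Plane} {C : ℝ} {e : Plane} {β : Fin M → ℝ} {ν c : ℝ}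

/-- `T` is small with respect to the constants of the system. -/
structure IsSmall (C c T : ℝ) : Prop where
  nonneg : 0 ≤ T
  mul_le : C * T ≤ 1 / 4
  pow_mul_le : 256 * C ^ 5 * T ≤ c ^ 3

theorem IsSmall.mono {T t : ℝ} (hC : 1 ≤ C) (hT : IsSmall C c T) (ht : 0 ≤ t) (htT : t ≤ T) :
    IsSmall C c t :=
  ⟨ht, le_trans (by gcongr) hT.mul_le, le_trans (by gcongr) hT.pow_mul_le⟩

theorem IsParallel.c_le_C (hp : IsParallel A B e β ν c) (h : IsNice F G A B C) : c ≤ C :=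
  (hp.c_le ⟨0, hp.card_pos⟩).trans (hp.abs_beta_le h _)

theorem IsParallel.sq_mul_le (hp : IsParallel A B e β ν c) (h : IsNice F G A B C) {t : ℝ}
    (ht : IsSmall C c t) : C ^ 2 * t ≤ c / 4 := by
  have hC := h.one_le
  have hc := hp.c_pos
  have h1 := hp.c_le_C h
  have h2 : C ^ 3 * (256 * (C ^ 2 * t)) ≤ C ^ 3 * c := by
    calc C ^ 3 * (256 * (C ^ 2 * t)) = 256 * C ^ 5 * t := by ring
      _ ≤ c ^ 3 := ht.pow_mul_le
      _ = c * c * c := by ring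
      _ ≤ C * C * c := by gcongr
      _ ≤ C ^ 3 * c := by
        gcongr
        nlinarith [mul_nonneg (show (0 : ℝ) ≤ C by linarith) (show (0 : ℝ) ≤ C by linarith)]
  have h3 := le_of_mul_le_mul_left h2 (by positivity)
  linarith

/-- The velocity of the extremal stays close to its value at the origin. -/
theorem IsParallel.norm_velocity_pos (hp : IsParallel A B e β ν c) (h : IsNice F G A B C)
    {t : ℝ} (ht : IsSmall C c t) {X : ℝ → Plane}
    (hX : IsTrajectory (revDynamics F G) (fun _ => signs β) 0 t X) :
    0 < ‖revDynamics F G (X t) (signs β)‖ := by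
  have hC := h.one_le
  have hlt : ‖(0 : Plane)‖ + C * t < 1 := by rw [norm_zero]; linarith [ht.mul_le]
  have hm : t ∈ Icc 0 t := ⟨ht.nonneg, le_rfl⟩
  have h1 := hX.norm_lt_one h.isField_rev hp.isControl hlt hm
  have h2 := hX.norm_le h.isField_rev hp.isControl hlt hm
  have h3 := h.isField_rev.lip (X t) 0 h1.le (by simp) _ hp.signs_mem
  rw [hp.revDynamics_zero h, sub_zero] at h3
  have h4 := norm_sub_norm_le (-(totalSize β • e)) (revDynamics F G (X t) (signs β))
  rw [norm_sub_rev, norm_neg, norm_smul, hp.norm_e, mul_one, Real.norm_eq_abs] at h4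
  have h5 := le_abs_self (totalSize β)
  have h6 := hp.c_le_totalSize
  have h7 := hp.sq_mul_le h ht
  have h8 : C * ‖X t‖ ≤ C * (C * t) := by
    rw [norm_zero, zero_add] at h2
    gcongr
  have := hp.c_pos
  nlinarith

theorem moment_nonneg (u v : ℝ → Fin M → ℝ) {t : ℝ} (ht : 0 ≤ t) :
    0 ≤ ∫ s in (0 : ℝ)..t, s * gap u v s :=
  intervalIntegral.integral_nonneg ht fun s hs => mul_nonneg hs.1 (gap_nonneg u v s)

theorem moment_pos_of_le_gap {u v : ℝ → Fin M → ℝ} (hu : IsControl u) (hv : IsControl v)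
    {d t : ℝ} (hd : 0 < d) (hdt : d ≤ t) (h : ∀ r < d, 1 ≤ gap u v r) :
    0 < ∫ s in (0 : ℝ)..t, s * gap u v s := by
  have hi := moment_intervalIntegrable hu hv
  rw [← intervalIntegral.integral_add_adjacent_intervals (hi 0 d) (hi d t)]
  have h1 : 0 ≤ ∫ s in d..t, s * gap u v s := intervalIntegral.integral_nonneg hdt fun s hs =>
    mul_nonneg (hd.le.trans hs.1) (gap_nonneg u v s)
  have h2 : ∫ s in (0 : ℝ)..d, s ≤ ∫ s in (0 : ℝ)..d, s * gap u v s := by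
    refine intervalIntegral.integral_mono_on_of_le_Ioo hd.le (continuous_id.intervalIntegrable _ _)
      (hi 0 d) fun s hs => le_mul_of_one_le_right hs.1.le (h s hs.2)
  rw [integral_id] at h2
  have : 0 < d ^ 2 := by positivity
  linarith

/-- A trajectory which meets the extremal at time `t` has the same control. -/
theorem IsParallel.moment_le_zero (hp : IsParallel A B e β ν c) (h : IsNice F G A B C)
    {t : ℝ} (ht : IsSmall C c t) {X : ℝ → Plane} (hXc : Continuous X)
    (hX : IsTrajectory (revDynamics F G) (fun _ => signs β) 0 t X)
    {v : ℝ → Fin M → ℝ} (hv : IsControl v) {x : ℝ → Plane}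
    (hx : IsTrajectory (revDynamics F G) v 0 t x) (hxX : x t = X t) :
    ∫ s in (0 : ℝ)..t, s * gap v (fun _ => signs β) s ≤ 0 := by
  have h1 := hp.extremal_inequality h ht.nonneg ht.mul_le ht.pow_mul_le hXc hX hv hx
  rw [hxX, sub_self, norm_zero] at h1
  have h2 : wedge (revDynamics F G (X t) (signs β)) 0 = 0 := by simp [wedge]
  rw [h2] at h1
  have hc : 0 < c ^ 3 := pow_pos hp.c_pos 3
  nlinarith

/-- A faster route, preceded by waiting at the origin, would reach `X t` at time `t` with zero
control at first; its gap to controls of modulus 1 gives a positive moment, against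
`moment_le_zero`. -/
theorem IsParallel.minTime_extremal (hp : IsParallel A B e β ν c) (h : IsNice F G A B C)
    {t : ℝ} (ht : IsSmall C c t) {X : ℝ → Plane} (hXc : Continuous X)
    (hX : IsTrajectory (revDynamics F G) (fun _ => signs β) 0 t X) :
    minTime F G (X t) = ENNReal.ofReal t := by
  refine le_antisymm (steers_of_rev_zero h hp.isControl ht.nonneg hX).minTime_le ?_
  refine le_iInf₂ fun s hs => ?_
  by_contra! hlt
  have hst : s < t := (ENNReal.ofReal_lt_ofReal_iff_of_nonneg hs.1).1 hlt
  obtain ⟨u, hu, hu0, x, hx, hxt⟩ := hs.exists_rev_wait h hst.le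
  have h1 := hp.moment_le_zero h ht hXc hX hu hx hxt
  have h2 := moment_pos_of_le_gap hu hp.isControl (d := t - s) (t := t) (by linarith)
    (by linarith [hs.1]) fun r hr => by
      simp only [gap, hu0 r hr, Pi.zero_apply, zero_sub, abs_neg, hp.abs_signs]
      have : (1 : ℝ) ≤ M := by exact_mod_cast hp.card_pos
      simpa using this
  linarith

theorem IsParallel.extremal_ne (hp : IsParallel A B e β ν c) (h : IsNice F G A B C)
    {t : ℝ} (ht : IsSmall C c t) (ht0 : 0 < t) {X Y : ℝ → Plane} (hXc : Continuous X)
    (hX : IsTrajectory (revDynamics F G) (fun _ => signs β) 0 t X)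
    (hY : IsTrajectory (revDynamics F G) (fun _ => signs (-β)) 0 t Y) : X t ≠ Y t := by
  intro hXY
  have h1 := hp.moment_le_zero h ht hXc hX hp.neg.isControl hY hXY.symm
  have h2 := moment_pos_of_le_gap hp.neg.isControl hp.isControl ht0 le_rfl fun r _ => by
    have h3 : ∀ i, |signs (-β) i - signs β i| = 2 := fun i => by
      rw [signs_neg, Pi.neg_apply, show -signs β i - signs β i = -(2 * signs β i) by ring, abs_neg,
        abs_mul, hp.abs_signs]
      norm_num
    simp only [gap, h3]
    have : (1 : ℝ) ≤ M := by exact_mod_cast hp.card_pos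
    simp only [Finset.sum_const, Finset.card_univ, Fintype.card_fin, nsmul_eq_mul]
    linarith
  linarith

/-- The rotation by a right angle. -/
def rot (v : Plane) : Plane := !₂[-v 1, v 0]

theorem inner_rot (v z : Plane) : inner ℝ (rot v) z = wedge v z := by
  rw [inner_plane]; simp [rot, wedge]; ring

theorem norm_rot (v : Plane) : ‖rot v‖ = ‖v‖ := by
  rw [← sq_eq_sq₀ (norm_nonneg _) (norm_nonneg _), norm_sq_plane, norm_sq_plane]
  simp [rot]; ring

/-- The normal is the velocity rotated by a right angle. `extremal_inequality` without its gain is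
the proximal inequality. By `switching_le` the control `signs β` minimizes the Hamiltonian, with
value 0 as the normal is orthogonal to the velocity. -/
theorem IsParallel.extremal_mem_singularSet (hp : IsParallel A B e β ν c) (h : IsNice F G A B C)
    {t τ : ℝ} (ht : IsSmall C c t) (htτ : t ≤ τ) {X : ℝ → Plane} (hXc : Continuous X)
    (hX : IsTrajectory (revDynamics F G) (fun _ => signs β) 0 t X) :
    X t ∈ singularSet F G τ := by
  have hC := h.one_le
  have hsteer := steers_of_rev_zero h hp.isControl ht.nonneg hX
  have hlt : ‖(0 : Plane)‖ + C * t < 1 := by rw [norm_zero]; linarith [ht.mul_le]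
  have hm : t ∈ Icc 0 t := ⟨ht.nonneg, le_rfl⟩
  have hVpos := hp.norm_velocity_pos h ht hX
  set V := revDynamics F G (X t) (signs β) with hV
  have hinn : ∀ z, inner ℝ ((ν / ‖V‖) • rot V) z = ν * wedge V z / ‖V‖ := by
    intro z
    rw [real_inner_smul_left, inner_rot]; ring
  refine ⟨⟨t, htτ, hsteer⟩, (ν / ‖V‖) • rot V, ?_, ⟨?_, 32 * C ^ 2 / ‖V‖, by positivity, ?_⟩, ?_⟩
  · rw [norm_smul, norm_rot, norm_div, norm_norm, Real.norm_eq_abs, hp.abs_ν,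
      div_mul_cancel₀ _ hVpos.ne']
  · rw [hp.minTime_extremal h ht hXc hX, ENNReal.toReal_ofReal ht.nonneg]
    exact ⟨t, le_rfl, hsteer⟩
  · intro y hy
    rw [hp.minTime_extremal h ht hXc hX, ENNReal.toReal_ofReal ht.nonneg,
      mem_reachable_iff h] at hy
    obtain ⟨u, hu, x, hx, rfl⟩ := hy.exists_rev h
    have h1 := hp.extremal_inequality h ht.nonneg ht.mul_le ht.pow_mul_le hXc hX hu hx
    have h2 := moment_nonneg u (fun _ => signs β) ht.nonneg
    have hc : 0 < c ^ 3 := pow_pos hp.c_pos 3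
    rw [hinn, div_mul_eq_mul_div]
    refine div_le_div_of_nonneg_right (h1.trans ?_) hVpos.le
    have := mul_nonneg hc.le h2
    linarith
  · have hX2 : ‖X t‖ ≤ C * t := by
      simpa using hX.norm_le h.isField_rev hp.isControl hlt hm
    have hct8 : 8 * C ^ 5 * t ≤ c ^ 3 := by
      have := ht.nonneg
      have : 0 ≤ C ^ 5 * t := by positivity
      linarith [ht.pow_mul_le]
    refine IsLeast.csInf_eq ⟨⟨signs β, hp.signs_mem, ?_⟩, ?_⟩
    · have : dynamics F G (X t) (signs β) = -V := by rw [hV, revDynamics, neg_neg]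
      simp [hinn, this, wedge_neg_right, wedge_self]
    · rintro _ ⟨w, hw, rfl⟩
      have h1 : dynamics F G (X t) w = -V + ∑ i, (w i - signs β i) • G i (X t) := by
        simp only [hV, revDynamics, neg_neg, dynamics, sub_smul, Finset.sum_sub_distrib]
        abel
      simp only [hinn]
      refine div_nonneg ?_ (norm_nonneg _)
      rw [h1, wedge_add_right, wedge_neg_right, wedge_self, wedge_sum_right, neg_zero, zero_add,
        Finset.mul_sum]
      refine Finset.sum_nonneg fun i _ => ?_
      have h2 := hp.switching_le h (by linarith [ht.mul_le]) hct8 hX hm hX2 i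
      have h3 : 0 ≤ c ^ 3 / 2 * t := by
        have := hp.c_pos
        have := ht.nonneg
        positivity
      rw [wedge_smul_right, hp.sub_signs_eq hw i]
      have h4 := abs_nonneg (w i - signs β i)
      have h5 : 0 ≤ |w i - signs β i| * -(signs β i * (ν * wedge V (G i (X t)))) :=
        mul_nonneg h4 (by linarith)
      linarith [h5]

end

/-! ### Crossing a nearly straight curve; the transversal estimate -/

section

variable {M : ℕ} {F : Plane → Plane} {G : Fin M → Plane → Plane} {A : Plane →L[ℝ] Plane}
  {B : Fin M → Plane} {C : ℝ} {e : Plane} {β : Fin M → ℝ} {ν c : ℝ}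

/-- A path which joins the two sides of a nearly straight curve crosses it. -/
theorem exists_crossing {γ p : ℝ → Plane} {k D b₀ a : ℝ} (he : ‖e‖ = 1) (hc : 0 < c) (hck : c ≤ k)
    (hD : 0 ≤ D) (hb₀ : 0 ≤ b₀) (ha : 0 ≤ a) (hν : |ν| = 1)
    (hγ : ∀ b' ∈ Icc (-b₀) b₀, ∀ b ∈ Icc b' b₀,
      ‖γ b - γ b' + ((b - b') * k) • e‖ ≤ c / 4 * (b - b'))
    (hγ0 : γ 0 = 0) (hγ2 : ∀ b ∈ Icc (-b₀) b₀, |wedge e (γ b)| ≤ D * b ^ 2)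
    (hp : ContinuousOn p (Icc (-a) a)) (hp1 : ∀ α ∈ Icc (-a) a, |inner ℝ e (p α)| ≤ c / 2 * b₀)
    (hpa : D * b₀ ^ 2 < ν * wedge e (p a)) (hpa' : ν * wedge e (p (-a)) < -(D * b₀ ^ 2)) :
    ∃ α ∈ Icc (-a) a, ∃ b ∈ Icc (-b₀) b₀, p α = γ b := by
  -- The curve is a graph over the line of `e`: its coordinate `l` decreases at rate at least `3 * c
  -- / 4`.
  set l : ℝ → ℝ := fun b => inner ℝ e (γ b) with hl
  have hl1 : ∀ b' ∈ Icc (-b₀) b₀, ∀ b ∈ Icc b' b₀, 3 * c / 4 * (b - b') ≤ l b' - l b := by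
    intro b' hb' b hb
    have h1 := (abs_real_inner_le_norm e (γ b - γ b' + ((b - b') * k) • e)).trans
      (le_of_eq_of_le (by rw [he, one_mul]) (hγ b' hb' b hb))
    rw [inner_add_right, inner_sub_right, real_inner_smul_right, real_inner_self_eq_norm_sq, he]
      at h1
    have h2 := (abs_le.1 h1).2
    have h3 : c * (b - b') ≤ k * (b - b') := by
      have : 0 ≤ b - b' := sub_nonneg.2 hb.1
      gcongr
    simp only [hl]
    nlinarith
  have hl2 : ∀ b ∈ Icc (-b₀) b₀, ∀ b' ∈ Icc (-b₀) b₀, 3 * c / 4 * |b - b'| ≤ |l b - l b'| := by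
    intro b hb b' hb'
    rcases le_total b' b with hle | hle
    · have := hl1 b' hb' b ⟨hle, hb.2⟩
      rw [abs_of_nonneg (sub_nonneg.2 hle), abs_sub_comm]
      exact this.trans (le_abs_self _)
    · have := hl1 b hb b' ⟨hle, hb'.2⟩
      rw [abs_sub_comm, abs_of_nonneg (sub_nonneg.2 hle)]
      exact this.trans (le_abs_self _)
  have hγc : ContinuousOn γ (Icc (-b₀) b₀) := by
    have hLip : ∀ b' ∈ Icc (-b₀) b₀, ∀ b ∈ Icc b' b₀, ‖γ b - γ b'‖ ≤ (c + k) * |b - b'| := by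
      intro b' hb' b hb
      have hbb : 0 ≤ b - b' := sub_nonneg.2 hb.1
      have h1 := norm_sub_le (γ b - γ b' + ((b - b') * k) • e) (((b - b') * k) • e)
      rw [add_sub_cancel_right, norm_smul, he, mul_one, Real.norm_eq_abs,
        abs_of_nonneg (mul_nonneg hbb (hc.le.trans hck))] at h1
      rw [abs_of_nonneg hbb]
      nlinarith [hγ b' hb' b hb, mul_nonneg hc.le hbb]
    refine LipschitzOnWith.continuousOn (K := (c + k).toNNReal)
      (LipschitzOnWith.of_dist_le_mul fun b hb b' hb' => ?_)
    rw [Real.coe_toNNReal _ (by linarith), dist_eq_norm, Real.dist_eq]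
    rcases le_total b' b with hle | hle
    · exact hLip b' hb' b ⟨hle, hb.2⟩
    · rw [norm_sub_rev, abs_sub_comm]
      exact hLip b hb b' ⟨hle, hb'.2⟩
  have hlc : ContinuousOn l (Icc (-b₀) b₀) := continuousOn_const.inner hγc
  have hl0 : l 0 = 0 := by simp [hl, hγ0]
  have h0m : (0 : ℝ) ∈ Icc (-b₀) b₀ := ⟨by linarith, hb₀⟩
  have hex : ∀ α ∈ Icc (-a) a, ∃ b ∈ Icc (-b₀) b₀, l b = inner ℝ e (p α) := by
    intro α hα
    have h1 := abs_le.1 (hp1 α hα)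
    have h2 := hl1 0 h0m b₀ ⟨hb₀, le_rfl⟩
    have h3 := hl1 (-b₀) ⟨le_rfl, by linarith⟩ 0 ⟨by linarith, hb₀⟩
    rw [hl0] at h2 h3
    have h4 : 0 ≤ c * b₀ := by positivity
    have := intermediate_value_Icc' (by linarith : -b₀ ≤ b₀) hlc
    exact this ⟨by nlinarith, by nlinarith⟩
  -- `γ (f α)` is the point of the curve above the `e`-coordinate of `p α`; `f` is continuous
  -- because `l` is expanding by `hl2`.
  choose! f hf hfl using hex
  have hfc : ContinuousOn f (Icc (-a) a) := by
    intro α hα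
    have hpc := hp α hα
    rw [ContinuousWithinAt, tendsto_iff_norm_sub_tendsto_zero] at hpc ⊢
    refine squeeze_zero' (Eventually.of_forall fun _ => norm_nonneg _) ?_
      (by simpa using hpc.const_mul (4 / (3 * c)))
    filter_upwards [self_mem_nhdsWithin] with α' hα'
    have h1 := hl2 _ (hf α' hα') _ (hf α hα)
    rw [hfl α' hα', hfl α hα, ← inner_sub_right] at h1
    have h2 := abs_real_inner_le_norm e (p α' - p α)
    rw [he, one_mul] at h2
    rw [Real.norm_eq_abs, div_mul_eq_mul_div, le_div_iff₀ (by positivity)]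
    linarith
  have hgc : ContinuousOn (fun α => γ (f α)) (Icc (-a) a) := hγc.comp hfc hf
  have hqc : ContinuousOn (fun α => ν * wedge e (p α - γ (f α))) (Icc (-a) a) := by
    have := hp.sub hgc
    have h2 : Continuous fun z : Plane => ν * wedge e z := by unfold wedge; fun_prop
    exact h2.comp_continuousOn this
  have hside : ∀ α ∈ Icc (-a) a, |ν * wedge e (γ (f α))| ≤ D * b₀ ^ 2 := by
    intro α hα
    rw [abs_mul, hν, one_mul]
    refine (hγ2 _ (hf α hα)).trans ?_
    have : f α ^ 2 ≤ b₀ ^ 2 := sq_le_sq' (hf α hα).1 (hf α hα).2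
    gcongr
  have ham : a ∈ Icc (-a) a := ⟨by linarith, le_rfl⟩
  have ham' : -a ∈ Icc (-a) a := ⟨le_rfl, by linarith⟩
  have hz : (0 : ℝ) ∈ Icc (ν * wedge e (p (-a) - γ (f (-a)))) (ν * wedge e (p a - γ (f a))) := by
    have h1 := abs_le.1 (hside a ham)
    have h2 := abs_le.1 (hside (-a) ham')
    rw [wedge_sub_right, wedge_sub_right, mul_sub, mul_sub]
    exact ⟨by linarith, by linarith⟩
  -- The transversal offset between the path and the curve changes sign, and where it vanishes both
  -- coordinates agree.
  obtain ⟨α, hα, hαz⟩ := intermediate_value_Icc (by linarith : -a ≤ a) hqc hz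
  refine ⟨α, hα, f α, hf α hα, ?_⟩
  have hν0 : ν ≠ 0 := by rintro rfl; simp at hν
  have hw : wedge e (p α - γ (f α)) = 0 := (mul_eq_zero.1 hαz).resolve_left hν0
  have hi : inner ℝ e (p α - γ (f α)) = 0 := by
    rw [inner_sub_right, ← hfl α hα, sub_self]
  have := inner_sq_add_wedge_sq e (p α - γ (f α))
  rw [hw, hi, he] at this
  have h3 : ‖p α - γ (f α)‖ = 0 := by
    have : ‖p α - γ (f α)‖ ^ 2 = 0 := by linarith
    exact pow_eq_zero_iff (two_ne_zero) |>.1 this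
  exact sub_eq_zero.1 (norm_eq_zero.1 h3)

/-- The bookkeeping of the error terms in the transversal estimate. -/
theorem remainder_le {s t N α y d m ρ w : ℝ} (hC : 1 ≤ C) (hN : 0 ≤ N) (hy : 0 ≤ y) (hyN : y ≤ N)
    (hsy : s * y ≤ 2 * d + 2 * C * (α * m)) (hw : 0 ≤ w) (hwC : w ≤ 2 * C) (hα : 0 ≤ α)
    (hα1 : α ≤ 1) (hs : 0 ≤ s) (hst : s ≤ t) (hρ : 0 ≤ ρ)
    (h : ρ ≤ 2 * C ^ 2 * ((N + C * s) * y) + C * (α * w * (N + C * s) ^ 2)) :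
    ρ + s * (C * (C * y)) + C * ρ ≤ 12 * C ^ 3 * N ^ 2 + 10 * C ^ 4 * d + 10 * C ^ 5 * (α * m) +
      4 * C ^ 4 * t * (α * (s * w)) := by
  -- In the application `y` is the distance of the two trajectories, `ρ` the norm of the remainder,
  -- `w` the gap and `m` its moment.
  have hrz : (N + C * s) * y ≤ N ^ 2 + C * (s * y) := by
    have : N * y ≤ N * N := mul_le_mul_of_nonneg_left hyN hN
    linarith
  have hrr : α * w * (N + C * s) ^ 2 ≤ 4 * C * N ^ 2 + 2 * C ^ 2 * t * (α * (s * w)) := by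
    have k1 : (N + C * s) ^ 2 ≤ 2 * N ^ 2 + 2 * (C * s) ^ 2 := by
      linarith [sq_nonneg (N - C * s)]
    have k2 : α * w ≤ 2 * C := (mul_le_of_le_one_left hw hα1).trans hwC
    calc α * w * (N + C * s) ^ 2 ≤ α * w * (2 * N ^ 2 + 2 * (C * s) ^ 2) := by gcongr
      _ = α * w * (2 * N ^ 2) + 2 * C ^ 2 * s * (α * (s * w)) := by ring
      _ ≤ 2 * C * (2 * N ^ 2) + 2 * C ^ 2 * t * (α * (s * w)) := by gcongr
      _ = _ := by ring
  have hR2 : ρ + C * ρ ≤ 2 * C * ρ := by linarith [mul_le_mul_of_nonneg_right hC hρ]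
  have hR3 : 2 * C * ρ ≤ 12 * C ^ 3 * N ^ 2 + 4 * C ^ 4 * (s * y) +
      4 * C ^ 4 * t * (α * (s * w)) := by
    calc 2 * C * ρ ≤ 2 * C * (2 * C ^ 2 * (N ^ 2 + C * (s * y)) +
          C * (4 * C * N ^ 2 + 2 * C ^ 2 * t * (α * (s * w)))) := by
          gcongr
          exact h.trans (by gcongr)
      _ = _ := by ring
  have hC24 : C ^ 2 * (s * y) ≤ C ^ 4 * (s * y) := by
    gcongr ?_ * _
    exact pow_le_pow_right₀ hC (by norm_num)
  have hfin : 5 * C ^ 4 * (s * y) ≤ 5 * C ^ 4 * (2 * d + 2 * C * (α * m)) := by gcongr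
  linarith

/-- The effect, transversally to `e`, of moving the control towards `signs β`. -/
theorem IsParallel.side_estimate (hp : IsParallel A B e β ν c) (h : IsNice F G A B C)
    {t : ℝ} (ht : IsSmall C c t) {u : ℝ → Fin M → ℝ} (hu : IsControl u) {x : ℝ → Plane}
    (hx : IsTrajectory (revDynamics F G) u 0 t x) {α : ℝ} (hα : 0 ≤ α) (hα1 : α ≤ 1)
    {u' : ℝ → Fin M → ℝ} (hu' : IsControl u')
    (huu' : ∀ s i, u' s i = u s i + α * (signs β i - u s i))
    {x' : ℝ → Plane} (hx' : IsTrajectory (revDynamics F G) u' (x' 0) t x')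
    (hxb' : ∀ r ∈ Icc 0 t, ‖x' r‖ ≤ 1) {d : ℝ} (hd : ‖x' t - x t‖ = d)
    (hN : 4 * C ^ 2 * (d + α) ≤ 1 / 2) :
    c ^ 2 / 2 * (α * ∫ s in (0 : ℝ)..t, s * gap u (fun _ => signs β) s) - 12 * C ^ 4 * d -
      192 * C ^ 7 * (d + α) ^ 2 ≤ ν * wedge e (x' 0) := by
  have hC := h.one_le
  have hf := h.isField_rev
  have hσ := hp.isControl
  have ht0 := ht.nonneg
  have hlt : ‖(0 : Plane)‖ + C * t < 1 := by rw [norm_zero]; linarith [ht.mul_le]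
  have ht1 : t ≤ 1 := by nlinarith [ht.mul_le]
  have hd0 : 0 ≤ d := hd ▸ norm_nonneg _
  have hxb := fun s hs => (hx.norm_lt_one hf hu hlt (r := s) hs)
  set w := gap u (fun _ => signs β) with hw
  have hwi := gap_intervalIntegrable hu hσ
  have hw0 : ∀ s, 0 ≤ w s := gap_nonneg _ _
  have hgap : gap u' u = fun s => α * w s := by
    funext s
    simp only [hw, gap, Finset.mul_sum]
    refine Finset.sum_congr rfl fun i _ => ?_
    rw [huu', add_sub_cancel_left, abs_mul, abs_of_nonneg hα, abs_sub_comm]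
  set m := ∫ s in (0 : ℝ)..t, s * w s with hm
  set tail : ℝ → ℝ := fun s => ∫ r in s..t, w r with htail
  have htb : ∀ s ∈ Icc 0 t, 0 ≤ tail s ∧ tail s ≤ 2 * C := by
    intro s hs
    refine ⟨intervalIntegral.integral_nonneg hs.2 fun r _ => hw0 r, ?_⟩
    calc tail s ≤ 2 * M * (t - s) := integral_gap_le hu hσ hs.2
      _ ≤ 2 * C * 1 := by
        have := h.card_le
        have : t - s ≤ 1 := by linarith [hs.1]
        have : 0 ≤ t - s := by linarith [hs.2]
        gcongr
      _ = _ := mul_one _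
  have htm : ∀ s ∈ Icc 0 t, s * tail s ≤ m := by
    intro s hs
    have h1 : s * tail s = ∫ r in s..t, s * w r := by
      rw [intervalIntegral.integral_const_mul]
    have h2 : ∫ r in s..t, s * w r ≤ ∫ r in s..t, r * w r := by
      refine intervalIntegral.integral_mono_on hs.2 ((hwi _ _).const_mul s)
        (moment_intervalIntegrable hu hσ _ _) fun r hr => ?_
      exact mul_le_mul_of_nonneg_right hr.1 (hw0 r)
    have h3 : 0 ≤ ∫ r in (0 : ℝ)..s, r * w r := moment_nonneg _ _ hs.1
    have h4 := intervalIntegral.integral_add_adjacent_intervals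
      (moment_intervalIntegrable hu hσ 0 s) (moment_intervalIntegrable hu hσ s t)
    rw [h1]
    linarith
  set z : ℝ → Plane := fun s => x' s - x s with hz
  have hzb : ∀ s ∈ Icc 0 t, ‖z s‖ ≤ 2 * (d + C * (α * tail s)) := by
    intro s hs
    have h1 := norm_sub_trajectory_le hf (by linarith [ht.mul_le]) hu' hx' hxb' hu hx
      (fun r hr => (hxb r hr).le) hs ⟨ht0, le_rfl⟩
    rw [intervalIntegral.integral_symm, abs_neg, hgap, intervalIntegral.integral_const_mul, hd] at h1
    change _ ≤ 2 * (_ + C * |α * tail s|) at h1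
    rwa [abs_of_nonneg (mul_nonneg hα (htb s hs).1)] at h1
  set N := 4 * C ^ 2 * (d + α) with hNdef
  have hN0 : 0 ≤ N := by positivity
  have hzN : ∀ s ∈ Icc 0 t, ‖z s‖ ≤ N := by
    intro s hs
    refine (hzb s hs).trans ?_
    have h1 : C * (α * tail s) ≤ C * (α * (2 * C)) := by gcongr; exact (htb s hs).2
    have h2 : d ≤ 2 * C ^ 2 * d := le_mul_of_one_le_left hd0 (by nlinarith)
    rw [hNdef]
    linarith
  have h0m : (0 : ℝ) ∈ Icc 0 t := ⟨le_rfl, ht0⟩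
  have hx0 : x 0 = 0 := hx.apply_zero ht0
  have hp0 : ‖x' 0‖ ≤ N := by
    have := hzN 0 h0m
    simpa [hz, hx0] using this
  have hlt' : ‖x' 0‖ + C * t < 1 := by linarith [ht.mul_le]
  -- First-order adjoint: as `z' = -A z - α q e + R`, the terms in `wedge e (A z)` cancel and `e`
  -- contributes `-s α q * wedge e (A e)`, of definite sign.
  set χ : ℝ → ℝ := fun s => ν * (wedge e (z s) + s * wedge e (A (z s))) with hχ
  have hzac : ∀ j : Fin 2, AbsolutelyContinuousOnInterval (fun s => z s j) 0 t := fun j =>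
    (hx'.absolutelyContinuous hf hu' ht0 hlt' j).fun_sub (hx.absolutelyContinuous hf hu ht0 hlt j)
  have hidac : AbsolutelyContinuousOnInterval (fun s : ℝ => s) 0 t :=
    contDiffOn_id.absolutelyContinuousOnInterval
  have hχac : AbsolutelyContinuousOnInterval χ 0 t := by
    have hA : ∀ j : Fin 2, AbsolutelyContinuousOnInterval (fun s => A (z s) j) 0 t := by
      intro j
      have h1 : (fun s => A (z s) j) = fun s => A (EuclideanSpace.single 0 1) j * z s 0 +
          A (EuclideanSpace.single 1 1) j * z s 1 := by
        funext s; rw [map_plane_apply]; ring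
      rw [h1]
      exact ((hzac 0).const_mul _).fun_add ((hzac 1).const_mul _)
    exact ((((hzac 1).const_mul (e 0)).fun_sub ((hzac 0).const_mul (e 1))).fun_add
      (hidac.fun_mul (((hA 1).const_mul (e 0)).fun_sub ((hA 0).const_mul (e 1))))).const_mul ν
  set K₀ := 12 * C ^ 3 * N ^ 2 + 10 * C ^ 4 * d + 10 * C ^ 5 * (α * m) with hK₀
  set bd : ℝ → ℝ := fun s => K₀ - (c ^ 2 - 4 * C ^ 4 * t) * α * (s * w s) with hbd
  have hmi := moment_intervalIntegrable hu hσ 0 t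
  have hbdi : IntervalIntegrable bd volume 0 t := intervalIntegrable_const.sub (hmi.const_mul _)
  have hder : ∀ᵐ s : ℝ, s ∈ Ioo 0 t → ∃ d, HasDerivAt χ d s ∧ d ≤ bd s := by
    filter_upwards [hx.ae_hasDerivAt hf hu ht0, hx'.ae_hasDerivAt hf hu' ht0, hu.2,
      gap_le hu hσ] with s h1 h2 h3 hws hs
    have hs' := Ioo_subset_Icc_self hs
    have hs0 := hs'.1
    have hst := hs'.2
    have hs1 : s ≤ 1 := hst.trans ht1
    have hzd := (h2 hs).fun_sub (h1 hs)
    set z' := revDynamics F G (x' s) (u' s) - revDynamics F G (x s) (u s) with hz'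
    have hAzd : HasDerivAt (fun r => A (z r)) (A z') s := A.hasFDerivAt.comp_hasDerivAt s hzd
    have hd1 := ((hasDerivAt_const s e).wedge hzd).fun_add
      ((hasDerivAt_id' s).fun_mul ((hasDerivAt_const s e).wedge hAzd))
    refine ⟨_, hd1.const_mul ν, ?_⟩
    have hwz : ∀ y, wedge 0 y = 0 := fun y => by simp [wedge]
    simp only [hwz, zero_add, one_mul]
    set q := ∑ i, |β i| * |u s i - signs β i| with hq
    set R := -(F (x' s) - F (x s) - A (z s)) - ∑ i, u s i • (G i (x' s) - G i (x s)) -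
      ∑ i, (α * (signs β i - u s i)) • (G i (x' s) - β i • e) with hR
    have hzR : z' = R - A (z s) - (α * q) • e := by
      have k1 : ∑ i, (α * (signs β i - u s i)) • β i • e = (α * q) • e := by
        rw [hq, Finset.mul_sum, Finset.sum_smul]
        refine Finset.sum_congr rfl fun i _ => ?_
        have k2 := hp.sub_signs_eq h3 i
        have k3 : signs β i - u s i = signs β i * |u s i - signs β i| := by linarith
        rw [smul_smul, k3, ← hp.signs_mul i]
        congr 1
        ring
      rw [← k1, hR, hz']
      simp only [revDynamics, dynamics, huu', add_smul, smul_sub, Finset.sum_sub_distrib,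
        Finset.sum_add_distrib]
      abel
    set r := N + C * s with hr
    have hCs : C * s ≤ C * t := by gcongr
    have hr1 : r ≤ 1 := by linarith [ht.mul_le]
    have hxs : ‖x s‖ ≤ r := by
      have := hx.norm_le hf hu hlt hs'
      rw [norm_zero, zero_add] at this
      linarith
    have hxs' : ‖x' s‖ ≤ r := by
      have := hx'.norm_le hf hu' hlt' hs'
      linarith
    have hr0 : 0 ≤ r := (norm_nonneg _).trans hxs
    have hRn : ‖R‖ ≤ 2 * C ^ 2 * (r * ‖z s‖) + C * (α * w s * r ^ 2) := by
      have k1 := h.F_sub r hr1 _ _ hxs' hxs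
      have k2 := norm_sum_smul_le h3 (g := fun i => G i (x' s) - G i (x s))
        (fun i => h.G_sub i r hr1 _ _ hxs' hxs)
      have k3 : ‖∑ i, (α * (signs β i - u s i)) • (G i (x' s) - β i • e)‖ ≤
          C * (α * w s * r ^ 2) := by
        rw [hw, gap, Finset.mul_sum, Finset.sum_mul, Finset.mul_sum]
        refine norm_sum_le_of_le _ fun i _ => ?_
        have k4 := h.G_sub i r hr1 (x' s) 0 hxs' (by simpa using hr0)
        rw [h.G_zero, hp.B_eq, sub_zero] at k4
        rw [norm_smul, norm_mul, Real.norm_eq_abs, Real.norm_eq_abs, abs_of_nonneg hα,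
          abs_sub_comm]
        calc _ ≤ α * |u s i - signs β i| * (C * r * r) := by
              gcongr; exact k4.trans (by gcongr)
          _ = _ := by ring
      have k5 : (M : ℝ) * (C * r * ‖z s‖) ≤ C * (C * r * ‖z s‖) := by
        gcongr; exact h.card_le
      have k6 : C * r * ‖z s‖ ≤ C * (C * r * ‖z s‖) := le_mul_of_one_le_left (by positivity) hC
      calc ‖R‖ ≤ C * r * ‖z s‖ + M * (C * r * ‖z s‖) + C * (α * w s * r ^ 2) := by
            refine (norm_sub_le _ _).trans (add_le_add ((norm_sub_le _ _).trans ?_) k3)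
            rw [norm_neg]
            exact add_le_add k1 k2
        _ ≤ _ := by linarith
    have hAn : ∀ y, ‖A y‖ ≤ C * ‖y‖ := fun y =>
      (A.le_opNorm y).trans (by gcongr; exact h.norm_A)
    have hνw : ∀ y, ν * wedge e y ≤ ‖y‖ := fun y => by
      refine (le_abs_self _).trans ?_
      rw [abs_mul, hp.abs_ν, one_mul]
      simpa [hp.norm_e] using abs_wedge_le e y
    have hexp : ν * (wedge e z' + (wedge e (A (z s)) + s * wedge e (A z'))) =
        ν * wedge e R + s * (ν * wedge e (-A (A (z s)))) + s * (ν * wedge e (A R)) -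
          s * α * q * (ν * wedge e (A e)) := by
      rw [hzR]
      simp only [map_sub, map_smul, wedge_sub_right, wedge_smul_right, wedge_neg_right, wedge_self]
      ring
    change ν * (wedge e z' + (wedge e (A (z s)) + s * wedge e (A z'))) ≤ bd s
    rw [hexp]
    have g1 := hνw R
    have g2 : s * (ν * wedge e (-A (A (z s)))) ≤ s * (C * (C * ‖z s‖)) := by
      refine mul_le_mul_of_nonneg_left ((hνw _).trans ?_) hs0
      rw [norm_neg]
      exact (hAn _).trans (by gcongr; exact hAn _)
    have g3 : s * (ν * wedge e (A R)) ≤ C * ‖R‖ := by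
      calc _ ≤ s * (C * ‖R‖) := mul_le_mul_of_nonneg_left ((hνw _).trans (hAn _)) hs0
        _ ≤ _ := mul_le_of_le_one_left (by positivity) hs1
    have g4 : c * w s ≤ q := by
      rw [hw, gap, Finset.mul_sum]
      exact Finset.sum_le_sum fun i _ => mul_le_mul_of_nonneg_right (hp.c_le i) (abs_nonneg _)
    have g5 : s * α * (c * w s) * c ≤ s * α * q * (ν * wedge e (A e)) := by
      have hc := hp.c_pos
      have hws0 := hw0 s
      have : 0 ≤ q := le_trans (by positivity) g4
      gcongr
      exact hp.c_le_wedge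
    have hsz : s * ‖z s‖ ≤ 2 * d + 2 * C * (α * m) := by
      calc s * ‖z s‖ ≤ s * (2 * (d + C * (α * tail s))) := by gcongr; exact hzb s hs'
        _ = 2 * (s * d) + 2 * C * (α * (s * tail s)) := by ring
        _ ≤ 2 * (1 * d) + 2 * C * (α * m) := by gcongr; exact htm s hs'
        _ = _ := by ring
    have hws2 : w s ≤ 2 * C := hws.trans (by gcongr; exact h.card_le)
    have hsum := remainder_le hC hN0 (norm_nonneg (z s)) (hzN s hs') hsz (hw0 s) hws2 hα hα1 hs0 hst
      (norm_nonneg R) hRn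
    simp only [hbd, hK₀]
    linarith
  have hfin := sub_le_integral_of_ae_hasDerivAt_le ht0 hχac hbdi hder
  have hbdint : ∫ s in (0 : ℝ)..t, bd s = t * K₀ - (c ^ 2 - 4 * C ^ 4 * t) * α * m := by
    simp only [hbd]
    rw [intervalIntegral.integral_sub intervalIntegrable_const (hmi.const_mul _),
      intervalIntegral.integral_const, intervalIntegral.integral_const_mul, sub_zero, smul_eq_mul]
  rw [hbdint] at hfin
  have hχ0 : χ 0 = ν * wedge e (x' 0) := by simp [hχ, hz, hx0]
  have hm0 : 0 ≤ m := moment_nonneg _ _ ht0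
  have hχt : -(2 * C ^ 4 * d) ≤ χ t := by
    have k1 : |χ t| ≤ d + C * d := by
      have k2 := abs_wedge_le e (z t)
      have k3 := abs_wedge_le e (A (z t))
      have k4 := A.le_opNorm (z t)
      have k5 : ‖A‖ * ‖z t‖ ≤ C * ‖z t‖ := by gcongr; exact h.norm_A
      have k6 : ‖z t‖ = d := hd
      rw [hp.norm_e, one_mul] at k2 k3
      rw [k6] at k2 k4 k5
      simp only [hχ]
      rw [abs_mul, hp.abs_ν, one_mul]
      refine (abs_add_le _ _).trans (add_le_add k2 ?_)
      rw [abs_mul, abs_of_nonneg ht0]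
      calc t * |wedge e (A (z t))| ≤ 1 * |wedge e (A (z t))| := by gcongr
        _ ≤ C * d := by linarith
    have k7 : C ≤ C ^ 4 := le_self_pow₀ hC (by norm_num)
    have := (_root_.abs_le.1 k1).1
    nlinarith
  -- The moment terms among the errors add up to `4 * C ^ 4 * t + 10 * C ^ 5 * t`; they cost half of
  -- the gain `c ^ 2`.
  have hCt : 14 * C ^ 5 * t ≤ c ^ 2 / 2 := by
    have k1 := ht.pow_mul_le
    have k2 : c ^ 3 ≤ c ^ 2 := pow_le_pow_of_le_one hp.c_pos.le hp.c_le_one (by norm_num)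
    have k3 : 0 ≤ C ^ 5 * t := by positivity
    have k4 : 0 ≤ c ^ 2 := sq_nonneg c
    linarith
  have hC45 : 4 * C ^ 4 * t ≤ 4 * C ^ 5 * t := by
    gcongr ?_ * ?_ * _
    exact pow_le_pow_right₀ hC (by norm_num)
  have hαm : 0 ≤ α * m := mul_nonneg hα hm0
  have l1 : t * K₀ ≤ 12 * C ^ 3 * N ^ 2 + 10 * C ^ 4 * d + 10 * C ^ 5 * t * (α * m) := by
    have : t * (12 * C ^ 3 * N ^ 2 + 10 * C ^ 4 * d) ≤ 12 * C ^ 3 * N ^ 2 + 10 * C ^ 4 * d :=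
      mul_le_of_le_one_left (by positivity) ht1
    rw [hK₀]
    linarith
  have l2 : 12 * C ^ 3 * N ^ 2 = 192 * C ^ 7 * (d + α) ^ 2 := by rw [hNdef]; ring
  have l3 : (4 * C ^ 4 * t + 10 * C ^ 5 * t) * (α * m) ≤ c ^ 2 / 2 * (α * m) := by
    gcongr
    linarith
  rw [hχ0] at hfin
  linarith

end

/-! ### Steering to points near a non-extremal trajectory -/

section

variable {M : ℕ} {F : Plane → Plane} {G : Fin M → Plane → Plane} {A : Plane →L[ℝ] Plane}
  {B : Fin M → Plane} {C : ℝ} {e : Plane} {β : Fin M → ℝ} {ν c : ℝ}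

/-- Two curves issuing from the origin, joined to one. -/
def joinCurves (X Y : ℝ → Plane) (b : ℝ) : Plane := if 0 ≤ b then X b else Y (-b)

theorem joinCurves_of_nonneg (X Y : ℝ → Plane) {b : ℝ} (hb : 0 ≤ b) : joinCurves X Y b = X b :=
  if_pos hb

theorem joinCurves_of_nonpos {X Y : ℝ → Plane} (h : X 0 = Y 0) {b : ℝ} (hb : b ≤ 0) :
    joinCurves X Y b = Y (-b) := by
  rcases hb.eq_or_lt with rfl | hb
  · simp [joinCurves, h]
  · simp [joinCurves, not_le.2 hb]

theorem totalSize_neg (β : Fin M → ℝ) : totalSize (-β) = totalSize β := by simp [totalSize]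

/-- The two extremals with constant controls `signs β` and `-signs β` up to the time `T`. -/
structure IsExtremalPair (F : Plane → Plane) (G : Fin M → Plane → Plane) (β : Fin M → ℝ) (T : ℝ)
    (X Y : ℝ → Plane) : Prop where
  contX : Continuous X
  contY : Continuous Y
  trajX : IsTrajectory (revDynamics F G) (fun _ => signs β) 0 T X
  trajY : IsTrajectory (revDynamics F G) (fun _ => signs (-β)) 0 T Y

theorem IsParallel.exists_extremalPair (hp : IsParallel A B e β ν c) (h : IsNice F G A B C)
    {T : ℝ} (hT : IsSmall C c T) : ∃ X Y, IsExtremalPair F G β T X Y := by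
  have h1 := hT.mul_le
  obtain ⟨X, hXc, hX⟩ := exists_trajectory (p := 0) h.isField_rev hp.isControl hT.nonneg
    (by linarith) (by rw [norm_zero]; linarith)
  obtain ⟨Y, hYc, hY⟩ := exists_trajectory (p := 0) h.isField_rev hp.neg.isControl hT.nonneg
    (by linarith) (by rw [norm_zero]; linarith)
  exact ⟨X, Y, hXc, hYc, hX, hY⟩

section Curves

variable {T : ℝ} {X Y : ℝ → Plane}

theorem IsExtremalPair.zero_eq (hXY : IsExtremalPair F G β T X Y) (hT : 0 ≤ T) : X 0 = Y 0 := by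
  rw [hXY.trajX.apply_zero hT, hXY.trajY.apply_zero hT]

/-- `Y` is the extremal for `-e`; traversed backwards, it continues `X` through the origin with
nearly the same velocity, a multiple of `-e`. This is the straightness needed in `exists_crossing`.
-/
theorem IsParallel.norm_joinCurves_sub_le (hp : IsParallel A B e β ν c) (h : IsNice F G A B C)
    (hT : IsSmall C c T) (hXY : IsExtremalPair F G β T X Y) {b b' : ℝ} (hb' : -T ≤ b')
    (hbb : b' ≤ b) (hb : b ≤ T) :
    ‖joinCurves X Y b - joinCurves X Y b' + ((b - b') * totalSize β) • e‖ ≤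
      c / 4 * (b - b') := by
  have hC := h.one_le
  have hCT : C * T < 1 := by linarith [hT.mul_le]
  have hsq := hp.sq_mul_le h hT
  have h0 := hXY.zero_eq hT.nonneg
  have key : ∀ r s : ℝ, 0 ≤ r → r ≤ s → s ≤ T → C ^ 2 * s * (s - r) ≤ c / 4 * (s - r) := by
    intro r s hr hrs hsT
    have : 0 ≤ s - r := by linarith
    have : C ^ 2 * s ≤ C ^ 2 * T := by gcongr
    gcongr
    linarith
  have hpos : ∀ b' b : ℝ, 0 ≤ b' → b' ≤ b → b ≤ T →
      ‖joinCurves X Y b - joinCurves X Y b' + ((b - b') * totalSize β) • e‖ ≤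
        c / 4 * (b - b') := by
    intro b' b hb' hbb hb
    rw [joinCurves_of_nonneg X Y hb', joinCurves_of_nonneg X Y (hb'.trans hbb), mul_smul]
    exact (hp.norm_extremal_add_le h hCT hXY.trajX ⟨hb'.trans hbb, hb⟩ ⟨hb', hbb⟩).trans
      (key b' b hb' hbb hb)
  have hneg : ∀ b' b : ℝ, -T ≤ b' → b' ≤ b → b ≤ 0 →
      ‖joinCurves X Y b - joinCurves X Y b' + ((b - b') * totalSize β) • e‖ ≤
        c / 4 * (b - b') := by
    intro b' b hb' hbb hb
    rw [joinCurves_of_nonpos h0 hb, joinCurves_of_nonpos h0 (hbb.trans hb), ← norm_neg]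
    have h1 := hp.neg.norm_extremal_add_le h hCT hXY.trajY (s := -b') (r := -b)
      ⟨by linarith, by linarith⟩ ⟨by linarith, by linarith⟩
    have h2 := key (-b) (-b') (by linarith) (by linarith) (by linarith)
    rw [totalSize_neg] at h1
    have h3 : -(Y (-b) - Y (-b') + ((b - b') * totalSize β) • e) =
        Y (-b') - Y (-b) + (-b' - -b) • totalSize β • -e := by
      rw [smul_neg, smul_neg, smul_smul, show -b' - -b = b - b' by ring]; abel
    rw [h3]
    linarith
  rcases le_total 0 b' with hb0 | hb0
  · exact hpos b' b hb0 hbb hb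
  rcases le_total b 0 with hb1 | hb1
  · exact hneg b' b hb' hbb hb1
  have h1 := hpos 0 b le_rfl hb1 hb
  have h2 := hneg b' 0 hb' hb0 le_rfl
  have h3 : joinCurves X Y b - joinCurves X Y b' + ((b - b') * totalSize β) • e =
      (joinCurves X Y b - joinCurves X Y 0 + ((b - 0) * totalSize β) • e) +
      (joinCurves X Y 0 - joinCurves X Y b' + ((0 - b') * totalSize β) • e) := by
    rw [show (b - b') * totalSize β = (b - 0) * totalSize β + (0 - b') * totalSize β by ring,
      add_smul]
    abel
  rw [h3]
  refine (norm_add_le _ _).trans ?_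
  linarith

theorem IsParallel.abs_wedge_joinCurves_le (hp : IsParallel A B e β ν c) (h : IsNice F G A B C)
    (hT : IsSmall C c T) (hXY : IsExtremalPair F G β T X Y) {b : ℝ} (hb : b ∈ Icc (-T) T) :
    |wedge e (joinCurves X Y b)| ≤ C ^ 2 * b ^ 2 := by
  have hCT : C * T < 1 := by linarith [hT.mul_le]
  have h0 := hXY.zero_eq hT.nonneg
  have key : ∀ (y : Plane) (k : ℝ), |wedge e y| ≤ ‖y + k • e‖ := fun y k => by
    have h1 := abs_wedge_le e (y + k • e)
    rwa [wedge_add_right, wedge_smul_right, wedge_self, mul_zero, add_zero, hp.norm_e, one_mul]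
      at h1
  rcases le_total 0 b with hb0 | hb0
  · rw [joinCurves_of_nonneg X Y hb0]
    refine (key _ (b * totalSize β)).trans ?_
    rw [mul_smul]
    exact hp.norm_extremal_add_smul_le h hCT hXY.trajX ⟨hb0, hb.2⟩
  · rw [joinCurves_of_nonpos h0 hb0]
    refine (key _ (b * totalSize β)).trans ?_
    have h1 := hp.neg.norm_extremal_add_smul_le h hCT hXY.trajY (s := -b)
      ⟨by linarith, by linarith [hb.1]⟩
    rw [totalSize_neg] at h1
    have h2 : (-b) • totalSize β • -e = (b * totalSize β) • e := by
      rw [smul_neg, smul_neg, smul_smul, neg_mul, neg_smul, neg_neg]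
    rwa [h2, neg_sq] at h1

theorem IsParallel.steers_joinCurves (hp : IsParallel A B e β ν c) (h : IsNice F G A B C)
    (hT : 0 ≤ T) (hXY : IsExtremalPair F G β T X Y) {b : ℝ} (hb : b ∈ Icc (-T) T) :
    Steers F G (joinCurves X Y b) |b| := by
  rcases le_total 0 b with hb0 | hb0
  · rw [joinCurves_of_nonneg X Y hb0, abs_of_nonneg hb0]
    exact steers_of_rev_zero h hp.isControl hb0 (hXY.trajX.mono hb.2)
  · rw [joinCurves_of_nonpos (hXY.zero_eq hT) hb0, abs_of_nonpos hb0]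
    exact steers_of_rev_zero h hp.neg.isControl (by linarith) (hXY.trajY.mono (by linarith [hb.1]))

end Curves

/-- Prescribes the end of a reversed trajectory by solving the forward dynamics from `b`; its start
is then free. -/
theorem exists_rev_trajectory_to (h : IsNice F G A B C) {u : ℝ → Fin M → ℝ} (hu : IsControl u)
    {t : ℝ} (ht : 0 ≤ t) (hCt : C * t ≤ 1 / 2) {b : Plane} (hb : ‖b‖ + C * t < 1) :
    ∃ x : ℝ → Plane, IsTrajectory (revDynamics F G) u (x 0) t x ∧ x t = b ∧
      ∀ r ∈ Icc 0 t, ‖x r‖ ≤ 1 := by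
  obtain ⟨y, -, hy⟩ := exists_trajectory h.isField (hu.comp_sub_left t) ht hCt hb.le
  refine ⟨fun s => y (t - s), ?_, by simp [hy.apply_zero ht], fun r hr => ?_⟩
  · have := hy.reverse h.isField (hu.comp_sub_left t) ht
    simp only [sub_sub_cancel, sub_zero] at this ⊢
    exact this
  · exact (hy.norm_lt_one h.isField (hu.comp_sub_left t) hb
      ⟨by linarith [hr.2], by linarith [hr.1]⟩).le

theorem abs_integral_gap_le {u v : ℝ → Fin M → ℝ} {k : ℝ} (hk : ∀ᵐ s : ℝ, gap u v s ≤ k)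
    (a b : ℝ) : |∫ s in a..b, gap u v s| ≤ k * |b - a| := by
  rw [← Real.norm_eq_abs]
  refine intervalIntegral.norm_integral_le_of_norm_le_const_ae ?_
  filter_upwards [hk] with s hs _
  rwa [Real.norm_eq_abs, abs_of_nonneg (gap_nonneg u v s)]

/-- Trajectories with distinct ends have controls at a distance. -/
theorem moment_ge_of_dist (h : IsNice F G A B C) {t : ℝ} (ht : 0 ≤ t) (hCt : C * t ≤ 1 / 4)
    {u v : ℝ → Fin M → ℝ} (hu : IsControl u) (hv : IsControl v) {x y : ℝ → Plane}
    (hx : IsTrajectory (revDynamics F G) u 0 t x) (hy : IsTrajectory (revDynamics F G) v 0 t y)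
    {ε : ℝ} (hε : 0 < ε) (hxy : ε ≤ ‖x t - y t‖) :
    ε ^ 2 / (32 * C ^ 3) ≤ ∫ s in (0 : ℝ)..t, s * gap u v s := by
  have hC := h.one_le
  have hf := h.isField_rev
  have hlt : ‖(0 : Plane)‖ + C * t < 1 := by rw [norm_zero]; linarith
  have hgi := gap_intervalIntegrable hu hv
  set q := ∫ s in (0 : ℝ)..t, gap u v s with hq
  have hq0 : 0 ≤ q := intervalIntegral.integral_nonneg ht fun s _ => gap_nonneg u v s
  have h1 := norm_sub_trajectory_le hf (by linarith) hu hx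
    (fun r hr => (hx.norm_lt_one hf hu hlt hr).le) hv hy
    (fun r hr => (hy.norm_lt_one hf hv hlt hr).le) (r := t) (r0 := 0) ⟨ht, le_rfl⟩ ⟨le_rfl, ht⟩
  rw [hx.apply_zero ht, hy.apply_zero ht, sub_self, norm_zero, zero_add, abs_of_nonneg hq0] at h1
  have hqε : ε ≤ 2 * (C * q) := hxy.trans h1
  have hqt : q ≤ 2 * C * t := by
    calc q ≤ 2 * M * (t - 0) := integral_gap_le hu hv ht
      _ ≤ 2 * C * t := by rw [sub_zero]; gcongr; exact h.card_le
  -- The gap is at most `2 * C`, so at most half of its integral sits in `[0, η]`; the other half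
  -- has weight at least `η`.
  set η := q / (4 * C) with hη
  have hη0 : 0 ≤ η := by positivity
  have hηt : η ≤ t := by
    rw [hη, div_le_iff₀ (by positivity)]
    nlinarith
  have h2 : ∫ s in (0 : ℝ)..η, gap u v s ≤ q / 2 := by
    calc _ ≤ 2 * M * (η - 0) := integral_gap_le hu hv hη0
      _ ≤ 2 * C * η := by rw [sub_zero]; gcongr; exact h.card_le
      _ = q / 2 := by rw [hη]; field_simp; ring
  have h3 := intervalIntegral.integral_add_adjacent_intervals (hgi 0 η) (hgi η t)
  have hmi := moment_intervalIntegrable hu hv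
  have h4 := intervalIntegral.integral_add_adjacent_intervals (hmi 0 η) (hmi η t)
  have h5 := moment_nonneg u v hη0
  have h6 : ∫ s in η..t, η * gap u v s ≤ ∫ s in η..t, s * gap u v s :=
    intervalIntegral.integral_mono_on hηt ((hgi _ _).const_mul η) (hmi _ _) fun s hs =>
      mul_le_mul_of_nonneg_right hs.1 (gap_nonneg u v s)
  rw [intervalIntegral.integral_const_mul] at h6
  have h7 : η * (q / 2) ≤ η * ∫ s in η..t, gap u v s := by
    gcongr
    linarith
  have h8 : ε ^ 2 / (32 * C ^ 3) ≤ η * (q / 2) := by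
    have : η * (q / 2) = (2 * (C * q)) ^ 2 / (32 * C ^ 3) := by rw [hη]; field_simp; ring
    rw [this]
    gcongr
  linarith

/-- The control `u`, moved towards `signs β` or its opposite. -/
def tilt (β : Fin M → ℝ) (u : ℝ → Fin M → ℝ) (α : ℝ) (s : ℝ) (i : Fin M) : ℝ :=
  (1 - |α|) * u s i + α * signs β i

theorem IsParallel.isControl_tilt (hp : IsParallel A B e β ν c) {u : ℝ → Fin M → ℝ}
    (hu : IsControl u) {α : ℝ} (hα : |α| ≤ 1) : IsControl (tilt β u α) := by
  refine ⟨measurable_pi_iff.2 fun i => ?_, ?_⟩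
  · exact (((measurable_pi_apply i).comp hu.1).const_mul _).add_const _
  · filter_upwards [hu.2] with s hs
    refine mem_cube_of_abs_le_one fun i => ?_
    have h1 := abs_le_one_of_mem_cube hs i
    calc _ ≤ _ := abs_add_le _ _
      _ = (1 - |α|) * |u s i| + |α| := by
        rw [abs_mul, abs_mul, hp.abs_signs, mul_one, abs_of_nonneg (by linarith : 0 ≤ 1 - |α|)]
      _ ≤ (1 - |α|) * 1 + |α| := by gcongr
      _ = 1 := by ring

theorem IsParallel.gap_tilt_le (hp : IsParallel A B e β ν c) {u : ℝ → Fin M → ℝ}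
    (hu : IsControl u) (α α' : ℝ) :
    ∀ᵐ s : ℝ, gap (tilt β u α) (tilt β u α') s ≤ 2 * M * |α - α'| := by
  filter_upwards [hu.2] with s hs
  calc gap (tilt β u α) (tilt β u α') s ≤ ∑ i : Fin M, 2 * |α - α'| := by
        refine Finset.sum_le_sum fun i _ => ?_
        have h1 := abs_le_one_of_mem_cube hs i
        have h2 : tilt β u α s i - tilt β u α' s i =
            (|α'| - |α|) * u s i + (α - α') * signs β i := by simp only [tilt]; ring
        rw [h2]
        refine (abs_add_le _ _).trans ?_
        rw [abs_mul, abs_mul, hp.abs_signs, mul_one]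
        have h3 := abs_abs_sub_abs_le α' α
        rw [abs_sub_comm α' α] at h3
        have h4 : |(|α'| - |α|)| * |u s i| ≤ |(|α'| - |α|)| * 1 := by gcongr
        linarith
    _ = _ := by simp; ring

theorem tilt_zero (β : Fin M → ℝ) (u : ℝ → Fin M → ℝ) : tilt β u 0 = u := by
  funext s i; simp [tilt]

set_option maxHeartbeats 1000000 in
/-- Points near one which is steered by a control far from the constant ones can be steered to
the origin with a delay at most linear in the distance. -/
theorem IsParallel.steer_near (hp : IsParallel A B e β ν c) (h : IsNice F G A B C) {T : ℝ}
    (hT : IsSmall C c T) (hT0 : 0 < T) {m : ℝ} (hm : 0 < m) :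
    ∃ ρ > 0, ∃ K : ℝ, 0 ≤ K ∧ ∀ t, 0 ≤ t → t ≤ T → ∀ u : ℝ → Fin M → ℝ, IsControl u →
      ∀ x : ℝ → Plane, IsTrajectory (revDynamics F G) u 0 t x →
      m ≤ ∫ s in (0 : ℝ)..t, s * gap u (fun _ => signs β) s →
      m ≤ ∫ s in (0 : ℝ)..t, s * gap u (fun _ => signs (-β)) s →
      ∀ b, ‖b - x t‖ ≤ ρ → ∃ s ≤ t + K * ‖b - x t‖, Steers F G b s := by
  have hC := h.one_le
  have hc := hp.c_pos
  have hc1 := hp.c_le_one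
  obtain ⟨X, Y, hXY⟩ := hp.exists_extremalPair h hT
  -- With the tilt `a = K * d` the gain `c ^ 2 / 2 * (a * m)` equals `(12 * C ^ 4 + 2) * d`: it pays
  -- for the linear error of `side_estimate` and leaves `2 * d`.
  set K := 2 * (12 * C ^ 4 + 2) / (c ^ 2 * m) with hK
  have hK0 : 0 < K := by positivity
  set k := 1 + K with hk
  have hk1 : 1 ≤ k := by linarith
  -- The three radii keep all trajectories in the unit ball, the crossing parameter below `T`, and
  -- the quadratic errors below `d`.
  refine ⟨min (1 / (16 * C ^ 2 * k)) (min (c * T / (8 * C ^ 2 * k)) (c ^ 2 / (256 * C ^ 7 * k ^ 2))),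
    by positivity, 8 * C ^ 2 * k / c, by positivity, ?_⟩
  intro t ht0 htT u hu x hx hm1 hm2 b hb
  have ht := hT.mono hC ht0 htT
  have ht1 : t ≤ 1 := by nlinarith [ht.mul_le]
  have hf := h.isField_rev
  set d := ‖b - x t‖ with hd
  simp only [le_min_iff] at hb
  obtain ⟨hb1, hb2, hb3⟩ := hb
  rcases (norm_nonneg (b - x t)).eq_or_lt with hd0 | hd0
  · have : b = x t := sub_eq_zero.1 (norm_eq_zero.1 hd0.symm)
    refine ⟨t, ?_, this ▸ steers_of_rev_zero h hu ht0 hx⟩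
    have : 0 ≤ 8 * C ^ 2 * k / c * d := by positivity
    linarith
  change 0 < d at hd0
  rw [le_div_iff₀ (by positivity)] at hb1 hb2 hb3
  have hCk : 1 ≤ C ^ 2 * k := by nlinarith [mul_le_mul hC hC (by norm_num) (by linarith)]
  have hdk : C ^ 2 * k * d ≤ 1 / 16 := by linarith
  have hkd : k * d ≤ 1 / 16 := by
    refine le_trans ?_ hdk
    have : 1 ≤ C ^ 2 := by nlinarith
    have : 1 * (k * d) ≤ C ^ 2 * (k * d) := by gcongr
    linarith
  have hd16 : d ≤ 1 / 16 := by
    have : 1 * d ≤ k * d := by gcongr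
    linarith
  set a := K * d with ha
  have ha0 : 0 < a := by positivity
  have hda : d + a = k * d := by rw [ha, hk]; ring
  have ha1 : a ≤ 1 := by linarith
  have hxt : ‖x t‖ ≤ 1 / 4 := by
    have := hx.norm_le hf hu (by rw [norm_zero]; linarith [ht.mul_le]) (r := t) ⟨ht0, le_rfl⟩
    rw [norm_zero, zero_add] at this
    linarith [ht.mul_le]
  have hbn : ‖b‖ + C * t < 1 := by
    have := norm_sub_norm_le b (x t)
    linarith [ht.mul_le]
  -- For each tilt the end `b` is kept; the starting points `y α 0` form the path that must cross
  -- the extremals.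
  have hex : ∀ α ∈ Icc (-a) a, ∃ y : ℝ → Plane,
      IsTrajectory (revDynamics F G) (tilt β u α) (y 0) t y ∧ y t = b ∧
        ∀ r ∈ Icc 0 t, ‖y r‖ ≤ 1 := fun α hα =>
    exists_rev_trajectory_to h (hp.isControl_tilt hu ((_root_.abs_le.2 hα).trans ha1)) ht0
      (by linarith [ht.mul_le]) hbn
  choose! y hy hyb hy1 using hex
  have hctrl : ∀ α ∈ Icc (-a) a, IsControl (tilt β u α) := fun α hα =>
    hp.isControl_tilt hu ((_root_.abs_le.2 hα).trans ha1)
  have h0t : (0 : ℝ) ∈ Icc 0 t := ⟨le_rfl, ht0⟩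
  have htt : t ∈ Icc 0 t := ⟨ht0, le_rfl⟩
  have hMC : 2 * M * t ≤ 2 * C := by
    calc 2 * M * t ≤ 2 * C * 1 := by gcongr; exact h.card_le
      _ = _ := mul_one _
  have hgapint : ∀ α α', C * |∫ s in t..0, gap (tilt β u α) (tilt β u α') s| ≤
      2 * C ^ 2 * |α - α'| := by
    intro α α'
    have h1 := abs_integral_gap_le (hp.gap_tilt_le hu α α') t 0
    rw [zero_sub, abs_neg, abs_of_nonneg ht0] at h1
    calc _ ≤ C * (2 * M * |α - α'| * t) := by gcongr
      _ = C * (2 * M * t * |α - α'|) := by ring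
      _ ≤ C * (2 * C * |α - α'|) := by gcongr
      _ = _ := by ring
  have hcont : ContinuousOn (fun α => y α 0) (Icc (-a) a) := by
    refine LipschitzOnWith.continuousOn (K := (4 * C ^ 2).toNNReal)
      (LipschitzOnWith.of_dist_le_mul fun α hα α' hα' => ?_)
    rw [Real.coe_toNNReal _ (by positivity), dist_eq_norm, Real.dist_eq]
    have h1 := norm_sub_trajectory_le hf (by linarith [ht.mul_le]) (hctrl α hα) (hy α hα)
      (hy1 α hα) (hctrl α' hα') (hy α' hα') (hy1 α' hα') h0t htt
    rw [hyb α hα, hyb α' hα', sub_self, norm_zero, zero_add] at h1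
    linarith [hgapint α α']
  have hxb : ∀ r ∈ Icc 0 t, ‖x r‖ ≤ 1 := fun r hr =>
    (hx.norm_lt_one hf hu (by rw [norm_zero]; linarith [ht.mul_le]) hr).le
  have hy0 : ∀ α ∈ Icc (-a) a, ‖y α 0‖ ≤ 4 * C ^ 2 * (d + a) := by
    intro α hα
    have h1 := norm_sub_trajectory_le hf (by linarith [ht.mul_le]) (hctrl α hα) (hy α hα)
      (hy1 α hα) hu hx hxb h0t htt
    have h2 := hgapint α 0
    rw [tilt_zero, sub_zero] at h2
    rw [hyb α hα, hx.apply_zero ht0, sub_zero] at h1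
    have h3 : |α| ≤ a := _root_.abs_le.2 hα
    have h4 : 2 * C ^ 2 * |α| ≤ 2 * C ^ 2 * a := by gcongr
    have h5 : d ≤ 2 * C ^ 2 * d := le_mul_of_one_le_left hd0.le (by nlinarith)
    linarith
  -- Chosen so that `c / 2 * b₀` is the bound `4 * C ^ 2 * (d + a)` for `y α 0`.
  set b₀ := 8 * C ^ 2 * k / c * d with hb₀
  have hb₀0 : 0 ≤ b₀ := by positivity
  have hb₀T : b₀ ≤ T := by
    rw [hb₀, div_mul_eq_mul_div, div_le_iff₀ hc]
    linarith
  have ham : a ∈ Icc (-a) a := ⟨by linarith, le_rfl⟩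
  have ham' : -a ∈ Icc (-a) a := ⟨le_rfl, by linarith⟩
  have hNs : 4 * C ^ 2 * (d + a) ≤ 1 / 2 := by rw [hda]; linarith
  have hgain : ∀ m', m ≤ m' → (12 * C ^ 4 + 2) * d ≤ c ^ 2 / 2 * (a * m') := by
    intro m' hmm'
    calc (12 * C ^ 4 + 2) * d = c ^ 2 / 2 * (a * m) := by rw [ha, hK]; field_simp
      _ ≤ _ := by gcongr
  have hsq : C ^ 2 * b₀ ^ 2 < 2 * d - 192 * C ^ 7 * (d + a) ^ 2 := by
    have h1 : C ^ 2 * b₀ ^ 2 ≤ 64 * C ^ 7 * k ^ 2 / c ^ 2 * d ^ 2 := by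
      have : C ^ 2 * b₀ ^ 2 = 64 * C ^ 6 * k ^ 2 / c ^ 2 * d ^ 2 := by rw [hb₀]; field_simp; ring
      rw [this]
      gcongr ?_ * ?_ * _ / _ * _
      exact pow_le_pow_right₀ hC (by norm_num)
    have h2 : 192 * C ^ 7 * (d + a) ^ 2 ≤ 192 * C ^ 7 * k ^ 2 / c ^ 2 * d ^ 2 := by
      rw [hda, mul_pow, ← mul_assoc]
      gcongr
      rw [le_div_iff₀ (by positivity)]
      exact mul_le_of_le_one_right (by positivity) (pow_le_one₀ hc.le hc1)
    have h3 : 256 * C ^ 7 * k ^ 2 / c ^ 2 * d ^ 2 ≤ d := by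
      rw [div_mul_eq_mul_div, div_le_iff₀ (by positivity)]
      nlinarith
    have h4 : 64 * C ^ 7 * k ^ 2 / c ^ 2 * d ^ 2 + 192 * C ^ 7 * k ^ 2 / c ^ 2 * d ^ 2 =
      256 * C ^ 7 * k ^ 2 / c ^ 2 * d ^ 2 := by ring
    linarith
  have hside1 := hp.side_estimate h ht hu hx ha0.le ha1 (hctrl a ham)
    (fun s i => by rw [tilt, abs_of_pos ha0]; ring) (hy a ham) (hy1 a ham)
    (by rw [hyb a ham]) hNs
  -- A negative tilt moves towards `signs (-β)`, and with `-e` for `e` the same estimate places the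
  -- start on the other side.
  have hside2 := hp.neg.side_estimate h ht hu hx ha0.le ha1 (hctrl (-a) ham')
    (fun s i => by rw [tilt, abs_neg, abs_of_pos ha0, signs_neg, Pi.neg_apply]; ring)
    (hy (-a) ham') (hy1 (-a) ham') (by rw [hyb (-a) ham']) hNs
  rw [wedge_neg_left] at hside2
  have hg1 := hgain _ hm1
  have hg2 := hgain _ hm2
  obtain ⟨α, hα, b', hb', heq⟩ := exists_crossing (γ := joinCurves X Y) (p := fun α => y α 0)
    (k := totalSize β) (D := C ^ 2) (b₀ := b₀) (a := a) hp.norm_e hc hp.c_le_totalSize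
    (by positivity) hb₀0 ha0.le hp.abs_ν
    (fun b' hb' b hb => hp.norm_joinCurves_sub_le h hT hXY (by linarith [hb'.1]) hb.1
      (by linarith [hb.2]))
    (by rw [joinCurves_of_nonneg X Y le_rfl, hXY.trajX.apply_zero hT.nonneg])
    (fun b hb => hp.abs_wedge_joinCurves_le h hT hXY ⟨by linarith [hb.1], by linarith [hb.2]⟩)
    hcont
    (fun α hα => by
      have h1 := abs_real_inner_le_norm e (y α 0)
      rw [hp.norm_e, one_mul] at h1
      refine h1.trans ((hy0 α hα).trans (le_of_eq ?_))
      rw [hda, hb₀]; field_simp; ring)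
    (by linarith) (by linarith)
  have hst := hp.steers_joinCurves h hT.nonneg hXY (b := b')
    ⟨by linarith [hb'.1], by linarith [hb'.2]⟩
  rw [← heq] at hst
  have hfin := steers_of_rev h (hctrl α hα) ht0 (hy α hα) hst
  rw [hyb α hα] at hfin
  exact ⟨_, by linarith [_root_.abs_le.2 hb'], hfin⟩

end

/-! ### Identification of the singular set -/

section

variable {M : ℕ} {F : Plane → Plane} {G : Fin M → Plane → Plane} {A : Plane →L[ℝ] Plane}
  {B : Fin M → Plane} {C : ℝ} {e : Plane} {β : Fin M → ℝ} {ν c : ℝ}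

section Extremals

variable {T : ℝ} {X Y : ℝ → Plane}

/-- `x` has positive distance from the two compact curves, so by `moment_ge_of_dist` all
trajectories ending near `x` have both moments bounded below, uniformly in `t ≤ T`. -/
theorem IsParallel.steerStable (hp : IsParallel A B e β ν c) (h : IsNice F G A B C)
    (hT : IsSmall C c T) (hT0 : 0 < T) (hXY : IsExtremalPair F G β T X Y) {x : Plane}
    (hx : x ∉ X '' Icc 0 T ∪ Y '' Icc 0 T) : SteerStable F G T x := by
  have hC := h.one_le
  have hcl : IsClosed (X '' Icc 0 T ∪ Y '' Icc 0 T) :=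
    ((isCompact_Icc.image hXY.contX).union (isCompact_Icc.image hXY.contY)).isClosed
  obtain ⟨ε, hε, hball⟩ := Metric.isOpen_iff.1 hcl.isOpen_compl x hx
  have hfar : ∀ y ∈ X '' Icc 0 T ∪ Y '' Icc 0 T, ε ≤ ‖y - x‖ := by
    intro y hy
    by_contra! hlt
    exact hball (by simpa [dist_eq_norm] using hlt) hy
  obtain ⟨ρ, hρ, K, hK, hst⟩ := hp.steer_near h hT hT0
    (m := (ε / 2) ^ 2 / (32 * C ^ 3)) (by positivity)
  refine ⟨min (ε / 2) (ρ / 2), by positivity, K, hK, fun a b ha hb t ht hs => ?_⟩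
  rw [lt_min_iff] at ha hb
  obtain ⟨u, hu, y, hy, rfl⟩ := hs.exists_rev h
  have htC : C * t ≤ 1 / 4 := (hT.mono hC hs.1 ht).mul_le
  have hdist : ∀ z ∈ X '' Icc 0 T ∪ Y '' Icc 0 T, ε / 2 ≤ ‖y t - z‖ := by
    intro z hz
    have h1 := hfar z hz
    have h2 := norm_sub_le_norm_sub_add_norm_sub z (y t) x
    rw [norm_sub_rev z (y t)] at h2
    linarith
  refine hst t hs.1 ht u hu y hy ?_ ?_ b ?_
  · exact moment_ge_of_dist h hs.1 htC hu hp.isControl hy (hXY.trajX.mono ht) (by linarith)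
      (hdist _ (Or.inl ⟨t, ⟨hs.1, ht⟩, rfl⟩))
  · exact moment_ge_of_dist h hs.1 htC hu hp.neg.isControl hy (hXY.trajY.mono ht) (by linarith)
      (hdist _ (Or.inr ⟨t, ⟨hs.1, ht⟩, rfl⟩))
  · have h2 := norm_sub_le_norm_sub_add_norm_sub b x (y t)
    rw [norm_sub_rev x (y t)] at h2
    linarith

/-- This includes points of the extremals: after waiting, `x` is reached at time `T > τ`, when the
extremals are at points of minimum time `T`, hence different from `x`. -/
theorem IsParallel.exists_finite (hp : IsParallel A B e β ν c) (h : IsNice F G A B C)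
    (hT : IsSmall C c T) (hXY : IsExtremalPair F G β T X Y) {τ : ℝ}
    (hτT : τ < T) {x : Plane} (hx : Steers F G x τ) :
    ∃ ρ > 0, ∀ b, ‖b - x‖ < ρ → minTime F G b ≠ ⊤ := by
  have hC := h.one_le
  have hT0 : 0 < T := hx.1.trans_lt hτT
  obtain ⟨u, hu, y, hy, hyx⟩ := (hx.mono h hτT.le).exists_rev h
  have hne : ∀ z, minTime F G z = ENNReal.ofReal T → x ≠ z := by
    rintro z hz rfl
    have h1 := hx.minTime_le
    rw [hz, ENNReal.ofReal_le_ofReal_iff hx.1] at h1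
    linarith
  have h1 := hne _ (hp.minTime_extremal h hT hXY.contX hXY.trajX)
  have h2 := hne _ (hp.neg.minTime_extremal h hT hXY.contY hXY.trajY)
  set ε := min ‖x - X T‖ ‖x - Y T‖ with hε
  have hε0 : 0 < ε := lt_min (norm_pos_iff.2 (sub_ne_zero.2 h1)) (norm_pos_iff.2 (sub_ne_zero.2 h2))
  obtain ⟨ρ, hρ, K, hK, hst⟩ := hp.steer_near h hT hT0 (m := ε ^ 2 / (32 * C ^ 3)) (by positivity)
  refine ⟨ρ, hρ, fun b hb => ?_⟩
  obtain ⟨s, -, hs⟩ := hst T hT0.le le_rfl u hu y hy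
    (moment_ge_of_dist h hT0.le hT.mul_le hu hp.isControl hy hXY.trajX hε0
      (by rw [hyx]; exact min_le_left _ _))
    (moment_ge_of_dist h hT0.le hT.mul_le hu hp.neg.isControl hy hXY.trajY hε0
      (by rw [hyx]; exact min_le_right _ _)) b (by rw [hyx]; exact hb.le)
  exact hs.minTime_ne_top

/-- The arcs of `X`, `Y` after `τ` have minimum time greater than `τ`, so `x` avoids the curves up
to `T` as well. -/
theorem IsParallel.lipAt (hp : IsParallel A B e β ν c) (h : IsNice F G A B C)
    (hT : IsSmall C c T) (hXY : IsExtremalPair F G β T X Y) {τ : ℝ}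
    (hτT : τ < T) {x : Plane} (hx : Steers F G x τ) (hxΓ : x ∉ X '' Icc 0 τ ∪ Y '' Icc 0 τ) :
    LipAt (minTime F G) x := by
  have hC := h.one_le
  refine (hp.steerStable h hT (hx.1.trans_lt hτT) hXY ?_).lipAt hτT hx
  have key : ∀ Z : ℝ → Plane, (∀ t ∈ Icc 0 T, minTime F G (Z t) = ENNReal.ofReal t) →
      x ∈ Z '' Icc 0 T → x ∈ Z '' Icc 0 τ := by
    rintro Z hZ ⟨t, ht, rfl⟩
    have h1 := hx.minTime_le
    rw [hZ t ht, ENNReal.ofReal_le_ofReal_iff hx.1] at h1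
    exact ⟨t, ⟨ht.1, h1⟩, rfl⟩
  rintro (hm | hm)
  · exact hxΓ (Or.inl (key X (fun t ht => hp.minTime_extremal h (hT.mono hC ht.1 ht.2) hXY.contX
      (hXY.trajX.mono ht.2)) hm))
  · exact hxΓ (Or.inr (key Y (fun t ht => hp.neg.minTime_extremal h (hT.mono hC ht.1 ht.2)
      hXY.contY (hXY.trajY.mono ht.2)) hm))

theorem IsParallel.singularSet_eq (hp : IsParallel A B e β ν c) (h : IsNice F G A B C)
    (hT : IsSmall C c T) (hXY : IsExtremalPair F G β T X Y) {τ : ℝ} (hτT : τ < T) :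
    singularSet F G τ = X '' Icc 0 τ ∪ Y '' Icc 0 τ := by
  have hC := h.one_le
  refine Subset.antisymm (fun x hx => ?_) ?_
  · by_contra hxΓ
    have hs := (mem_reachable_iff h).1 hx.1
    obtain ⟨ρ, hρ, hfin⟩ := hp.exists_finite h hT hXY hτT hs
    have hτ := (hT.mono hC hs.1 hτT.le).mul_le
    exact not_lipAt_of_mem_singularSet h (by linarith) hx hρ hfin (hp.lipAt h hT hXY hτT hs hxΓ)
  · rintro x (⟨t, ht, rfl⟩ | ⟨t, ht, rfl⟩)
    · exact hp.extremal_mem_singularSet h (hT.mono hC ht.1 (ht.2.trans hτT.le)) ht.2 hXY.contX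
        (hXY.trajX.mono (ht.2.trans hτT.le))
    · exact hp.neg.extremal_mem_singularSet h (hT.mono hC ht.1 (ht.2.trans hτT.le)) ht.2 hXY.contY
        (hXY.trajY.mono (ht.2.trans hτT.le))

theorem IsParallel.singularSet_eq_nonLipschitz (hp : IsParallel A B e β ν c)
    (h : IsNice F G A B C) (hT : IsSmall C c T) (hXY : IsExtremalPair F G β T X Y) {τ : ℝ}
    (hτT : τ < T) :
    singularSet F G τ =
      {x | x ∈ reachable F G τ ∧ NonLipschitzAt (minTime F G) x} := by
  have hC := h.one_le
  ext x
  rw [mem_ofPred_eq, nonLipschitzAt_iff]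
  constructor
  · intro hx
    have hs := (mem_reachable_iff h).1 hx.1
    obtain ⟨ρ, hρ, hfin⟩ := hp.exists_finite h hT hXY hτT hs
    have hτ := (hT.mono hC hs.1 hτT.le).mul_le
    exact ⟨hx.1, not_lipAt_of_mem_singularSet h (by linarith) hx hρ hfin⟩
  · rintro ⟨hx, hnl⟩
    rw [hp.singularSet_eq h hT hXY hτT]
    by_contra hxΓ
    exact hnl (hp.lipAt h hT hXY hτT ((mem_reachable_iff h).1 hx) hxΓ)

end Extremals

/-! ### Independent control fields -/

/-- If two control vector fields are independent at the origin, then small points can be steered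
to the origin along a segment. -/
theorem exists_steers_of_wedge_ne_zero (h : IsNice F G A B C) {i j : Fin M}
    (hij : wedge (B i) (B j) ≠ 0) :
    ∃ ρ > 0, ∃ K : ℝ, 0 ≤ K ∧ ∀ p, ‖p‖ < ρ → Steers F G p (K * ‖p‖) := by
  have hC := h.one_le
  have hne : i ≠ j := by rintro rfl; exact hij (wedge_self _)
  have hGc := fun i => (h.G_contDiff i).continuous
  have hFc := h.F_contDiff.continuous
  have hwc : ∀ {f g : Plane → Plane}, Continuous f → Continuous g →
      Continuous fun z => wedge (f z) (g z) := fun hf hg => by unfold wedge; fun_prop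
  set δ := |wedge (B i) (B j)| / 2 with hδ
  have hδ0 : 0 < δ := by positivity
  have hev : ∀ᶠ z in 𝓝 (0 : Plane), δ < |wedge (G i z) (G j z)| := by
    refine (hwc (hGc i) (hGc j)).abs.continuousAt.eventually_const_lt ?_
    simp only [h.G_zero]
    rw [hδ]
    exact half_lt_self (abs_pos.2 hij)
  obtain ⟨r, hr, hball⟩ := Metric.eventually_nhds_iff_ball.1 hev
  refine ⟨min (min r 1) (δ / (4 * C ^ 2)), by positivity, 2 * C / δ, by positivity,
    fun p hp => ?_⟩
  simp only [lt_min_iff] at hp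
  obtain ⟨⟨hpr, hp1⟩, hpδ⟩ := hp
  rcases eq_or_ne p 0 with rfl | hp0
  · simpa using steers_zero
  have hpn : 0 < ‖p‖ := norm_pos_iff.2 hp0
  -- The segment is run at speed `δ / (2 * C)`; the compensation of `F` takes at most as much again.
  set t := 2 * C / δ * ‖p‖ with ht
  have ht0 : 0 < t := by positivity
  set y : ℝ → Plane := fun s => (1 - (projIcc (0 : ℝ) 1 zero_le_one (s / t) : ℝ)) • p with hy
  have hyc : Continuous y := by
    have : Continuous fun s : ℝ => (projIcc (0 : ℝ) 1 zero_le_one (s / t) : ℝ) :=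
      continuous_subtype_val.comp (continuous_projIcc.comp (continuous_id.div_const t))
    exact (continuous_const.sub this).smul continuous_const
  have hyn : ∀ s, ‖y s‖ ≤ ‖p‖ := by
    intro s
    have h1 := (projIcc (0 : ℝ) 1 zero_le_one (s / t)).2
    rw [hy, norm_smul, Real.norm_eq_abs, abs_of_nonneg (by linarith [h1.2])]
    exact mul_le_of_le_one_left (norm_nonneg _) (by linarith [h1.1])
  have hD : ∀ s, δ < |wedge (G i (y s)) (G j (y s))| := fun s =>
    hball _ (by simpa using (hyn s).trans_lt hpr)
  have hD0 : ∀ s, wedge (G i (y s)) (G j (y s)) ≠ 0 := fun s =>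
    abs_pos.1 (hδ0.trans (hD s))
  set v : ℝ → Plane := fun s => -(t⁻¹ • p) - F (y s) with hv
  have hvc : Continuous v := continuous_const.sub (hFc.comp hyc)
  have hvn : ∀ s, ‖v s‖ ≤ δ / C := by
    intro s
    have h1 : ‖F (y s)‖ ≤ 2 * C * ‖p‖ := by
      have k1 := h.F_sub 1 le_rfl (y s) 0 ((hyn s).trans hp1.le) (by simp)
      rw [h.F_zero, sub_zero, sub_zero, mul_one] at k1
      have k2 := norm_sub_norm_le (F (y s)) (A (y s))
      have k3 := A.le_opNorm (y s)
      have k4 : ‖A‖ * ‖y s‖ ≤ C * ‖p‖ := by gcongr; exact h.norm_A; exact hyn s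
      have k5 : C * ‖y s‖ ≤ C * ‖p‖ := by gcongr; exact hyn s
      linarith
    have h2 : 2 * C * ‖p‖ ≤ δ / C / 2 := by
      rw [lt_div_iff₀ (by positivity)] at hpδ
      rw [div_div, le_div_iff₀ (by positivity)]
      nlinarith
    have h3 : ‖-(t⁻¹ • p)‖ = δ / C / 2 := by
      rw [norm_neg, norm_smul, Real.norm_eq_abs, abs_of_pos (by positivity), ht]
      field_simp
    calc ‖v s‖ ≤ _ := norm_sub_le _ _
      _ ≤ _ := by rw [h3]; linarith
  -- Cramer's rule for the two controls that produce the velocity `v s`; they are admissible because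
  -- `‖v s‖ ≤ δ / C`.
  set a : ℝ → ℝ := fun s => wedge (v s) (G j (y s)) / wedge (G i (y s)) (G j (y s)) with ha
  set b : ℝ → ℝ := fun s => wedge (G i (y s)) (v s) / wedge (G i (y s)) (G j (y s)) with hb
  have hwc' : ∀ {f g : ℝ → Plane}, Continuous f → Continuous g →
      Continuous fun z => wedge (f z) (g z) := fun hf hg => by unfold wedge; fun_prop
  have hac : Continuous a := (hwc' hvc ((hGc j).comp hyc)).div
    (hwc' ((hGc i).comp hyc) ((hGc j).comp hyc)) hD0
  have hbc : Continuous b := (hwc' ((hGc i).comp hyc) hvc).div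
    (hwc' ((hGc i).comp hyc) ((hGc j).comp hyc)) hD0
  have hbound : ∀ s q, |q| ≤ ‖v s‖ * C → |q / wedge (G i (y s)) (G j (y s))| ≤ 1 := by
    intro s q hq
    rw [abs_div, div_le_one (hδ0.trans (hD s))]
    refine hq.trans (le_trans ?_ (hD s).le)
    calc ‖v s‖ * C ≤ δ / C * C := by gcongr; exact hvn s
      _ = δ := by field_simp
  have hGn : ∀ l s, ‖G l (y s)‖ ≤ C := fun l s => h.norm_G l _ ((hyn s).trans hp1.le)
  have ha1 : ∀ s, |a s| ≤ 1 := fun s => hbound s _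
    ((abs_wedge_le _ _).trans (by gcongr; exact hGn j s))
  have hb1 : ∀ s, |b s| ≤ 1 := fun s => hbound s _
    ((abs_wedge_le _ _).trans (by rw [mul_comm]; gcongr; exact hGn i s))
  set u : ℝ → Fin M → ℝ := fun s => Pi.single i (a s) + Pi.single j (b s) with hu
  have huc : IsControl u := by
    refine ⟨measurable_pi_iff.2 fun l => Continuous.measurable ?_, Eventually.of_forall fun s =>
      mem_cube_of_abs_le_one fun l => ?_⟩
    · simp only [hu, Pi.add_apply, Pi.single_apply]
      split_ifs <;> fun_prop
    · simp only [hu, Pi.add_apply, Pi.single_apply]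
      by_cases hl : l = i
      · have : l ≠ j := hl ▸ hne
        simpa [hl, hne] using ha1 s
      · by_cases hl' : l = j
        · simpa [hl, hl'] using (by simpa [hl', hne.symm] using hb1 s : |_| ≤ (1 : ℝ))
        · simp [hl, hl']
  have hdyn : ∀ s, dynamics F G (y s) (u s) = -(t⁻¹ • p) := by
    intro s
    have h1 : ∑ l, u s l • G l (y s) = a s • G i (y s) + b s • G j (y s) := by
      simp [hu, add_smul, Finset.sum_add_distrib, Pi.single_apply, ite_smul]
    have h2 : a s • G i (y s) + b s • G j (y s) = v s := by
      have h3 := hD0 s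
      set g := G i (y s)
      set k := G j (y s)
      ext l
      simp only [ha, hb, PiLp.add_apply, PiLp.smul_apply, smul_eq_mul, div_mul_eq_mul_div,
        ← add_div]
      rw [div_eq_iff h3]
      fin_cases l <;> simp only [wedge, Fin.zero_eta, Fin.mk_one] <;> ring
    rw [dynamics, h1, h2, hv]
    simp
  have hyval : ∀ r ∈ Icc 0 t, y r = (1 - r / t) • p := by
    intro r hr
    have : r / t ∈ Icc (0 : ℝ) 1 := ⟨div_nonneg hr.1 ht0.le, (div_le_one ht0).2 hr.2⟩
    simp only [hy, projIcc_of_mem zero_le_one this]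
  refine ⟨ht0.le, u, huc, y, ⟨hyc.continuousOn, fun r hr => ?_⟩, ?_⟩
  · simp only [hdyn]
    rw [intervalIntegral.integral_const, hyval r hr, sub_zero, smul_neg, smul_smul, sub_smul,
      one_smul, div_eq_mul_inv, sub_eq_add_neg]
  · rw [hyval t ⟨ht0.le, le_rfl⟩, div_self ht0.ne', sub_self, zero_smul]

/-- The control that steers `a` brings `b` within `2 * ‖b - a‖` of the origin; a segment covers the
rest. -/
theorem steerStable_of_wedge_ne_zero (h : IsNice F G A B C) {i j : Fin M}
    (hij : wedge (B i) (B j) ≠ 0) {T : ℝ} (hT : C * T ≤ 1 / 4) (x : Plane) (hx : ‖x‖ ≤ 1 / 4) :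
    SteerStable F G T x := by
  have hC := h.one_le
  have hf := h.isField_rev
  obtain ⟨ρ, hρ, K, hK, hst⟩ := exists_steers_of_wedge_ne_zero h hij
  refine ⟨min (1 / 4) (ρ / 4), by positivity, K * 2, by positivity, fun a b ha hb t ht hs => ?_⟩
  rw [lt_min_iff] at ha hb
  obtain ⟨u, hu, y, hy, rfl⟩ := hs.exists_rev h
  have htC : C * t ≤ 1 / 4 := le_trans (by gcongr) hT
  have hbn : ‖b‖ + C * t < 1 := by
    have := norm_sub_norm_le b x
    linarith
  obtain ⟨z, hz, hzb, hz1⟩ := exists_rev_trajectory_to h hu hs.1 (by linarith) hbn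
  have h1 := norm_sub_trajectory_le hf (by linarith) hu hz hz1 hu hy
    (fun r hr => (hy.norm_lt_one hf hu (by rw [norm_zero]; linarith) hr).le)
    (r := 0) (r0 := t) ⟨le_rfl, hs.1⟩ ⟨hs.1, le_rfl⟩
  have h2 : gap u u = fun _ => 0 := by funext s; simp [gap]
  rw [h2, hzb, hy.apply_zero hs.1, sub_zero] at h1
  simp only [intervalIntegral.integral_zero, abs_zero, mul_zero, add_zero] at h1
  have h3 : ‖b - y t‖ < ρ / 2 := by
    have := norm_sub_le_norm_sub_add_norm_sub b x (y t)
    rw [norm_sub_rev x (y t)] at this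
    linarith
  have h4 := steers_of_rev h hu hs.1 hz (hst (z 0) (by linarith))
  rw [hzb] at h4
  refine ⟨_, ?_, h4⟩
  have : K * ‖z 0‖ ≤ K * (2 * ‖b - y t‖) := by gcongr
  linarith

end

/-! ### Rank condition, rectifiability and length -/

theorem wedge_ne_zero_of_rank_columns {v w : Plane} (h : (columns v w).rank = 2) :
    wedge v w ≠ 0 := by
  intro h0
  have hdet : (columns v w).det = 0 := by
    rw [Matrix.det_fin_two, ← h0]
    simp [columns, wedge]
    ring
  obtain ⟨x, hx, hx0⟩ := Matrix.exists_mulVec_eq_zero_iff.2 hdet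
  have htop : LinearMap.range (columns v w).mulVecLin = ⊤ :=
    Submodule.eq_top_of_finrank_eq (by simpa [Matrix.rank] using h)
  have hinj := LinearMap.injective_iff_surjective.2 (LinearMap.range_eq_top.1 htop)
  exact hx (hinj (by simpa using hx0))

theorem eq_inner_smul_of_wedge_eq_zero {e x : Plane} (he : ‖e‖ = 1) (h : wedge e x = 0) :
    x = (inner ℝ e x : ℝ) • e := by
  have h1 := inner_sq_add_wedge_sq e x
  rw [h, he] at h1
  have h2 : ‖x - (inner ℝ e x : ℝ) • e‖ ^ 2 = 0 := by
    rw [norm_sub_sq_real, inner_smul_right, norm_smul, he, mul_one, Real.norm_eq_abs, sq_abs,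
      real_inner_comm e x]
    linarith
  exact sub_eq_zero.1 (norm_eq_zero.1 (pow_eq_zero_iff two_ne_zero |>.1 h2))

theorem exists_isParallel {M : ℕ} (hM : 0 < M) {A : Plane →L[ℝ] Plane} {B : Fin M → Plane}
    (hAB : ∀ i, wedge (B i) (A (B i)) ≠ 0) (hB : ∀ i j, wedge (B i) (B j) = 0) :
    ∃ (e : Plane) (β : Fin M → ℝ) (ν c : ℝ), IsParallel A B e β ν c := by
  have : Nonempty (Fin M) := ⟨⟨0, hM⟩⟩
  set b := B ⟨0, hM⟩ with hb
  have hB0 : ∀ i, B i ≠ 0 := fun i hi => hAB i (by simp [hi, wedge])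
  have hbn : ‖b‖ ≠ 0 := norm_ne_zero_iff.2 (hB0 _)
  set e := ‖b‖⁻¹ • b with he
  have hen : ‖e‖ = 1 := by rw [he, norm_smul, norm_inv, norm_norm, inv_mul_cancel₀ hbn]
  have hBe : ∀ i, B i = (inner ℝ e (B i) : ℝ) • e := fun i =>
    eq_inner_smul_of_wedge_eq_zero hen (by rw [he, wedge_smul_left, hb, hB, mul_zero])
  have hκ : wedge e (A e) ≠ 0 := by
    rw [he, map_smul, wedge_smul_left, wedge_smul_right]
    exact mul_ne_zero (inv_ne_zero hbn) (mul_ne_zero (inv_ne_zero hbn) (hAB _))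
  have hβ : ∀ i, (inner ℝ e (B i) : ℝ) ≠ 0 := fun i hi =>
    hB0 i (by rw [hBe i, hi, zero_smul])
  obtain ⟨k, hk⟩ := Finite.exists_min fun i => |(inner ℝ e (B i) : ℝ)|
  refine ⟨e, fun i => inner ℝ e (B i), wedge e (A e) / |wedge e (A e)|,
    min 1 (min |(inner ℝ e (B k) : ℝ)| |wedge e (A e)|), hM, hen, hBe,
    lt_min one_pos (lt_min (abs_pos.2 (hβ k)) (abs_pos.2 hκ)), min_le_left _ _,
    fun i => (min_le_right _ _).trans ((min_le_left _ _).trans (hk i)), ?_, ?_⟩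
  · rw [abs_div, abs_abs, div_self (abs_ne_zero.2 hκ)]
  · refine (min_le_right _ _).trans ((min_le_right _ _).trans (le_of_eq ?_))
    rw [div_mul_eq_mul_div, eq_div_iff (abs_ne_zero.2 hκ), abs_mul_abs_self]

theorem isCaratheodory_hausdorffMeasure {E : Set Plane} (hE : IsClosed E) (d : ℝ) :
    (Measure.hausdorffMeasure d : Measure Plane).toOuterMeasure.IsCaratheodory E :=
  le_toOuterMeasure_caratheodory _ _ hE.measurableSet

theorem countablyRectifiable_empty (k : ℕ) : CountablyRectifiable k ∅ :=
  ⟨isCaratheodory_hausdorffMeasure isClosed_empty _, fun _ _ => 0,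
    fun _ => ⟨0, LipschitzWith.const 0⟩, by simp⟩

/-- Clamping the parameter to `[0, τ]` extends the curve without increasing its Lipschitz constant.
-/
theorem exists_lipschitzWith_image_Icc_subset_range {X : ℝ → Plane} {τ : ℝ} (hτ : 0 ≤ τ) {K : ℝ≥0}
    (hX : LipschitzOnWith K X (Icc 0 τ)) :
    ∃ f : EuclideanSpace ℝ (Fin 1) → Plane, (∃ K : ℝ≥0, LipschitzWith K f) ∧
      X '' Icc 0 τ ⊆ range f := by
  have h1 : LipschitzWith (K * 1) (IccExtend hτ ((Icc 0 τ).domRestrict X)) :=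
    (lipschitzOnWith_iff_restrict.1 hX).comp (LipschitzWith.projIcc hτ)
  have h2 := h1.comp (EuclideanSpace.proj 0 : EuclideanSpace ℝ (Fin 1) →L[ℝ] ℝ).lipschitz
  refine ⟨_, ⟨_, h2⟩, ?_⟩
  rintro _ ⟨t, ht, rfl⟩
  exact ⟨EuclideanSpace.single 0 t, by simp [IccExtend_of_mem hτ _ ht]⟩

theorem countablyRectifiable_image_union {X Y : ℝ → Plane} {τ : ℝ} (hτ : 0 ≤ τ) {K : ℝ≥0}
    (hX : LipschitzOnWith K X (Icc 0 τ)) (hY : LipschitzOnWith K Y (Icc 0 τ)) :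
    CountablyRectifiable 1 (X '' Icc 0 τ ∪ Y '' Icc 0 τ) := by
  obtain ⟨f, hf, hXf⟩ := exists_lipschitzWith_image_Icc_subset_range hτ hX
  obtain ⟨g, hg, hYg⟩ := exists_lipschitzWith_image_Icc_subset_range hτ hY
  refine ⟨isCaratheodory_hausdorffMeasure ((isCompact_Icc.image_of_continuousOn
    hX.continuousOn).union (isCompact_Icc.image_of_continuousOn hY.continuousOn)).isClosed _,
    fun n => if n = 0 then f else g, fun n => ?_, ?_⟩
  · dsimp only
    split_ifs
    exacts [hf, hg]
  · rw [sdiff_eq_empty.2, measure_empty]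
    refine union_subset (hXf.trans ?_) (hYg.trans ?_)
    · exact subset_iUnion_of_subset 0 (by simp)
    · exact subset_iUnion_of_subset 1 (by simp)

/-- A nonconstant curve has positive length near each of its points. -/
theorem hausdorffMeasure_inter_ball_pos {X : ℝ → Plane} {I : Set ℝ} (hI : IsPreconnected I)
    (hX : ContinuousOn X I) {E : Set Plane} (hE : X '' I ⊆ E) {t t' : ℝ} (ht : t ∈ I)
    (ht' : t' ∈ I) (hne : X t' ≠ X t) :
    0 < Measure.hausdorffMeasure 1 (E ∩ Metric.ball (X t) 1) := by
  have hd : 0 < dist (X t') (X t) := dist_pos.2 hne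
  -- The distance to `X t` is 1-Lipschitz and, by connectedness, its values fill an interval.
  have hsub : Ico 0 (min 1 (dist (X t') (X t))) ⊆
      (fun z => dist z (X t)) '' (E ∩ Metric.ball (X t) 1) := by
    intro r hr
    have hc : ContinuousOn (fun s => dist (X s) (X t)) I :=
      (continuous_id.dist continuous_const).comp_continuousOn hX
    obtain ⟨s, hs, hsr⟩ := hI.intermediate_value ht ht' hc
      ⟨by simpa using hr.1, (hr.2.trans_le (min_le_right _ _)).le⟩
    refine ⟨X s, ⟨hE ⟨s, hs, rfl⟩, ?_⟩, hsr⟩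
    rw [Metric.mem_ball]
    exact hsr.trans_lt (hr.2.trans_le (min_le_left _ _))
  have h1 := (LipschitzWith.dist_left (X t)).hausdorffMeasure_image_le zero_le_one
    (E ∩ Metric.ball (X t) 1)
  rw [ENNReal.coe_one, ENNReal.one_rpow, one_mul, hausdorffMeasure_real] at h1
  refine lt_of_lt_of_le ?_ ((measure_mono hsub).trans h1)
  simp [hd]

section Conclusions

variable {M : ℕ} {F : Plane → Plane} {G : Fin M → Plane → Plane} {A : Plane →L[ℝ] Plane}
  {B : Fin M → Plane} {C : ℝ}

theorem singularSet_eq_empty_of_wedge_ne_zero (h : IsNice F G A B C) {i j : Fin M}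
    (hij : wedge (B i) (B j) ≠ 0) {T τ : ℝ} (hT : C * T ≤ 1 / 4) (hτ : τ < T) :
    singularSet F G τ = ∅ ∧
      {x | x ∈ reachable F G τ ∧ NonLipschitzAt (minTime F G) x} = ∅ := by
  have hC := h.one_le
  have hCτ : C * τ ≤ 1 / 4 := le_trans (by gcongr) hT
  have hst : ∀ x, Steers F G x τ → SteerStable F G T x := fun x hx =>
    steerStable_of_wedge_ne_zero h hij hT x ((hx.norm_le h (by linarith)).trans hCτ)
  constructor
  · refine eq_empty_of_forall_notMem fun x hx => ?_
    have hs := (mem_reachable_iff h).1 hx.1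
    obtain ⟨ρ, hρ, hfin⟩ := (hst x hs).exists_finite hτ.le hs
    exact not_lipAt_of_mem_singularSet h (by linarith) hx hρ hfin ((hst x hs).lipAt hτ hs)
  · refine eq_empty_of_forall_notMem fun x hx => ?_
    have hs := (mem_reachable_iff h).1 hx.1
    exact (nonLipschitzAt_iff _ _).1 hx.2 ((hst x hs).lipAt hτ hs)

variable {e : Plane} {β : Fin M → ℝ} {ν c : ℝ}

theorem IsParallel.isOptimalReversed (hp : IsParallel A B e β ν c) (h : IsNice F G A B C) {t : ℝ}
    (ht : IsSmall C c t) {X : ℝ → Plane} (hXc : Continuous X)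
    (hX : IsTrajectory (revDynamics F G) (fun _ => signs β) 0 t X) :
    IsOptimalReversed F G t X :=
  ⟨⟨_, hp.isControl, hX⟩, hp.minTime_extremal h ht hXc hX⟩

theorem IsParallel.lipschitzOnWith_extremal (hp : IsParallel A B e β ν c)
    (h : IsNice F G A B C) {t : ℝ} (ht : IsSmall C c t) {X : ℝ → Plane}
    (hX : IsTrajectory (revDynamics F G) (fun _ => signs β) 0 t X) :
    LipschitzOnWith C.toNNReal X (Icc 0 t) := by
  refine LipschitzOnWith.of_dist_le_mul fun r hr s hs => ?_
  rw [Real.coe_toNNReal _ (zero_le_one.trans h.one_le), dist_eq_norm, Real.dist_eq]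
  exact hX.norm_sub_le h.isField_rev hp.isControl (by rw [norm_zero]; linarith [ht.mul_le]) hs hr

/-- The minimum time recovers the parameter of an extremal. -/
theorem IsParallel.injOn_extremal (hp : IsParallel A B e β ν c)
    (h : IsNice F G A B C) {t : ℝ} (ht : IsSmall C c t) {X : ℝ → Plane} (hXc : Continuous X)
    (hX : IsTrajectory (revDynamics F G) (fun _ => signs β) 0 t X) : InjOn X (Icc 0 t) := by
  have key : ∀ r ∈ Icc 0 t, minTime F G (X r) = ENNReal.ofReal r := fun r hr =>
    hp.minTime_extremal h (ht.mono h.one_le hr.1 hr.2) hXc (hX.mono hr.2)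
  intro r hr s hs hrs
  rw [← ENNReal.ofReal_eq_ofReal_iff hr.1 hs.1, ← key r hr, ← key s hs, hrs]

theorem IsParallel.hausdorffMeasure_pos (hp : IsParallel A B e β ν c)
    (h : IsNice F G A B C) {τ : ℝ} (ht : IsSmall C c τ) (hτ : 0 < τ) {X : ℝ → Plane}
    (hXc : Continuous X) (hX : IsTrajectory (revDynamics F G) (fun _ => signs β) 0 τ X)
    {E : Set Plane} (hE : X '' Icc 0 τ ⊆ E) {t : ℝ} (htτ : t ∈ Icc 0 τ) :
    0 < Measure.hausdorffMeasure 1 (E ∩ Metric.ball (X t) 1) := by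
  obtain ⟨t', ht', hne⟩ : ∃ t' ∈ Icc 0 τ, t' ≠ t := by
    by_cases h0 : t = 0
    · exact ⟨τ, ⟨hτ.le, le_rfl⟩, by rw [h0]; exact hτ.ne'⟩
    · exact ⟨0, ⟨le_rfl, hτ.le⟩, Ne.symm h0⟩
  exact hausdorffMeasure_inter_ball_pos isPreconnected_Icc hXc.continuousOn hE htτ ht'
    fun heq => hne (hp.injOn_extremal h ht hXc hX ht' htτ heq)

end Conclusions

end MinTime

end

theorem theorem5p2 (M : ℕ) (hM : M = 1 ∨ M = 2) (L : ℝ≥0)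
    (A : MinTime.Plane →L[ℝ] MinTime.Plane) (B : Fin M → MinTime.Plane)
    (hAB : ∀ i, (MinTime.columns (B i) (A (B i))).rank = 2) :
    -- the time bound depends only on `L`, `A = DF(0)` and `B = G(0)`
    ∃ T₀ : ℝ, 0 < T₀ ∧
      ∀ (F : MinTime.Plane → MinTime.Plane) (G : Fin M → MinTime.Plane → MinTime.Plane),
        MinTime.IsC11 L F → (∀ i, MinTime.IsC11 L (G i)) →
        F 0 = 0 → fderiv ℝ F 0 = A →
        (∀ i, G i 0 = B i) → (∀ i, fderiv ℝ (G i) 0 = 0) →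
        ∀ τ : ℝ, 0 < τ → τ < T₀ →
          -- `S` is exactly the set of non-Lipschitz points of `T` in `R_τ`
          MinTime.singularSet F G τ =
            {x | x ∈ MinTime.reachable F G τ ∧
              MinTime.NonLipschitzAt (MinTime.minTime F G) x} ∧
          MinTime.CountablyRectifiable 1 (MinTime.singularSet F G τ) ∧
          -- `S` is empty or consists of exactly two optimal trajectories
          (MinTime.singularSet F G τ = ∅ ∨
            ∃ x₁ x₂ : ℝ → MinTime.Plane,
              MinTime.IsOptimalReversed F G τ x₁ ∧ MinTime.IsOptimalReversed F G τ x₂ ∧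
              (∃ t ∈ Icc 0 τ, x₁ t ≠ x₂ t) ∧
              MinTime.singularSet F G τ = x₁ '' Icc 0 τ ∪ x₂ '' Icc 0 τ) ∧
          ∀ x ∈ MinTime.singularSet F G τ, ∃ δ : ℝ, 0 < δ ∧
            0 < Measure.hausdorffMeasure 1 (MinTime.singularSet F G τ ∩ Metric.ball x δ) := by
  have hwedge := fun i => MinTime.wedge_ne_zero_of_rank_columns (hAB i)
  obtain ⟨C, hC⟩ := MinTime.exists_isNice L A B
  -- `1 ≤ C` is known only once a system is given, but the time bound must be chosen before.
  have hm : 0 < max C 1 := lt_max_of_lt_right one_pos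
  by_cases hpar : ∃ i j, MinTime.wedge (B i) (B j) ≠ 0
  · obtain ⟨i, j, hij⟩ := hpar
    refine ⟨1 / (4 * max C 1), by positivity, fun F G hF hG hF0 hDF hG0 hDG τ hτ hτT => ?_⟩
    have h := hC F G hF hG hF0 hDF hG0 hDG
    rw [max_eq_left h.one_le] at hm hτT
    obtain ⟨h1, h2⟩ := MinTime.singularSet_eq_empty_of_wedge_ne_zero h hij
      (T := 1 / (4 * C)) (by field_simp; rfl) hτT
    rw [h1, h2]
    exact ⟨rfl, MinTime.countablyRectifiable_empty 1, Or.inl rfl, fun x hx => hx.elim⟩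
  · push Not at hpar
    obtain ⟨e, β, ν, c, hp⟩ := MinTime.exists_isParallel (by omega) hwedge hpar
    have hc := hp.c_pos
    refine ⟨min (1 / (4 * max C 1)) (c ^ 3 / (256 * max C 1 ^ 5)), by positivity,
      fun F G hF hG hF0 hDF hG0 hDG τ hτ hτT => ?_⟩
    have h := hC F G hF hG hF0 hDF hG0 hDG
    rw [max_eq_left h.one_le] at hm hτT
    set T := min (1 / (4 * C)) (c ^ 3 / (256 * C ^ 5)) with hTdef
    have hT : MinTime.IsSmall C c T := by
      refine ⟨by positivity, ?_, ?_⟩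
      · calc C * T ≤ C * (1 / (4 * C)) := by gcongr; exact min_le_left _ _
          _ = 1 / 4 := by field_simp
      · calc 256 * C ^ 5 * T ≤ 256 * C ^ 5 * (c ^ 3 / (256 * C ^ 5)) := by
              gcongr; exact min_le_right _ _
          _ = c ^ 3 := by field_simp
    obtain ⟨X, Y, hXY⟩ := hp.exists_extremalPair h hT
    have hsm := hT.mono h.one_le hτ.le hτT.le
    have hX := hXY.trajX.mono hτT.le
    have hY := hXY.trajY.mono hτT.le
    have hS := hp.singularSet_eq h hT hXY hτT
    refine ⟨hp.singularSet_eq_nonLipschitz h hT hXY hτT, ?_, Or.inr ⟨X, Y,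
      hp.isOptimalReversed h hsm hXY.contX hX, hp.neg.isOptimalReversed h hsm hXY.contY hY,
      ⟨τ, ⟨hτ.le, le_rfl⟩, hp.extremal_ne h hsm hτ hXY.contX hX hY⟩, hS⟩, fun x hx => ?_⟩
    · rw [hS]
      exact MinTime.countablyRectifiable_image_union hτ.le (hp.lipschitzOnWith_extremal h hsm hX)
        (hp.neg.lipschitzOnWith_extremal h hsm hY)
    · refine ⟨1, one_pos, ?_⟩
      rw [hS] at hx ⊢
      rcases hx with ⟨t, ht, rfl⟩ | ⟨t, ht, rfl⟩
      · exact hp.hausdorffMeasure_pos h hsm hτ hXY.contX hX subset_union_left ht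
      · exact hp.neg.hausdorffMeasure_pos h hsm hτ hXY.contY hY subset_union_right ht
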